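/- Let $f$ be a rational function of degree $m\ge 2$ on the Riemann sphere $\widehat{\mathbb C}=\mathbb C\cup\{\infty\}$ with Julia set $\mathcal J$. Assume that $\infty\notin\mathcal J$, that $\mathcal J$ is totally disconnected, and that $f$ is hyperbolic: $\inf_{z\in\mathcal J}|(f^n)'(z)|>1$ for some $n\ge 1$. Regard $\mathcal J$ as a subset of $\mathbb R^2\subset\mathbb C^2$ by $x+iy\mapsto(x,y)$. For an open set $D\subset\mathbb C^2$ let $H^2(D)$ be the Hilbert space of holomorphic functions on $D$ that are square integrable for Lebesgue measure. (a) On some open neighbourhood $V\subset\mathbb C$ of $\mathcal J$ there are $m$ holomorphic inverse branches $g_1,\dots,g_m$ of $f$, that is, for every $z\in V$ the points $g_1(z),\dots,g_m(z)$ are distinct and $f^{-1}(z)=\{g_1(z),\dots,g_m(z)\}$. (b) For any such branches there is an open neighbourhood $\Omega\subset\mathbb C^2$ of $\mathcal J$ on which the maps $g_i:\mathbb R^2\to\mathbb R^2$ and the functions $\log|g_i'|$ extend holomorphically. Write $g_i:\Omega\to\mathbb C^2$ also for the extended map, $\log[g_i']$ for the extension of $\log|g_i'|$, and $[g_i']^s=\exp(s\log[g_i'])$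 for $s\in\mathbb C$. (c) For any such extensions, call $D=D_1\cup\dots\cup D_m$ admissible if $D_1,\dots,D_m\subset\mathbb C^2$ are pairwise disjoint open sets with $g_i(\mathcal J)\subset D_i$, the set $D$ is bounded with $\overline D\subset\Omega$, and $g_i(\overline D)\subset D_i$ for all $i$. Every neighbourhood of $\mathcal J$ in $\mathbb C^2$ contains an admissible $D\supset\mathcal J$. (d) For every admissible $D$ and every $s\in\mathbb C$ the formula $$\mathcal L(s)u(z)=\sum_{i=1}^m[g_i'(z)]^s\,u(g_i(z)),\qquad z\in D,$$ defines a bounded operator $\mathcal L(s):H^2(D)\to H^2(D)$. This operator is trace class: it is compact and the sum of its characteristic values (the eigenvalues of $(\mathcal L(s)^*\mathcal L(s))^{1/2}$, with multiplicity) is finite. The product $$Z(s)=\det(I-\mathcal L(s)):=\prod_l(1-\lambda_l(s))$$ over the eigenvalues $\lambda_l(s)$ of $\mathcal L(s)$, repeated according to algebraic multiplicity, converges absolutely, and there is a constant $C>0$, independent of $s$, such that $$|\det(I-\mathcal L(s))|\le C\exp(C|s|^3)\qquad\text{for all }s\in\mathbb C.$$ Moreover $Z$ is an entire function of order at most $3$.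 -/

import Mathlib

open MeasureTheory Set Filter Topology
open scoped ENNReal NNReal Real

noncomputable section

namespace RuelleZeta

/-! ### Rational maps of the Riemann sphere and their Julia sets -/

/-- The degree of a rational function (of the associated self-map of the sphere). -/
def ratDegree (f : RatFunc ℂ) : ℕ := max f.num.natDegree f.denom.natDegree

/-- The self-map of the Riemann sphere `ℂ ∪ {∞}` given by a rational function. -/
def ratMap (f : RatFunc ℂ) : OnePoint ℂ → OnePoint ℂ
  | OnePoint.infty =>
      if f.denom.natDegree < f.num.natDegree then OnePoint.infty
      else ((f.num.coeff f.denom.natDegree / f.denom.leadingCoeff : ℂ) : OnePoint ℂ)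
  | OnePoint.some z =>
      if f.denom.eval z = 0 then OnePoint.infty
      else ((f.num.eval z / f.denom.eval z : ℂ) : OnePoint ℂ)

/-- The Fatou set of a self-map `F` of the sphere: the largest open set on which the iterates of
`F` form an equicontinuous family. Equicontinuity refers to the unique uniform structure of the
compact Hausdorff space `ℂ ∪ {∞}`, that is, to the spherical metric. -/
def fatouSet (F : OnePoint ℂ → OnePoint ℂ) : Set (OnePoint ℂ) :=
  {p | ∃ U : Set (OnePoint ℂ), IsOpen U ∧ p ∈ U ∧ ∀ q ∈ U,
    @EquicontinuousAt ℕ (OnePoint ℂ) (OnePoint ℂ) _ uniformSpaceOfCompactR1 (fun n => F^[n]) q}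

/-- The Julia set of a rational function, as a subset of the sphere. -/
def juliaSet (f : RatFunc ℂ) : Set (OnePoint ℂ) := (fatouSet (ratMap f))ᶜ

/-- The finite part of the Julia set. -/
def juliaPlane (f : RatFunc ℂ) : Set ℂ := {z | (z : OnePoint ℂ) ∈ juliaSet f}

/-- The affine coordinate on the sphere (with value `0` at `∞`). -/
def toPlane : OnePoint ℂ → ℂ
  | OnePoint.infty => 0
  | OnePoint.some z => z

/-- `f` is hyperbolic: some iterate of `f` is uniformly expanding on the Julia set, i.e.
`inf {|(f^n)'(z)| : z ∈ J} > 1` for some `n ≥ 1`. It is used for Julia sets not containing `∞`;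
these are forward invariant, so that `f^n` is finite near every point of the Julia set. -/
def IsHyperbolic (f : RatFunc ℂ) : Prop :=
  ∃ n : ℕ, 1 ≤ n ∧ ∃ κ : ℝ, 1 < κ ∧ ∀ z ∈ juliaPlane f,
    κ ≤ ‖deriv (fun w : ℂ => toPlane ((ratMap f)^[n] (w : OnePoint ℂ))) z‖

/-! ### Inverse branches and their holomorphic extensions to `ℂ²` -/

/-- `g 0, …, g (m - 1)`, with `m` the degree of `f`, are the `m` holomorphic inverse branches of
`f` on the open neighbourhood `V` of the Julia set: over every `z ∈ V` they list the `m` distinct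
points of `f⁻¹(z)`. -/
structure IsInverseBranches (f : RatFunc ℂ) (V : Set ℂ) (g : Fin (ratDegree f) → ℂ → ℂ) :
    Prop where
  isOpen : IsOpen V
  julia_subset : juliaPlane f ⊆ V
  differentiableOn : ∀ i, DifferentiableOn ℂ (g i) V
  preimage_eq : ∀ z ∈ V, ratMap f ⁻¹' {(z : OnePoint ℂ)} = range fun i => (g i z : OnePoint ℂ)
  injective : ∀ z ∈ V, Function.Injective fun i => g i z

/-- The inclusion `ℂ = ℝ² ⊆ ℂ²`, `x + i y ↦ (x, y)`. -/
def realEmb (z : ℂ) : ℂ × ℂ := ((z.re : ℂ), (z.im : ℂ))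

/-- The Julia set as a subset of `ℝ² ⊆ ℂ²`. -/
def juliaReal (f : RatFunc ℂ) : Set (ℂ × ℂ) := realEmb '' juliaPlane f

/-- On the open neighbourhood `Ω ⊆ ℂ²` of the Julia set, `G i : Ω → ℂ²` is a holomorphic extension
of the real analytic map `g i : ℝ² → ℝ²`, and `Λ i : Ω → ℂ` is a holomorphic extension of the real
analytic function `log |(g i)'|`. So `exp (Λ i)` is the holomorphic extension `[(g i)']` of
`|(g i)'|`, and `exp (s Λ i)` is its power `[(g i)'] ^ s`, in the branch that is positive on `ℝ²`
for real `s`. -/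
structure IsHolomorphicExtension (f : RatFunc ℂ) (V : Set ℂ) (g : Fin (ratDegree f) → ℂ → ℂ)
    (Ω : Set (ℂ × ℂ)) (G : Fin (ratDegree f) → ℂ × ℂ → ℂ × ℂ)
    (Λ : Fin (ratDegree f) → ℂ × ℂ → ℂ) : Prop where
  isOpen : IsOpen Ω
  julia_subset : juliaReal f ⊆ Ω
  differentiableOn_map : ∀ i, DifferentiableOn ℂ (G i) Ω
  differentiableOn_log : ∀ i, DifferentiableOn ℂ (Λ i) Ω
  map_eq : ∀ i, ∀ z ∈ V, realEmb z ∈ Ω → G i (realEmb z) = realEmb (g i z)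
  log_eq : ∀ i, ∀ z ∈ V, realEmb z ∈ Ω → Λ i (realEmb z) = (Real.log ‖deriv (g i) z‖ : ℂ)

/-- `D 0, …, D (m - 1)` are disjoint open neighbourhoods of the pieces `J_i = g_i(J)` of the Julia
set, their union `D` is bounded with closure in `Ω`, and `G i` maps the closure of `D` into
`D i`. -/
structure IsAdmissible (f : RatFunc ℂ) (g : Fin (ratDegree f) → ℂ → ℂ)
    (Ω : Set (ℂ × ℂ)) (G : Fin (ratDegree f) → ℂ × ℂ → ℂ × ℂ)
    (D : Fin (ratDegree f) → TopologicalSpace.Opens (ℂ × ℂ)) : Prop where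
  isBounded : Bornology.IsBounded ((⨆ i, D i : TopologicalSpace.Opens (ℂ × ℂ)) : Set (ℂ × ℂ))
  closure_subset : closure ((⨆ i, D i : TopologicalSpace.Opens (ℂ × ℂ)) : Set (ℂ × ℂ)) ⊆ Ω
  disjoint : ∀ i j, i ≠ j → Disjoint (D i : Set (ℂ × ℂ)) (D j : Set (ℂ × ℂ))
  julia_subset : ∀ i, ∀ z ∈ juliaPlane f, realEmb (g i z) ∈ D i
  mapsTo : ∀ i, MapsTo (G i)
    (closure ((⨆ i, D i : TopologicalSpace.Opens (ℂ × ℂ)) : Set (ℂ × ℂ))) (D i)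

/-! ### The Bergman space -/

lemma rot_mp (θ : ℝ) : MeasurePreserving
    (fun v : ℂ × ℂ => (circleMap 0 1 θ) • v) (volume : Measure (ℂ × ℂ)) volume := by
  have h1 : MeasurePreserving (fun v : ℂ => circleMap 0 1 θ * v) volume volume := by
    have := (rotation (Circle.exp θ)).measurePreserving
    have e : (fun v : ℂ => circleMap 0 1 θ * v) = rotation (Circle.exp θ) := by
      ext v
      simp [circleMap]
    rw [e]
    exact this
  exact h1.prod h1

lemma sq_mean (F : ℂ × ℂ → ℂ) (w v : ℂ × ℂ) (D : Set (ℂ × ℂ)) (hD : IsOpen D)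
    (hF : DifferentiableOn ℂ F D) (R : ℝ) (hR : Metric.closedBall w R ⊆ D)
    (hv : v ∈ Metric.ball (0 : ℂ × ℂ) R) :
    ‖F w‖ₑ ^ 2 ≤ ENNReal.ofReal (2 * π)⁻¹ *
      ∫⁻ θ in Ioc 0 (2 * π), ‖F (w + circleMap 0 1 θ • v)‖ₑ ^ 2 := by
  set h : ℂ → ℂ := fun t => F (w + t • v) ^ 2 with hh
  have hmem : ∀ t ∈ Metric.closedBall (0 : ℂ) 1, w + t • v ∈ D := by
    intro t ht
    apply hR
    simp only [mem_closedBall_zero_iff, mem_ball_zero_iff] at ht hv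
    rw [mem_closedBall_iff_norm]
    simp only [add_sub_cancel_left, norm_smul]
    nlinarith [norm_nonneg v, norm_nonneg t]
  have hd : DifferentiableOn ℂ h (Metric.closedBall 0 1) := by
    intro t ht
    have h1 : DifferentiableAt ℂ F (w + t • v) := (hF _ (hmem t ht)).differentiableAt
      (hD.mem_nhds (hmem t ht))
    have h2 : DifferentiableAt ℂ (fun t : ℂ => w + t • v) t := by fun_prop
    exact ((h1.comp t h2).pow 2).differentiableWithinAt
  have hc : DiffContOnCl ℂ h (Metric.ball 0 |1|) := by
    rw [abs_one]
    apply DifferentiableOn.diffContOnCl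
    rwa [closure_ball _ one_ne_zero]
  have hm := hc.circleAverage
  rw [Real.circleAverage_def] at hm
  have h0 : h 0 = F w ^ 2 := by simp [hh]
  rw [h0] at hm
  have : ‖F w‖ₑ ^ 2 = ‖F w ^ 2‖ₑ := by simp
  rw [this, ← hm, enorm_smul, intervalIntegral.integral_of_le (by positivity)]
  have e : ‖(2 * π)⁻¹‖ₑ = ENNReal.ofReal (2 * π)⁻¹ :=
    Real.enorm_of_nonneg (by positivity)
  rw [e]
  gcongr
  refine (enorm_integral_le_lintegral_enorm _).trans (le_of_eq ?_)
  simp [hh]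

lemma mean_ineq (F : ℂ × ℂ → ℂ) (w : ℂ × ℂ) (D : Set (ℂ × ℂ)) (hD : IsOpen D)
    (hF : DifferentiableOn ℂ F D) (R : ℝ) (hR : Metric.closedBall w R ⊆ D) :
    ‖F w‖ₑ ^ 2 * volume (Metric.ball (0 : ℂ × ℂ) R) ≤ ∫⁻ z in D, ‖F z‖ₑ ^ 2 := by
  set Φ : ℂ × ℂ → ℝ≥0∞ := (Metric.ball w R).indicator (fun z => ‖F z‖ₑ ^ 2) with hΦ
  have hsub : Metric.ball w R ⊆ D := Metric.ball_subset_closedBall.trans hR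
  have hΦm : Measurable Φ := by
    have hcont : ContinuousOn F (Metric.ball w R) := hF.continuousOn.mono hsub
    have hG : Measurable ((Metric.ball w R).indicator F) := by
      classical
      rw [← Set.piecewise_eq_indicator]
      exact hcont.measurable_piecewise continuousOn_const measurableSet_ball
    have : Φ = fun z => ‖(Metric.ball w R).indicator F z‖ₑ ^ 2 := by
      ext z
      by_cases hz : z ∈ Metric.ball w R <;> simp [hΦ, hz]
    rw [this]
    exact hG.enorm.pow_const 2
  have hint : ∫⁻ z, Φ z ≤ ∫⁻ z in D, ‖F z‖ₑ ^ 2 := by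
    rw [hΦ, lintegral_indicator measurableSet_ball]
    exact lintegral_mono_set hsub
  refine le_trans ?_ hint
  have hpt : ∀ v ∈ Metric.ball (0 : ℂ × ℂ) R, ‖F w‖ₑ ^ 2 ≤ ENNReal.ofReal (2 * π)⁻¹ *
      ∫⁻ θ in Ioc 0 (2 * π), Φ (w + circleMap 0 1 θ • v) := by
    intro v hv
    refine (sq_mean F w v D hD hF R hR hv).trans (le_of_eq ?_)
    congr 2
    ext θ
    rw [hΦ, indicator_of_mem]
    rw [mem_ball_iff_norm]
    simpa [norm_smul] using hv
  have hjm : Measurable (Function.uncurry fun (v : ℂ × ℂ) (θ : ℝ) =>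
      Φ (w + circleMap 0 1 θ • v)) := by
    apply hΦm.comp
    apply Continuous.measurable
    have := continuous_circleMap 0 1
    fun_prop
  calc ‖F w‖ₑ ^ 2 * volume (Metric.ball (0 : ℂ × ℂ) R)
      = ∫⁻ v in Metric.ball (0 : ℂ × ℂ) R, ‖F w‖ₑ ^ 2 := by simp
    _ ≤ ∫⁻ v in Metric.ball (0 : ℂ × ℂ) R, ENNReal.ofReal (2 * π)⁻¹ *
          ∫⁻ θ in Ioc 0 (2 * π), Φ (w + circleMap 0 1 θ • v) :=
        setLIntegral_mono' measurableSet_ball hpt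
    _ ≤ ∫⁻ v : ℂ × ℂ, ENNReal.ofReal (2 * π)⁻¹ *
          ∫⁻ θ in Ioc 0 (2 * π), Φ (w + circleMap 0 1 θ • v) := setLIntegral_le_lintegral _ _
    _ = ENNReal.ofReal (2 * π)⁻¹ * ∫⁻ θ in Ioc 0 (2 * π), ∫⁻ v : ℂ × ℂ,
          Φ (w + circleMap 0 1 θ • v) := by
        rw [lintegral_const_mul', lintegral_lintegral_swap hjm.aemeasurable]
        exact ENNReal.ofReal_ne_top
    _ = ENNReal.ofReal (2 * π)⁻¹ * ∫⁻ θ in Ioc 0 (2 * π), ∫⁻ v : ℂ × ℂ, Φ v := by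
        congr 2
        ext θ
        rw [(rot_mp θ).lintegral_comp (f := fun v => Φ (w + v)) (hΦm.comp (measurable_const_add w))]
        have : (volume : Measure (ℂ × ℂ)).IsAddLeftInvariant := by
          rw [Measure.volume_eq_prod]; infer_instance
        exact lintegral_add_left_eq_self Φ w
    _ = ∫⁻ v : ℂ × ℂ, Φ v := by
        rw [lintegral_const, Measure.restrict_apply_univ, Real.volume_Ioc, mul_comm, mul_assoc,
          sub_zero, ← ENNReal.ofReal_mul (by positivity),
          mul_inv_cancel₀ (by positivity), ENNReal.ofReal_one, mul_one]

/-- Point evaluations on a Bergman space are locally bounded. -/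
lemma sup_bound {D : Set (ℂ × ℂ)} (hD : IsOpen D) {R : ℝ} (hR : 0 < R) :
    ∃ C : ℝ, 0 ≤ C ∧ ∀ (w : ℂ × ℂ), Metric.closedBall w R ⊆ D →
      ∀ (u : Lp ℂ 2 (volume.restrict D)) (F : ℂ × ℂ → ℂ), DifferentiableOn ℂ F D →
        u =ᵐ[volume.restrict D] F → ‖F w‖ ≤ C * ‖u‖ := by
  set V := volume (Metric.ball (0 : ℂ × ℂ) R)
  have hV0 : V ≠ 0 := (Metric.measure_ball_pos _ _ hR).ne'
  have hVt : V ≠ ∞ := measure_ball_lt_top.ne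
  refine ⟨Real.sqrt (V.toReal)⁻¹, Real.sqrt_nonneg _, fun w hw u F hF hu => ?_⟩
  have h1 := mean_ineq F w D hD hF R hw
  have h2 : ∫⁻ z in D, ‖F z‖ₑ ^ 2 = ‖u‖ₑ ^ 2 := by
    rw [Lp.enorm_def, eLpNorm_congr_ae hu,
      eLpNorm_eq_lintegral_rpow_enorm_toReal two_ne_zero ENNReal.ofNat_ne_top]
    rw [← ENNReal.rpow_natCast, ← ENNReal.rpow_mul]
    simp
  rw [h2] at h1
  have h3 := ENNReal.toReal_mono (by finiteness) h1
  simp only [ENNReal.toReal_mul, ENNReal.toReal_pow, toReal_enorm] at h3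
  have hVp : 0 < V.toReal := ENNReal.toReal_pos hV0 hVt
  apply le_of_sq_le_sq _ (by positivity)
  rw [mul_pow, Real.sq_sqrt (by positivity), inv_mul_eq_div, le_div_iff₀ hVp]
  exact h3

lemma fderiv_bound {F : ℂ × ℂ → ℂ} {w : ℂ × ℂ} {r M : ℝ} (hr : 0 < r) (hM : 0 ≤ M)
    (hF : ∀ z ∈ Metric.closedBall w r, DifferentiableAt ℂ F z)
    (hb : ∀ z ∈ Metric.closedBall w r, ‖F z‖ ≤ M) : ‖fderiv ℂ F w‖ ≤ M / r := by
  refine ContinuousLinearMap.opNorm_le_of_shell (ε := 2) (c := (2 : ℂ)) (by norm_num) (by positivity) (by simp) ?_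
  intro v _ _
  by_cases hv : v = 0
  · simp [hv]
  have hvp : 0 < ‖v‖ := norm_pos_iff.2 hv
  have hmem : ∀ t ∈ Metric.closedBall (0 : ℂ) (r / ‖v‖), w + t • v ∈ Metric.closedBall w r := by
    intro t ht
    rw [mem_closedBall_zero_iff, le_div_iff₀ hvp] at ht
    rw [mem_closedBall_iff_norm]
    simpa [norm_smul] using ht
  have hdiff : ∀ t ∈ Metric.closedBall (0 : ℂ) (r / ‖v‖), HasDerivAt (fun t : ℂ => F (w + t • v))
      (fderiv ℂ F (w + t • v) v) t := by
    intro t ht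
    have h1 := (hF _ (hmem t ht)).hasFDerivAt
    have h2 : HasDerivAt (fun t : ℂ => w + t • v) v t := by
      simpa using ((hasDerivAt_id t).smul_const v).const_add w
    exact h1.comp_hasDerivAt t h2
  have hrv : 0 < r / ‖v‖ := by positivity
  have := Complex.norm_deriv_le_of_forall_mem_sphere_norm_le (c := 0) (R := r / ‖v‖) (C := M)
    (f := fun t : ℂ => F (w + t • v)) hrv
    (by
      apply DifferentiableOn.diffContOnCl
      rw [closure_ball _ hrv.ne']
      exact fun t ht => (hdiff t ht).differentiableAt.differentiableWithinAt)
    (fun t ht => hb _ (hmem t (Metric.sphere_subset_closedBall ht)))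
  rw [(hdiff 0 (by simp [hrv.le])).deriv] at this
  simp only [zero_smul, add_zero] at this
  calc ‖fderiv ℂ F w v‖ ≤ M / (r / ‖v‖) := this
    _ = M / r * ‖v‖ := by field_simp

/-- The Bergman space `H²(D)` of the square integrable holomorphic functions on an open set
`D ⊆ ℂ²`, as a subspace of `L²(D)` for Lebesgue measure. -/
def bergmanSpace (D : TopologicalSpace.Opens (ℂ × ℂ)) :
    Submodule ℂ (Lp ℂ 2 ((volume : Measure (ℂ × ℂ)).restrict D)) where
  carrier := {u | ∃ F : ℂ × ℂ → ℂ, DifferentiableOn ℂ F D ∧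
    u =ᵐ[(volume : Measure (ℂ × ℂ)).restrict D] F}
  zero_mem' := ⟨0, differentiableOn_const 0, Lp.coeFn_zero ..⟩
  add_mem' := by
    rintro u v ⟨F, hF, hu⟩ ⟨G, hG, hv⟩
    exact ⟨F + G, hF.add hG, (Lp.coeFn_add u v).trans (hu.add hv)⟩
  smul_mem' := by
    rintro c u ⟨F, hF, hu⟩
    exact ⟨c • F, hF.const_smul c, (Lp.coeFn_smul c u).trans (hu.const_smul c)⟩

/-- The holomorphic function on `D` that an element of `H²(D)` is (its values off `D` are
irrelevant). -/
def holRep {D : TopologicalSpace.Opens (ℂ × ℂ)} (u : bergmanSpace D) : ℂ × ℂ → ℂ :=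
  Classical.choose u.2

theorem holRep_differentiableOn {D : TopologicalSpace.Opens (ℂ × ℂ)} (u : bergmanSpace D) :
    DifferentiableOn ℂ (holRep u) D := (Classical.choose_spec u.2).1

theorem holRep_ae_eq {D : TopologicalSpace.Opens (ℂ × ℂ)} (u : bergmanSpace D) :
    (u : Lp ℂ 2 ((volume : Measure (ℂ × ℂ)).restrict D))
      =ᵐ[(volume : Measure (ℂ × ℂ)).restrict D] holRep u := (Classical.choose_spec u.2).2

theorem isClosed_bergmanSpace (D : TopologicalSpace.Opens (ℂ × ℂ)) :
    IsClosed (bergmanSpace D : Set (Lp ℂ 2 ((volume : Measure (ℂ × ℂ)).restrict D))) := by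
  apply IsSeqClosed.isClosed
  intro U u hU hlim
  choose F hF hUF using hU
  have hD := D.isOpen
  -- Cauchy estimate
  have hdiff : ∀ n m, DifferentiableOn ℂ (F n - F m) D := fun n m => (hF n).sub (hF m)
  have hrep : ∀ n m, (U n - U m : Lp ℂ 2 ((volume : Measure (ℂ × ℂ)).restrict D))
      =ᵐ[(volume : Measure (ℂ × ℂ)).restrict D] (F n - F m) := fun n m =>
    (Lp.coeFn_sub (U n) (U m)).trans ((hUF n).sub (hUF m))
  have hball : ∀ z ∈ D, ∃ R > 0, Metric.closedBall z (3 * R) ⊆ D := by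
    intro z hz
    obtain ⟨ε, hε, h⟩ := Metric.nhds_basis_closedBall.mem_iff.1 (hD.mem_nhds hz)
    exact ⟨ε / 3, by positivity, by convert h using 2; ring⟩
  have hloc : ∀ z ∈ D, ∃ s, IsOpen s ∧ z ∈ s ∧ s ⊆ D ∧
      UniformCauchySeqOn F atTop s ∧ UniformCauchySeqOn (fun n => fderiv ℂ (F n)) atTop s := by
    intro z hz
    obtain ⟨R, hR, hRD⟩ := hball z hz
    obtain ⟨C, hC, hsup⟩ := sup_bound hD hR
    have hsup2 : ∀ w ∈ Metric.closedBall z (2 * R), ∀ n m, ‖F n w - F m w‖ ≤ C * ‖U n - U m‖ := by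
      intro w hw n m
      refine hsup w ((Metric.closedBall_subset_closedBall' ?_).trans hRD) _ _ (hdiff n m) (hrep n m)
      have := Metric.mem_closedBall.1 hw
      linarith
    have hsD : Metric.closedBall z (2 * R) ⊆ D :=
      (Metric.closedBall_subset_closedBall (by linarith)).trans hRD
    have hder : ∀ w ∈ Metric.ball z R, ∀ n m,
        ‖fderiv ℂ (F n) w - fderiv ℂ (F m) w‖ ≤ C * ‖U n - U m‖ / R := by
      intro w hw n m
      have hsub : Metric.closedBall w R ⊆ Metric.closedBall z (2 * R) :=
        Metric.closedBall_subset_closedBall' (by have := Metric.mem_ball.1 hw; linarith)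
      have hda : ∀ k, ∀ x ∈ Metric.closedBall w R, DifferentiableAt ℂ (F k) x := fun k x hx =>
        (hF k).differentiableAt (hD.mem_nhds (hsD (hsub hx)))
      have hww : w ∈ Metric.closedBall w R := Metric.mem_closedBall_self hR.le
      rw [← fderiv_sub (hda n w hww) (hda m w hww)]
      exact fderiv_bound hR (by positivity) (fun x hx => (hda n x hx).sub (hda m x hx))
        (fun x hx => hsup2 x (hsub hx) n m)
    have hcau : CauchySeq U := hlim.cauchySeq
    have hcau' : ∀ K : ℝ, ∀ ε > 0, ∃ N, ∀ n ≥ N, ∀ m ≥ N, K * ‖U n - U m‖ < ε := by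
      intro K ε hε
      obtain ⟨N, hN⟩ := Metric.cauchySeq_iff.1 hcau (ε / (|K| + 1)) (by positivity)
      refine ⟨N, fun n hn m hm => ?_⟩
      have := hN n hn m hm
      rw [dist_eq_norm, lt_div_iff₀ (by positivity)] at this
      nlinarith [le_abs_self K, norm_nonneg (U n - U m)]
    refine ⟨Metric.ball z R, Metric.isOpen_ball, Metric.mem_ball_self hR,
      (Metric.ball_subset_closedBall.trans
        (Metric.closedBall_subset_closedBall (by linarith))).trans hsD, ?_, ?_⟩
    · rw [Metric.uniformCauchySeqOn_iff]
      intro ε hε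
      obtain ⟨N, hN⟩ := hcau' C ε hε
      refine ⟨N, fun n hn m hm x hx => ?_⟩
      rw [dist_eq_norm]
      refine (hsup2 x ?_ n m).trans_lt (hN n hn m hm)
      exact Metric.closedBall_subset_closedBall (by linarith) (Metric.ball_subset_closedBall hx)
    · rw [Metric.uniformCauchySeqOn_iff]
      intro ε hε
      obtain ⟨N, hN⟩ := hcau' (C / R) ε hε
      refine ⟨N, fun n hn m hm x hx => ?_⟩
      rw [dist_eq_norm]
      refine (hder x hx n m).trans_lt ?_
      have := hN n hn m hm
      rwa [div_mul_eq_mul_div] at this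
  -- pointwise limits
  have hpt : ∀ z ∈ D, ∃ y, Tendsto (fun n => F n z) atTop (𝓝 y) := by
    intro z hz
    obtain ⟨s, -, hzs, -, h, -⟩ := hloc z hz
    exact cauchySeq_tendsto_of_complete (h.cauchy_map hzs)
  have hpt' : ∀ z ∈ D, ∃ y, Tendsto (fun n => fderiv ℂ (F n) z) atTop (𝓝 y) := by
    intro z hz
    obtain ⟨s, -, hzs, -, -, h⟩ := hloc z hz
    exact cauchySeq_tendsto_of_complete (h.cauchy_map hzs)
  choose! G hG using hpt
  choose! G' hG' using hpt'
  refine ⟨G, ?_, ?_⟩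
  · intro z hz
    obtain ⟨s, hs, hzs, hsD, -, h⟩ := hloc z hz
    have := hasFDerivAt_of_tendstoUniformlyOn hs
      (h.tendstoUniformlyOn_of_tendsto fun x hx => hG' x (hsD hx))
      (fun n x hx => ((hF n).differentiableAt (hD.mem_nhds (hsD hx))).hasFDerivAt)
      (fun x hx => hG x (hsD hx)) hzs
    exact this.differentiableAt.differentiableWithinAt
  · obtain ⟨ns, hns, hae⟩ := (tendstoInMeasure_of_tendsto_Lp hlim).exists_seq_tendsto_ae
    have hall : ∀ᵐ x ∂((volume : Measure (ℂ × ℂ)).restrict D), ∀ n, U n x = F n x :=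
      ae_all_iff.2 hUF
    filter_upwards [hae, hall, ae_restrict_mem hD.measurableSet] with x hx hx' hxD
    refine tendsto_nhds_unique hx ?_
    simp only [hx']
    exact (hG x hxD).comp hns.tendsto_atTop

/-- `H²(D)` is a Hilbert space. -/
instance instCompleteSpaceBergman (D : TopologicalSpace.Opens (ℂ × ℂ)) : CompleteSpace (bergmanSpace D) :=
  (isClosed_bergmanSpace D).completeSpace_coe

/-! ### Trace class operators and determinants -/

section Operators

variable {H : Type*} [NormedAddCommGroup H] [InnerProductSpace ℂ H]

/-- `A` is trace class: it is compact and the sum of its characteristic values, the eigenvalues of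
`(A* A)^(1/2)` repeated according to multiplicity, is finite. -/
def IsTraceClass [CompleteSpace H] (A : H →L[ℂ] H) : Prop :=
  IsCompactOperator A ∧
    Summable fun ν : {ν : ℝ // 0 < ν} =>
      (Module.finrank ℂ (Module.End.eigenspace ((CFC.abs A : H →L[ℂ] H) : H →ₗ[ℂ] H) ((ν : ℝ) : ℂ)) : ℝ) * ν

/-- The algebraic multiplicity of `μ` as an eigenvalue of `A` (`0` if it is not an eigenvalue). -/
def algMult (A : H →L[ℂ] H) (μ : ℂ) : ℕ :=
  Module.finrank ℂ (Module.End.maxGenEigenspace (A : H →ₗ[ℂ] H) μ)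

/-- `det (I + A) = ∏ (1 + λ)`, the product over the eigenvalues `λ` of `A` repeated according to
algebraic multiplicity (eigenvalue `0` contributes the factor `1`). -/
def detOneAdd (A : H →L[ℂ] H) : ℂ :=
  ∏' μ : {μ : ℂ // μ ≠ 0}, (1 + (μ : ℂ)) ^ algMult A μ

/-- The eigenvalue product for `det (I + A)` converges absolutely. -/
def DetConverges (A : H →L[ℂ] H) : Prop :=
  Summable fun μ : {μ : ℂ // μ ≠ 0} => (algMult A μ : ℝ) * ‖(μ : ℂ)‖

end Operators

/-- The order of growth of an entire function: the infimum of the `ρ ≥ 0` for which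
`F(s) = O(exp(|s|^ρ))` as `|s| → ∞`. -/
def entireOrder (F : ℂ → ℂ) : ℝ≥0∞ :=
  ⨅ (ρ : ℝ≥0) (_ : F =O[cocompact ℂ] fun s => Real.exp (‖s‖ ^ (ρ : ℝ))), (ρ : ℝ≥0∞)

/-- The operator `T` on `H²(D)` is the transfer operator
`u ↦ ∑ i, [(g i)'] ^ s * (u ∘ g i)` with parameter `s`, where `[(g i)'] ^ s = exp (s Λ i)`. -/
def IsTransferOperator {m : ℕ} (D : TopologicalSpace.Opens (ℂ × ℂ))
    (G : Fin m → ℂ × ℂ → ℂ × ℂ) (Λ : Fin m → ℂ × ℂ → ℂ) (s : ℂ)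
    (T : bergmanSpace D →L[ℂ] bergmanSpace D) : Prop :=
  ∀ u : bergmanSpace D, ∀ z ∈ D,
    holRep (T u) z = ∑ i, Complex.exp (s * Λ i z) * holRep u (G i z)

end RuelleZeta

end

open RuelleZeta

noncomputable section

namespace RuelleZeta

/-! ### Infinite determinants -/

/-! The transfer operator is a sum of rank one operators that decay geometrically in a
two-dimensional array. The claims about `Z` are read off from this expansion. On an admissible
domain the maps `G i` send `D` into a compact `K ⊆ D`. Cover `K` by finitely many balls of radius
`r` and expand `u ∘ G i` in a Taylor series at the centre of the ball that `G i z` lies in. The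
coefficients are bounded functionals of `u` of size `(2r)^(-a-b)`, the monomials have size
`r^(a+b)`. So `L s = ∑ ⟪x k, ·⟫ y s k` with `k = (t, a, b)`, where `‖x k‖` and `‖y s k‖` are at most
`K e^(-c(a+b))` and `K e^(K|s| - c(a+b))` for some constant `K`
(`IsContractingSystem.exists_geometricFamily`). The determinant of the infinite matrix `1 - ⟪x k, y
s l⟫` is then bounded by the product of its absolute row sums, hence by `∏ (1 + e^(T - c(a+b)))`
with `T = O(1 + |s|)`. Only `O(T²)` factors are large and each is at most about `e^T`, which gives
`exp(O(T³))` (`prod_one_add_exp_mul_pow_le`). The finite sections are entire in `s` and converge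
locally uniformly, so the infinite determinant is entire (`differentiable_infDet`). It remains to
see that the eigenvalue product equals the matrix determinant, a theorem of Lidskii type
(`NuclearRep.detOneAdd_eq_infDet`). Compress `A` to a large finite dimensional `V` containing the
spectral subspace `E` of the eigenvalues of modulus at least `ρ`. The determinant of the compression
is close to the matrix determinant. It factors into the product over `E`, close to the full
eigenvalue product, and a product over eigenvalues of modulus below `ρ`, close to `1`. The last
point holds because the product `∏ (1 + t l)` has growth order at most `1/2` in `t`, so the
Borel-Carathéodory inequality applies to its logarithm. Absolute convergence and trace class both
follow from one estimate for sums of matrix coefficients (`NuclearRep.sum_norm_inner_le`). The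
geometric input is as follows. Hyperbolicity excludes critical points on `J`, so each fibre over `J`
has `m` simple points and branches exist locally; total disconnectedness allows gluing them
(`exists_isInverseBranches`). In the coordinates `x + iy`, `x - iy` of `ℂ²` the branch `g` extends
as `g` in the first and its conjugate in the second
(`IsInverseBranches.exists_isHolomorphicExtension`). The derivative of the extension on `J` is
diagonal there, with entries of modulus `|g'|`, so a metric on `J` in which the branches contract
gives a tube around `J` that they map into itself (`IsHolomorphicExtension.exists_isAdmissible`). -/

lemma norm_det_le_prod_sum {n : Type*} [Fintype n] [DecidableEq n] (P : Matrix n n ℂ) :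
    ‖P.det‖ ≤ ∏ i, ∑ j, ‖P i j‖ := by
  rw [Matrix.det_apply, Finset.prod_univ_sum, Fintype.piFinset_univ]
  calc ‖∑ σ : Equiv.Perm n, Equiv.Perm.sign σ • ∏ i, P (σ i) i‖
      ≤ ∑ σ : Equiv.Perm n, ∏ i, ‖P (σ i) i‖ := by
        refine (norm_sum_le _ _).trans (Finset.sum_le_sum fun σ _ => ?_)
        rw [← norm_prod]
        rcases Int.units_eq_one_or (Equiv.Perm.sign σ) with h | h <;> simp [h]
    _ = ∑ σ : Equiv.Perm n, ∏ i, ‖P i (σ i)‖ := by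
        rw [← Equiv.sum_comp (Equiv.inv (Equiv.Perm n))]
        refine Finset.sum_congr rfl fun σ _ => ?_
        rw [← Equiv.prod_comp σ]
        simp
    _ = ∑ f ∈ Finset.univ.image (fun σ : Equiv.Perm n => (σ : n → n)), ∏ i, ‖P i (f i)‖ := by
        rw [Finset.sum_image]
        exact fun σ _ τ _ h => DFunLike.coe_injective h
    _ ≤ ∑ f : n → n, ∏ i, ‖P i (f i)‖ :=
        Finset.sum_le_sum_of_subset_of_nonneg (Finset.subset_univ _)
          fun _ _ _ => Finset.prod_nonneg fun _ _ => norm_nonneg _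

/-- The determinant of the leading `n × n` section of the infinite matrix `1 + M`. -/
def secDet (M : ℕ → ℕ → ℂ) (n : ℕ) : ℂ :=
  (1 + Matrix.of fun i j : Fin n => M i j).det

/-- The determinant of the infinite matrix `1 + M`. -/
def infDet (M : ℕ → ℕ → ℂ) : ℂ := limUnder atTop (secDet M)

/-- The absolute row sums of the leading sections of `M` are bounded by `b`. -/
def RowBound (M : ℕ → ℕ → ℂ) (b : ℕ → ℝ) : Prop :=
  ∀ i n, ∑ j ∈ Finset.range n, ‖M i j‖ ≤ b i

lemma RowBound.nonneg {M : ℕ → ℕ → ℂ} {b : ℕ → ℝ} (h : RowBound M b) (i : ℕ) : 0 ≤ b i := by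
  simpa using h i 0

lemma RowBound.sum_fin {M : ℕ → ℕ → ℂ} {b : ℕ → ℝ} (h : RowBound M b) (i n : ℕ) :
    ∑ j : Fin n, ‖M i j‖ ≤ b i := by
  rw [Fin.sum_univ_eq_sum_range fun j => ‖M i j‖]
  exact h i n

lemma sum_norm_one_add_le {M : ℕ → ℕ → ℂ} {b : ℕ → ℝ} (h : RowBound M b) {n : ℕ} (i : Fin n) :
    ∑ j : Fin n, ‖(1 + Matrix.of fun i j : Fin n => M i j) i j‖ ≤ 1 + b i := by
  calc ∑ j : Fin n, ‖(1 + Matrix.of fun i j : Fin n => M i j) i j‖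
      ≤ ∑ j : Fin n, (‖(1 : Matrix (Fin n) (Fin n) ℂ) i j‖ + ‖M i j‖) :=
        Finset.sum_le_sum fun j _ => norm_add_le _ _
    _ ≤ 1 + b i := by
        rw [Finset.sum_add_distrib]
        refine add_le_add (le_of_eq ?_) (h.sum_fin i n)
        rw [Finset.sum_eq_single i] <;> simp +contextual [eq_comm]

lemma norm_secDet_le {M : ℕ → ℕ → ℂ} {b : ℕ → ℝ} (h : RowBound M b) (n : ℕ) :
    ‖secDet M n‖ ≤ ∏ i ∈ Finset.range n, (1 + b i) := by
  refine (norm_det_le_prod_sum _).trans ?_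
  rw [← Fin.prod_univ_eq_prod_range fun i => 1 + b i]
  exact Finset.prod_le_prod (fun _ _ => Finset.sum_nonneg fun _ _ => norm_nonneg _)
    fun i _ => sum_norm_one_add_le h i

/-- The last row of the larger section is a unit vector plus the last row of `M`, and the
determinant is additive in that row. The unit vector reproduces the smaller section; the remaining
determinant carries the factor `b n`. -/
lemma norm_secDet_succ_sub_le {M : ℕ → ℕ → ℂ} {b : ℕ → ℝ} (h : RowBound M b) (n : ℕ) :
    ‖secDet M (n + 1) - secDet M n‖ ≤ b n * ∏ i ∈ Finset.range n, (1 + b i) := by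
  set Q : Matrix (Fin (n + 1)) (Fin (n + 1)) ℂ :=
    1 + Matrix.of fun i j : Fin (n + 1) => M i j with hQ
  have h1 : Q = Q.updateRow (Fin.last n)
      (Pi.single (Fin.last n) 1 + fun j : Fin (n + 1) => M n j) := by
    ext i j
    by_cases hi : i = Fin.last n
    · subst hi
      simp [hQ, Matrix.one_apply, Pi.single_apply, eq_comm]
    · rw [Matrix.updateRow_ne hi]
  have h2 : (Q.updateRow (Fin.last n) (Pi.single (Fin.last n) 1)).det = secDet M n := by
    rw [Matrix.det_succ_row _ (Fin.last n), Finset.sum_eq_single (Fin.last n)]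
    · simp only [Fin.val_last, Matrix.updateRow_self, Pi.single_eq_same, mul_one, secDet]
      rw [← two_mul, pow_mul]
      simp only [even_two, Even.neg_pow, one_pow, one_mul]
      congr 1
      ext i j
      simp [hQ, Matrix.one_apply]
    · intro j _ hj
      simp [hj]
    · simp
  have h3 : secDet M (n + 1) - secDet M n =
      (Q.updateRow (Fin.last n) fun j : Fin (n + 1) => M n j).det := by
    rw [← h2]
    change Q.det - _ = _
    conv_lhs => rw [h1]
    rw [Matrix.det_updateRow_add]
    simp
  rw [h3]
  refine (norm_det_le_prod_sum _).trans ?_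
  rw [Fin.prod_univ_castSucc, mul_comm]
  refine mul_le_mul ?_ ?_ (Finset.prod_nonneg fun _ _ => Finset.sum_nonneg fun _ _ =>
    norm_nonneg _) (h.nonneg n)
  · simpa using h.sum_fin n (n + 1)
  · rw [← Fin.prod_univ_eq_prod_range fun i => 1 + b i]
    refine Finset.prod_le_prod (fun _ _ => Finset.sum_nonneg fun _ _ => norm_nonneg _) ?_
    intro i _
    have : i.castSucc ≠ Fin.last n := (Fin.castSucc_lt_last i).ne
    simp only [Matrix.updateRow_ne this]
    exact sum_norm_one_add_le h i.castSucc

lemma prod_one_add_le_exp_tsum {b : ℕ → ℝ} (hb0 : ∀ i, 0 ≤ b i) (hb : Summable b) (n : ℕ) :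
    ∏ i ∈ Finset.range n, (1 + b i) ≤ Real.exp (∑' i, b i) := by
  calc ∏ i ∈ Finset.range n, (1 + b i) ≤ ∏ i ∈ Finset.range n, Real.exp (b i) :=
        Finset.prod_le_prod (fun i _ => by linarith [hb0 i])
          fun i _ => by linarith [Real.add_one_le_exp (b i)]
    _ = Real.exp (∑ i ∈ Finset.range n, b i) := (Real.exp_sum _ _).symm
    _ ≤ _ := Real.exp_le_exp.2 (hb.sum_le_tsum _ fun i _ => hb0 i)

lemma dist_secDet_le {M : ℕ → ℕ → ℂ} {b : ℕ → ℝ} (h : RowBound M b) (hb : Summable b) (n : ℕ) :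
    dist (secDet M n) (secDet M (n + 1)) ≤ Real.exp (∑' i, b i) * b n := by
  rw [dist_comm, dist_eq_norm, mul_comm]
  exact (norm_secDet_succ_sub_le h n).trans
    (mul_le_mul_of_nonneg_left (prod_one_add_le_exp_tsum h.nonneg hb n) (h.nonneg n))

lemma tendsto_secDet {M : ℕ → ℕ → ℂ} {b : ℕ → ℝ} (h : RowBound M b) (hb : Summable b) :
    Tendsto (secDet M) atTop (𝓝 (infDet M)) :=
  (cauchySeq_of_dist_le_of_summable _ (dist_secDet_le h hb) (hb.mul_left _)).tendsto_limUnder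

/-- The rate depends on `b` only, so convergence is uniform over all matrices with the same row
bound. This serves both the comparison with compressions and the holomorphy in `s`. -/
lemma dist_secDet_infDet_le {M : ℕ → ℕ → ℂ} {b : ℕ → ℝ} (h : RowBound M b) (hb : Summable b)
    (n : ℕ) : dist (secDet M n) (infDet M) ≤ Real.exp (∑' i, b i) * ∑' i, b (n + i) := by
  rw [← tsum_mul_left]
  exact dist_le_tsum_of_dist_le_of_tendsto _ (dist_secDet_le h hb) (hb.mul_left _)
    (tendsto_secDet h hb) n

lemma norm_infDet_le {M : ℕ → ℕ → ℂ} {b : ℕ → ℝ} (h : RowBound M b) (hb : Summable b) {K : ℝ}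
    (hK : ∀ n, ∏ i ∈ Finset.range n, (1 + b i) ≤ K) : ‖infDet M‖ ≤ K :=
  le_of_tendsto (tendsto_secDet h hb).norm
    (Eventually.of_forall fun n => (norm_secDet_le h n).trans (hK n))

/-- When the rows are multiplied by `t`, this turns the product bound into `exp(O(√‖t‖))`. A growth
order below `1` is what later forces products over small eigenvalues to be near `1`; it is the
reason for asking `√‖x k‖` to be summable. -/
lemma one_add_le_exp_two_sqrt {b : ℝ} (hb : 0 ≤ b) : 1 + b ≤ Real.exp (2 * √b) := by
  have h1 := Real.quadratic_le_exp_of_nonneg (x := 2 * √b) (by positivity)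
  nlinarith [Real.sq_sqrt hb, Real.sqrt_nonneg b]

lemma prod_one_add_le_exp_sqrt {b : ℕ → ℝ} (hb0 : ∀ i, 0 ≤ b i) (hb : Summable fun i => √(b i))
    (n : ℕ) : ∏ i ∈ Finset.range n, (1 + b i) ≤ Real.exp (2 * ∑' i, √(b i)) := by
  calc ∏ i ∈ Finset.range n, (1 + b i) ≤ ∏ i ∈ Finset.range n, Real.exp (2 * √(b i)) :=
        Finset.prod_le_prod (fun i _ => by linarith [hb0 i])
          fun i _ => one_add_le_exp_two_sqrt (hb0 i)
    _ = Real.exp (2 * ∑ i ∈ Finset.range n, √(b i)) := by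
        rw [← Real.exp_sum, Finset.mul_sum]
    _ ≤ _ := Real.exp_le_exp.2 (mul_le_mul_of_nonneg_left
        (hb.sum_le_tsum _ fun i _ => Real.sqrt_nonneg _) zero_le_two)

lemma summable_of_summable_sqrt {a : ℕ → ℝ} (h0 : ∀ i, 0 ≤ a i) (h : Summable fun i => √(a i)) :
    Summable a := by
  have h1 : ∀ᶠ i in atTop, a i ≤ √(a i) := by
    filter_upwards [h.tendsto_atTop_zero.eventually (gt_mem_nhds zero_lt_one)] with i hi
    nlinarith [Real.sq_sqrt (h0 i), Real.sqrt_nonneg (a i)]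
  refine Summable.of_norm_bounded_eventually_nat (g := fun i => √(a i)) h ?_
  filter_upwards [h1] with i hi
  rwa [Real.norm_of_nonneg (h0 i)]

/-! ### Nuclear representations -/

/-- The bounds for the rows of the matrix `⟪x k, y l⟫`. -/
def rowBd {H : Type*} [NormedAddCommGroup H] (x y : ℕ → H) (k : ℕ) : ℝ := ‖x k‖ * ∑' l, ‖y l‖

lemma rowBd_nonneg {H : Type*} [NormedAddCommGroup H] (x y : ℕ → H) (k : ℕ) : 0 ≤ rowBd x y k :=
  mul_nonneg (norm_nonneg _) (tsum_nonneg fun _ => norm_nonneg _)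

variable {H : Type*} [NormedAddCommGroup H] [InnerProductSpace ℂ H]

/-- `A = ∑ k, ⟪x k, ·⟫ y k`, where the norms `‖x k‖ ^ (1 / 2)` and `‖y k‖` are summable. -/
structure NuclearRep (A : H →L[ℂ] H) (x y : ℕ → H) : Prop where
  summable_left : Summable fun k => √‖x k‖
  summable_right : Summable fun k => ‖y k‖
  hasSum : ∀ u, HasSum (fun k => inner ℂ (x k) u • y k) (A u)

lemma rowBound_inner {x x' y : ℕ → H} (hy : Summable fun k => ‖y k‖) (hx : ∀ k, ‖x' k‖ ≤ ‖x k‖) :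
    RowBound (fun k l => inner ℂ (x' k) (y l)) (rowBd x y) := by
  intro k n
  calc ∑ l ∈ Finset.range n, ‖inner ℂ (x' k) (y l)‖
      ≤ ∑ l ∈ Finset.range n, ‖x k‖ * ‖y l‖ := Finset.sum_le_sum fun l _ =>
        (norm_inner_le_norm _ _).trans (mul_le_mul_of_nonneg_right (hx k) (norm_nonneg _))
    _ ≤ rowBd x y k := by
        rw [← Finset.mul_sum]
        exact mul_le_mul_of_nonneg_left (hy.sum_le_tsum _ fun _ _ => norm_nonneg _) (norm_nonneg _)

namespace NuclearRep

variable {A : H →L[ℂ] H} {x y : ℕ → H}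

lemma summable_sqrt_rowBd (h : NuclearRep A x y) : Summable fun k => √(rowBd x y k) := by
  simp only [rowBd, Real.sqrt_mul (norm_nonneg _)]
  exact h.summable_left.mul_right _

lemma summable_rowBd (h : NuclearRep A x y) : Summable (rowBd x y) :=
  summable_of_summable_sqrt (rowBd_nonneg x y) h.summable_sqrt_rowBd

lemma summable_norm_mul (h : NuclearRep A x y) : Summable fun k => ‖x k‖ * ‖y k‖ := by
  refine Summable.of_nonneg_of_le (fun k => by positivity) (fun k => ?_) h.summable_rowBd
  exact mul_le_mul_of_nonneg_left (h.summable_right.le_tsum k fun _ _ => norm_nonneg _)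
    (norm_nonneg _)

lemma smul (h : NuclearRep A x y) (t : ℂ) :
    NuclearRep (t • A) (fun k => (starRingEnd ℂ t) • x k) y where
  summable_left := by
    simp only [norm_smul, Real.sqrt_mul (norm_nonneg _)]
    exact h.summable_left.mul_left _
  summable_right := h.summable_right
  hasSum u := by
    simpa [inner_smul_left, smul_smul, mul_comm] using (h.hasSum u).const_smul t

end NuclearRep

/-! ### Compressions to finite dimensional subspaces -/

variable {H : Type*} [NormedAddCommGroup H] [InnerProductSpace ℂ H]

/-- The compression of `A` to a finite dimensional subspace. -/
def compress (A : H →L[ℂ] H) (V : Submodule ℂ H) [FiniteDimensional ℂ V] : V →ₗ[ℂ] V :=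
  (V.orthogonalProjectionOnto ∘L A ∘L V.subtypeL).toLinearMap

lemma compress_apply (A : H →L[ℂ] H) (V : Submodule ℂ H) [FiniteDimensional ℂ V] (v : V) :
    compress A V v = V.orthogonalProjectionOnto (A v) := rfl

lemma coe_compress_apply (A : H →L[ℂ] H) (V : Submodule ℂ H) [FiniteDimensional ℂ V] (v : V) :
    (compress A V v : H) = V.starProjection (A v) := rfl

lemma compress_smul (A : H →L[ℂ] H) (V : Submodule ℂ H) [FiniteDimensional ℂ V] (t : ℂ) :
    compress (t • A) V = t • compress A V := by
  ext v; simp [compress_apply]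

/-- The eigenvalues of the compression of `A` to `V`, with multiplicity. -/
def eigs (A : H →L[ℂ] H) (V : Submodule ℂ H) [FiniteDimensional ℂ V] : Multiset ℂ :=
  (compress A V).charpoly.roots

section

variable {A : H →L[ℂ] H} {V : Submodule ℂ H} [FiniteDimensional ℂ V]

lemma card_eigs : (eigs A V).card = Module.finrank ℂ V := by
  rw [eigs, IsAlgClosed.card_roots_eq_natDegree, LinearMap.charpoly_natDegree]

lemma det_sub_compress (t : ℂ) :
    (algebraMap ℂ (Module.End ℂ V) t - compress A V).det =
      ((eigs A V).map fun l => t - l).prod := by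
  rw [← LinearMap.eval_charpoly, (IsAlgClosed.splits (compress A V).charpoly).eval_eq_prod_roots_of_monic
    (LinearMap.charpoly_monic _)]
  rfl

lemma det_one_add_smul_compress (t : ℂ) :
    (1 + t • compress A V).det = ((eigs A V).map fun l => 1 + t * l).prod := by
  by_cases ht : t = 0
  · simp [ht]
  have h1 : (1 + t • compress A V) =
      (-t) • (algebraMap ℂ (Module.End ℂ V) (-t⁻¹) - compress A V) := by
    rw [Algebra.algebraMap_eq_smul_one, smul_sub, smul_smul]
    simp [ht]
  rw [h1, LinearMap.det_smul, det_sub_compress, ← card_eigs (A := A)]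
  rw [← Multiset.prod_replicate, ← Multiset.map_const', ← Multiset.prod_map_mul]
  congr 1
  refine Multiset.map_congr rfl fun l _ => ?_
  field_simp
  ring

lemma mem_eigs_iff {μ : ℂ} : μ ∈ eigs A V ↔ ∃ v : V, v ≠ 0 ∧ compress A V v = μ • v := by
  rw [eigs, Polynomial.mem_roots (LinearMap.charpoly_monic _).ne_zero,
    ← Module.End.hasEigenvalue_iff_isRoot_charpoly]
  constructor
  · intro h
    obtain ⟨v, hv⟩ := h.exists_hasEigenvector
    exact ⟨v, hv.2, hv.apply_eq_smul⟩
  · rintro ⟨v, hv, h⟩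
    exact Module.End.hasEigenvalue_of_hasEigenvector (Module.End.hasEigenvector_iff.2
      ⟨Module.End.mem_eigenspace_iff.2 h, hv⟩)

end

lemma starProjection_inf_orthogonal {E V : Submodule ℂ H} [FiniteDimensional ℂ E]
    [FiniteDimensional ℂ V] [FiniteDimensional ℂ (V ⊓ Eᗮ : Submodule ℂ H)] (hEV : E ≤ V) (a : H) :
    (V ⊓ Eᗮ).starProjection a = V.starProjection a - E.starProjection a := by
  refine Submodule.eq_starProjection_of_mem_of_inner_eq_zero ⟨?_, ?_⟩ ?_
  · exact V.sub_mem (V.starProjection_apply_mem a) (hEV (E.starProjection_apply_mem a))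
  · have h1 := Submodule.sub_starProjection_mem_orthogonal (K := E) a
    have h2 := Submodule.orthogonal_le hEV (Submodule.sub_starProjection_mem_orthogonal (K := V) a)
    have h3 := Eᗮ.sub_mem h1 h2
    rwa [sub_sub_sub_cancel_left] at h3
  · rintro w ⟨hw1, hw2⟩
    have h1 := V.starProjection_inner_eq_zero a w hw1
    have h2 := (Submodule.mem_orthogonal _ _).1 hw2 _ (E.starProjection_apply_mem a)
    rw [sub_sub_eq_add_sub, add_sub_right_comm, inner_add_left, h1, h2, add_zero]

/-- In block form the compression to `V` is triangular, with `V ⊓ Eᗮ` standing for the quotient by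
`E`. Only the compressed map has to preserve `E`, so `E` may be spanned by an eigenvector of the
compression. -/
lemma charpoly_compress_eq_mul {A : H →L[ℂ] H} {E V : Submodule ℂ H} [FiniteDimensional ℂ E]
    [FiniteDimensional ℂ V] [FiniteDimensional ℂ (V ⊓ Eᗮ : Submodule ℂ H)] (hEV : E ≤ V)
    (hE : ∀ v ∈ E, V.starProjection (A v) ∈ E) :
    (compress A V).charpoly = (compress A E).charpoly * (compress A (V ⊓ Eᗮ)).charpoly := by
  refine Polynomial.funext fun t => ?_
  rw [Polynomial.eval_mul, LinearMap.eval_charpoly, LinearMap.eval_charpoly,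
    LinearMap.eval_charpoly]
  set e : V →ₗ[ℂ] V := algebraMap ℂ (Module.End ℂ V) t - compress A V with he
  have hea : ∀ v : V, (e v : H) = t • (v : H) - V.starProjection (A v) := fun v => by
    simp [he, coe_compress_apply, Module.algebraMap_end_apply]
  set W : Submodule ℂ V := E.comap V.subtype with hW
  have hWe : W ≤ W.comap e := by
    intro v hv
    change (e v : H) ∈ E
    rw [hea]
    exact E.sub_mem (E.smul_mem _ hv) (hE _ hv)
  rw [LinearMap.det_eq_det_mul_det W e hWe]
  congr 1
  · let q : W ≃ₗ[ℂ] E := Submodule.comapSubtypeEquivOfLe hEV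
    rw [← LinearMap.det_conj _ q]
    congr 1
    ext v
    have hv : ((q.symm v : V) : H) = v := rfl
    change (e (q.symm v) : H) = _
    rw [hea, hv]
    simp only [LinearMap.sub_apply, Module.algebraMap_end_apply, Submodule.coe_sub,
      Submodule.coe_smul, coe_compress_apply]
    congr 1
    have h1 := Submodule.starProjection_comp_starProjection_of_le hEV
    rw [← Submodule.starProjection_eq_self_iff.2 (hE v v.2)]
    exact congrArg (fun f : H →L[ℂ] H => f (A v)) h1
  -- The complement of `E` in `V` maps isomorphically onto `V ⧸ W`. Under this map the compression
  -- to `U` becomes the quotient map, since the projections to `U` and `V` differ by a vector of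
  -- `E`.
  · set U : Submodule ℂ H := V ⊓ Eᗮ with hU
    let j : U →ₗ[ℂ] V ⧸ W := W.mkQ ∘ₗ Submodule.inclusion (inf_le_left : U ≤ V)
    have hj : Function.Bijective j := by
      constructor
      · rw [← LinearMap.ker_eq_bot, LinearMap.ker_eq_bot']
        intro u hu
        have h1 : (u : H) ∈ E := by
          have := (Submodule.Quotient.mk_eq_zero W).1 hu
          exact this
        have h2 := Submodule.inner_right_of_mem_orthogonal h1 u.2.2
        exact Subtype.ext (inner_self_eq_zero.1 h2)
      · intro v
        obtain ⟨v, rfl⟩ := W.mkQ_surjective v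
        have hm : (v : H) - E.starProjection v ∈ U :=
          ⟨V.sub_mem v.2 (hEV (E.starProjection_apply_mem _)),
            Submodule.sub_starProjection_mem_orthogonal _⟩
        refine ⟨⟨_, hm⟩, ?_⟩
        refine (Submodule.Quotient.eq W).2 ?_
        change (v : H) - E.starProjection v - v ∈ E
        rw [sub_sub_cancel_left]
        exact E.neg_mem (E.starProjection_apply_mem _)
    let q : U ≃ₗ[ℂ] V ⧸ W := LinearEquiv.ofBijective j hj
    rw [← LinearMap.det_conj _ q]
    congr 1
    refine LinearMap.ext fun v => ?_
    obtain ⟨u, rfl⟩ := q.surjective v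
    simp only [LinearMap.coe_comp, LinearEquiv.coe_coe, Function.comp_apply,
      LinearEquiv.symm_apply_apply]
    change W.mkQ (e (Submodule.inclusion inf_le_left u)) = W.mkQ _
    refine (Submodule.Quotient.eq W).2 ?_
    change (e _ : H) - (((algebraMap ℂ (Module.End ℂ U) t - compress A U) u : U) : H) ∈ E
    rw [hea]
    simp only [LinearMap.sub_apply, Module.algebraMap_end_apply, Submodule.coe_sub,
      Submodule.coe_smul, coe_compress_apply, Submodule.coe_inclusion]
    rw [show U.starProjection (A u) = _ from starProjection_inf_orthogonal hEV _]
    convert E.neg_mem (E.starProjection_apply_mem (A u)) using 1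
    abel

lemma eigs_eq_add {A : H →L[ℂ] H} {E V : Submodule ℂ H} [FiniteDimensional ℂ E]
    [FiniteDimensional ℂ V] [FiniteDimensional ℂ (V ⊓ Eᗮ : Submodule ℂ H)] (hEV : E ≤ V)
    (hE : ∀ v ∈ E, V.starProjection (A v) ∈ E) :
    eigs A V = eigs A E + eigs A (V ⊓ Eᗮ) := by
  rw [eigs, charpoly_compress_eq_mul hEV hE, Polynomial.roots_mul]
  · rfl
  · exact mul_ne_zero (LinearMap.charpoly_monic _).ne_zero (LinearMap.charpoly_monic _).ne_zero

/-- A unitary triangularization: the eigenvalues of a compression are its diagonal entries in a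
suitable orthonormal basis. -/
lemma exists_orthonormal_eigs (A : H →L[ℂ] H) (V : Submodule ℂ H) [FiniteDimensional ℂ V] :
    ∃ s : Finset H, (s : Set H) ⊆ V ∧ Orthonormal ℂ ((↑) : s → H) ∧
      eigs A V = s.val.map fun f => inner ℂ f (A f) := by
  induction hn : Module.finrank ℂ V using Nat.strong_induction_on generalizing V with
  | _ n ih =>
  classical
  by_cases h0 : eigs A V = 0
  · exact ⟨∅, by simp, by simp [Orthonormal, Subsingleton.pairwise], by simpa using h0⟩
  obtain ⟨μ, hμ⟩ := Multiset.exists_mem_of_ne_zero h0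
  obtain ⟨v, hv0, hv⟩ := mem_eigs_iff.1 hμ
  have hv0' : (v : H) ≠ 0 := by simpa using hv0
  set f : H := ((‖(v : H)‖⁻¹ : ℝ) : ℂ) • (v : H) with hf
  have hf1 : ‖f‖ = 1 := by
    rw [hf, norm_smul, Complex.norm_real, norm_inv, norm_norm, inv_mul_cancel₀ (norm_ne_zero_iff.2 hv0')]
  have hfV : f ∈ V := V.smul_mem _ v.2
  have hAf : V.starProjection (A f) = μ • f := by
    have := congrArg (Subtype.val) hv
    rw [coe_compress_apply] at this
    rw [hf, map_smul, map_smul, this, smul_comm]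
    rfl
  set E : Submodule ℂ H := Submodule.span ℂ {f} with hE
  have hfE : f ∈ E := Submodule.mem_span_singleton_self f
  have hEV : E ≤ V := (Submodule.span_singleton_le_iff_mem _ _).2 hfV
  have hstab : ∀ w ∈ E, V.starProjection (A w) ∈ E := by
    intro w hw
    obtain ⟨c, rfl⟩ := Submodule.mem_span_singleton.1 hw
    rw [map_smul, map_smul, hAf]
    exact E.smul_mem _ (E.smul_mem _ hfE)
  have hf0 : f ≠ 0 := by rw [← norm_ne_zero_iff, hf1]; exact one_ne_zero
  have hinner : inner ℂ f (A f) = μ := by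
    have h1 := V.starProjection_inner_eq_zero (A f) f hfV
    rw [hAf, inner_sub_left, inner_smul_left, inner_self_eq_norm_sq_to_K, hf1, sub_eq_zero] at h1
    rw [← inner_conj_symm, h1]
    simp
  have hdimE : Module.finrank ℂ E = 1 := finrank_span_singleton hf0
  have heE : eigs A E = {μ} := by
    have hc : (eigs A E).card = 1 := by rw [card_eigs, hdimE]
    obtain ⟨ν, hν⟩ := Multiset.card_eq_one.1 hc
    have hμE : μ ∈ eigs A E := by
      refine mem_eigs_iff.2 ⟨⟨f, hfE⟩, by simpa using hf0, ?_⟩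
      apply Subtype.ext
      rw [coe_compress_apply]
      have h1 := Submodule.starProjection_comp_starProjection_of_le hEV
      have h2 : E.starProjection (V.starProjection (A f)) = E.starProjection (A f) :=
        congrArg (fun g : H →L[ℂ] H => g (A f)) h1
      change E.starProjection (A f) = μ • f
      rw [← h2, hAf]
      exact Submodule.starProjection_eq_self_iff.2 (E.smul_mem _ hfE)
    rw [hν] at hμE ⊢
    rw [Multiset.mem_singleton.1 hμE]
  -- Splitting off the line of one eigenvector removes one eigenvalue. The rest belong to the
  -- compression of the same `A` to `V ⊓ Eᗮ`, so the induction hypothesis yields diagonal entries of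
  -- `A` itself.
  have hadd := eigs_eq_add hEV hstab
  have hdim : Module.finrank ℂ (V ⊓ Eᗮ : Submodule ℂ H) < n := by
    have := congrArg Multiset.card hadd
    rw [Multiset.card_add, card_eigs, card_eigs, card_eigs, hdimE] at this
    omega
  obtain ⟨s, hsV, hs, hse⟩ := ih _ hdim (V ⊓ Eᗮ) rfl
  have hperp : ∀ g ∈ s, inner ℂ f g = 0 := fun g hg =>
    Submodule.inner_right_of_mem_orthogonal hfE (hsV hg).2
  have hfs : f ∉ s := by
    intro hfs
    have := hperp f hfs
    exact hf0 (inner_self_eq_zero.1 this)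
  refine ⟨insert f s, ?_, ?_, ?_⟩
  · rw [Finset.coe_insert, Set.insert_subset_iff]
    exact ⟨hfV, fun g hg => (hsV hg).1⟩
  · rw [orthonormal_iff_ite] at hs ⊢
    rintro ⟨g, hg⟩ ⟨g', hg'⟩
    simp only [Subtype.mk.injEq]
    rcases Finset.mem_insert.1 hg with rfl | hgs <;> rcases Finset.mem_insert.1 hg' with h' | hgs'
    · subst h'; simp [inner_self_eq_norm_sq_to_K, hf1]
    · rw [hperp g' hgs', if_neg]
      rintro rfl; exact hfs hgs'
    · subst h'
      rw [← inner_conj_symm, hperp g hgs, if_neg]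
      · simp
      · rintro rfl; exact hfs hgs
    · simpa using hs ⟨g, hgs⟩ ⟨g', hgs'⟩
  · rw [hadd, heE, hse, Finset.insert_val_of_notMem hfs, Multiset.map_cons, hinner,
      Multiset.singleton_add]

/-! ### Determinants of compressions -/

variable {H : Type*} [NormedAddCommGroup H] [InnerProductSpace ℂ H]

namespace NuclearRep

variable {A : H →L[ℂ] H} {x y : ℕ → H}

lemma norm_sub_sum_le (h : NuclearRep A x y) (n : ℕ) (u : H) :
    ‖A u - ∑ k ∈ Finset.range n, inner ℂ (x k) u • y k‖ ≤
      (∑' k, ‖x (k + n)‖ * ‖y (k + n)‖) * ‖u‖ := by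
  rw [← (h.hasSum u).tsum_eq, ← (h.hasSum u).summable.sum_add_tsum_nat_add n, add_sub_cancel_left,
    ← tsum_mul_right]
  have hs := ((summable_nat_add_iff n).2 h.summable_norm_mul).mul_right ‖u‖
  have hb : ∀ k, ‖inner ℂ (x (k + n)) u • y (k + n)‖ ≤ ‖x (k + n)‖ * ‖y (k + n)‖ * ‖u‖ := by
    intro k
    rw [norm_smul, mul_right_comm]
    exact mul_le_mul_of_nonneg_right (norm_inner_le_norm _ _) (norm_nonneg _)
  exact tsum_of_norm_bounded hs.hasSum hb

lemma isCompactOperator [CompleteSpace H] (h : NuclearRep A x y) : IsCompactOperator A := by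
  let B : ℕ → H →L[ℂ] H := fun n => ∑ k ∈ Finset.range n, (innerSL ℂ (x k)).smulRight (y k)
  have hB : ∀ n u, B n u = ∑ k ∈ Finset.range n, inner ℂ (x k) u • y k := fun n u => by
    simp [B]
  refine isCompactOperator_of_tendsto (F := B) (l := atTop) ?_ (Eventually.of_forall fun n => ?_)
  · rw [tendsto_iff_norm_sub_tendsto_zero]
    refine squeeze_zero (fun _ => norm_nonneg _) (fun n => ?_)
      (tendsto_sum_nat_add fun k => ‖x k‖ * ‖y k‖)
    refine ContinuousLinearMap.opNorm_le_bound _ (tsum_nonneg fun _ => by positivity) fun u => ?_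
    rw [sub_apply, norm_sub_rev, hB]
    exact h.norm_sub_sum_le n u
  · refine Submodule.sum_mem (compactOperator (RingHom.id ℂ) H H) fun k _ => ?_
    have h1 : IsCompactOperator (ContinuousLinearMap.toSpanSingleton ℂ (y k)) :=
      isCompactOperator_of_locallyCompactSpace_rng _
    exact h1.comp_clm (innerSL ℂ (x k))

/-- By `det (1 + XY) = det (1 + YX)`, the sections of the infinite matrix become matrices of size
`dim V`. These converge entrywise to the matrix of the compression in an orthonormal basis of `V`.
-/
lemma det_one_add_compress (h : NuclearRep A x y) (V : Submodule ℂ H) [FiniteDimensional ℂ V] :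
    (1 + compress A V).det = infDet fun k l => inner ℂ (V.starProjection (x k)) (y l) := by
  let b := stdOrthonormalBasis ℂ V
  let d := Module.finrank ℂ V
  let X (n : ℕ) : Matrix (Fin n) (Fin d) ℂ := Matrix.of fun k i => inner ℂ (x k) (b i : H)
  let Y (n : ℕ) : Matrix (Fin d) (Fin n) ℂ := Matrix.of fun i l => inner ℂ (b i : H) (y l)
  let Z : Matrix (Fin d) (Fin d) ℂ := Matrix.of fun i j => inner ℂ (b i : H) (A (b j))
  have h1 : ∀ n, secDet (fun k l => inner ℂ (V.starProjection (x k)) (y l)) n =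
      (1 + Y n * X n).det := by
    intro n
    rw [← Matrix.det_one_add_mul_comm, secDet]
    congr 2
    ext k l
    rw [Matrix.mul_apply]
    simp only [X, Y, Matrix.of_apply]
    have h2 := b.sum_inner_mul_inner (V.orthogonalProjectionOnto (x k))
      (V.orthogonalProjectionOnto (y l))
    simp only [Submodule.inner_orthogonalProjectionOnto_eq_of_mem_left,
      Submodule.inner_orthogonalProjectionOnto_eq_of_mem_right] at h2
    rw [Submodule.starProjection_apply, ← h2]
  have h3 : Tendsto (fun n => (1 + Y n * X n).det) atTop (𝓝 (1 + Z).det) := by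
    refine ((continuous_id.matrix_det).tendsto _).comp (tendsto_pi_nhds.2 fun i => ?_)
    refine tendsto_pi_nhds.2 fun j => ?_
    simp only [Matrix.add_apply]
    refine Tendsto.const_add _ ?_
    have h4 : ∀ n, (Y n * X n) i j = inner ℂ (b i : H)
        (∑ k ∈ Finset.range n, inner ℂ (x k) (b j : H) • y k) := by
      intro n
      rw [Matrix.mul_apply, inner_sum,
        ← Fin.sum_univ_eq_sum_range fun k => inner ℂ (b i : H) (inner ℂ (x k) (b j : H) • y k)]
      exact Finset.sum_congr rfl fun k _ => by simp [X, Y, mul_comm]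
    simp only [h4]
    exact Tendsto.inner tendsto_const_nhds (h.hasSum _).tendsto_sum_nat
  have h5 : (1 + compress A V).det = (1 + Z).det := by
    rw [← LinearMap.det_toMatrix b.toBasis, map_add, LinearMap.toMatrix_one]
    congr 2
    ext i j
    rw [LinearMap.toMatrix_apply]
    simp only [OrthonormalBasis.coe_toBasis, OrthonormalBasis.coe_toBasis_repr_apply,
      OrthonormalBasis.repr_apply_apply, compress_apply, Z, Matrix.of_apply]
    exact Submodule.inner_orthogonalProjectionOnto_eq_of_mem_left _ _
  rw [h5]
  refine tendsto_nhds_unique h3 ?_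
  simp only [← h1]
  exact tendsto_secDet (rowBound_inner h.summable_right
    fun k => V.norm_starProjection_apply_le (x k)) h.summable_rowBd

lemma rowBound (h : NuclearRep A x y) :
    RowBound (fun k l => inner ℂ (x k) (y l)) (rowBd x y) :=
  rowBound_inner h.summable_right fun _ => le_rfl

lemma norm_det_one_add_compress_le (h : NuclearRep A x y) (V : Submodule ℂ H)
    [FiniteDimensional ℂ V] :
    ‖(1 + compress A V).det‖ ≤ Real.exp (2 * ∑' k, √(rowBd x y k)) := by
  rw [h.det_one_add_compress]
  exact norm_infDet_le (rowBound_inner h.summable_right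
    fun k => V.norm_starProjection_apply_le (x k)) h.summable_rowBd
    (prod_one_add_le_exp_sqrt (rowBd_nonneg x y) h.summable_sqrt_rowBd)

/-- Growth of order `1/2` in `t`, with a constant that does not depend on `V`: `t` is absorbed into
the vectors `x k`, so each row bound is multiplied by `‖t‖`. -/
lemma norm_prod_eigs_le (h : NuclearRep A x y) (V : Submodule ℂ H)
    [FiniteDimensional ℂ V] (t : ℂ) :
    ‖((eigs A V).map fun l => 1 + t * l).prod‖ ≤
      Real.exp (2 * (√‖t‖ * ∑' k, √(rowBd x y k))) := by
  rw [← det_one_add_smul_compress, ← compress_smul]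
  convert (h.smul t).norm_det_one_add_compress_le V using 3
  rw [← tsum_mul_left]
  refine tsum_congr fun k => ?_
  rw [rowBd, rowBd, norm_smul, RCLike.norm_conj, mul_assoc, Real.sqrt_mul (norm_nonneg t)]

/-- Projecting to `V` does not move the first `n` vectors `x k`, so both infinite matrices have the
same leading section of size `n`. Each infinite determinant is within one tail of it, hence the
factor `2`. -/
lemma dist_det_compress_le (h : NuclearRep A x y) (V : Submodule ℂ H) [FiniteDimensional ℂ V]
    (n : ℕ) (hV : ∀ k < n, x k ∈ V) :
    dist (1 + compress A V).det (infDet fun k l => inner ℂ (x k) (y l)) ≤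
      2 * (Real.exp (∑' k, rowBd x y k) * ∑' k, rowBd x y (n + k)) := by
  have h1 := dist_secDet_infDet_le (rowBound_inner h.summable_right
    fun k => V.norm_starProjection_apply_le (x k)) h.summable_rowBd n
  have h2 := dist_secDet_infDet_le h.rowBound h.summable_rowBd n
  rw [h.det_one_add_compress]
  have h3 : secDet (fun k l => inner ℂ (V.starProjection (x k)) (y l)) n =
      secDet (fun k l => inner ℂ (x k) (y l)) n := by
    rw [secDet, secDet]
    congr 2
    ext k l
    simp only [Matrix.of_apply]
    rw [Submodule.starProjection_eq_self_iff.2 (hV k k.2)]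
  rw [h3, dist_comm] at h1
  linarith [dist_triangle (infDet fun k l => inner ℂ (V.starProjection (x k)) (y l))
    (secDet (fun k l => inner ℂ (x k) (y l)) n) (infDet fun k l => inner ℂ (x k) (y l))]

/-- After expanding `A`, the sum over `i` for fixed `k` is handled by Cauchy-Schwarz and Bessel's
inequality for both families. With `e = f` this controls eigenvalues; with two different families it
controls characteristic values. -/
lemma sum_norm_inner_le (h : NuclearRep A x y) {ι : Type*} (s : Finset ι) {e f : ι → H}
    (he : Orthonormal ℂ e) (hf : Orthonormal ℂ f) :
    ∑ i ∈ s, ‖inner ℂ (e i) (A (f i))‖ ≤ ∑' k, ‖x k‖ * ‖y k‖ := by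
  have hb : ∀ i k, ‖inner ℂ (x k) (f i)‖ * ‖inner ℂ (e i) (y k)‖ ≤ ‖x k‖ * ‖y k‖ := by
    intro i k
    have h1 := norm_inner_le_norm (𝕜 := ℂ) (x k) (f i)
    have h2 := norm_inner_le_norm (𝕜 := ℂ) (e i) (y k)
    rw [hf.1, mul_one] at h1
    rw [he.1, one_mul] at h2
    exact mul_le_mul h1 h2 (norm_nonneg _) (norm_nonneg _)
  have hs : ∀ i, Summable fun k => ‖inner ℂ (x k) (f i)‖ * ‖inner ℂ (e i) (y k)‖ := fun i =>
    Summable.of_nonneg_of_le (fun _ => by positivity) (hb i) h.summable_norm_mul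
  have h1 : ∀ i, ‖inner ℂ (e i) (A (f i))‖ ≤
      ∑' k, ‖inner ℂ (x k) (f i)‖ * ‖inner ℂ (e i) (y k)‖ := by
    intro i
    have h2 := ((innerSL ℂ (e i)).hasSum (h.hasSum (f i)))
    simp only [innerSL_apply_apply, inner_smul_right] at h2
    rw [← h2.tsum_eq]
    exact tsum_of_norm_bounded (hs i).hasSum fun k => by rw [norm_mul]
  calc ∑ i ∈ s, ‖inner ℂ (e i) (A (f i))‖
      ≤ ∑ i ∈ s, ∑' k, ‖inner ℂ (x k) (f i)‖ * ‖inner ℂ (e i) (y k)‖ :=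
        Finset.sum_le_sum fun i _ => h1 i
    _ = ∑' k, ∑ i ∈ s, ‖inner ℂ (x k) (f i)‖ * ‖inner ℂ (e i) (y k)‖ :=
        (Summable.tsum_finsetSum fun i _ => hs i).symm
    _ ≤ ∑' k, ‖x k‖ * ‖y k‖ := by
        refine Summable.tsum_le_tsum (fun k => ?_) (summable_sum fun i _ => hs i)
          h.summable_norm_mul
        refine (Real.sum_mul_le_sqrt_mul_sqrt _ _ _).trans ?_
        refine mul_le_mul ?_ ?_ (Real.sqrt_nonneg _) (norm_nonneg _)
        · rw [Real.sqrt_le_left (norm_nonneg _)]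
          convert hf.sum_inner_products_le (x k) (s := s) using 3 with i
          exact norm_inner_symm _ _
        · rw [Real.sqrt_le_left (norm_nonneg _)]
          exact he.sum_inner_products_le (y k)

/-- A Schur basis makes the eigenvalues diagonal entries, so no diagonalizability is needed, and the
bound is uniform in `V`. -/
lemma sum_norm_eigs_le (h : NuclearRep A x y) (V : Submodule ℂ H) [FiniteDimensional ℂ V] :
    ((eigs A V).map fun l => ‖l‖).sum ≤ ∑' k, ‖x k‖ * ‖y k‖ := by
  obtain ⟨s, -, hs, he⟩ := exists_orthonormal_eigs A V
  rw [he, Multiset.map_map]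
  change ∑ f ∈ s, ‖inner ℂ f (A f)‖ ≤ _
  rw [← Finset.sum_coe_sort]
  exact h.sum_norm_inner_le Finset.univ hs hs

end NuclearRep

/-! ### Eigenvalues of nuclear operators -/

variable {H : Type*} [NormedAddCommGroup H] [InnerProductSpace ℂ H]

namespace NuclearRep

variable {A : H →L[ℂ] H} {x y : ℕ → H}

lemma finrank_mul_le (h : NuclearRep A x y) (E : Submodule ℂ H) [FiniteDimensional ℂ E] {ρ : ℝ}
    (hE : ∀ l ∈ eigs A E, ρ ≤ ‖l‖) : Module.finrank ℂ E * ρ ≤ ∑' k, ‖x k‖ * ‖y k‖ := by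
  refine le_trans ?_ (h.sum_norm_eigs_le E)
  rw [← card_eigs (A := A), ← nsmul_eq_mul, ← Multiset.card_map (fun l => ‖l‖)]
  refine Multiset.card_nsmul_le_sum fun r hr => ?_
  obtain ⟨l, hl, rfl⟩ := Multiset.mem_map.1 hr
  exact hE l hl

/-- The spectral subspace of the eigenvalues of modulus at least `ρ`. -/
lemma exists_maximal_invariant (h : NuclearRep A x y) {ρ : ℝ} (hρ : 0 < ρ) :
    ∃ (E : Submodule ℂ H) (_ : FiniteDimensional ℂ E), (∀ v ∈ E, A v ∈ E) ∧
      (∀ l ∈ eigs A E, ρ ≤ ‖l‖) ∧ ∀ (μ : ℂ) (v : H), ρ ≤ ‖μ‖ → A v - μ • v ∈ E → v ∈ E := by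
  -- Otherwise every candidate can be enlarged by one dimension, the new eigenvalue `μ` again having
  -- modulus at least `ρ`. The dimensions would be unbounded, against `finrank_mul_le`.
  by_contra! hcon
  have key : ∀ n : ℕ, ∃ (E : Submodule ℂ H) (_ : FiniteDimensional ℂ E), (∀ v ∈ E, A v ∈ E) ∧
      (∀ l ∈ eigs A E, ρ ≤ ‖l‖) ∧ n ≤ Module.finrank ℂ E := by
    intro n
    induction n with
    | zero =>
      refine ⟨⊥, inferInstance, by simp, fun l hl => ?_, Nat.zero_le _⟩
      have h0 : (eigs A (⊥ : Submodule ℂ H)).card = 0 := by rw [card_eigs]; simp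
      rw [Multiset.card_eq_zero.1 h0] at hl
      exact absurd hl (Multiset.notMem_zero l)
    | succ n ih =>
      obtain ⟨E, _, hinv, hl, hn⟩ := ih
      obtain ⟨μ, v, hμ, hv, hvE⟩ := hcon E inferInstance hinv hl
      let V : Submodule ℂ H := E ⊔ Submodule.span ℂ {v}
      have hEV : E ≤ V := le_sup_left
      have hvV : v ∈ V := le_sup_right (a := E) (Submodule.mem_span_singleton_self v)
      have hdec : ∀ w ∈ V, A w - μ • w ∈ E := by
        intro w hw
        obtain ⟨e, he, z, hz, rfl⟩ := Submodule.mem_sup.1 hw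
        obtain ⟨c, rfl⟩ := Submodule.mem_span_singleton.1 hz
        have : A (e + c • v) - μ • (e + c • v) = (A e - μ • e) + c • (A v - μ • v) := by
          rw [map_add, map_smul, smul_add, smul_sub, smul_comm μ c v]
          abel
        rw [this]
        exact E.add_mem (E.sub_mem (hinv e he) (E.smul_mem _ he)) (E.smul_mem _ hv)
      have hVinv : ∀ w ∈ V, A w ∈ V := fun w hw => by
        have := V.add_mem (hEV (hdec w hw)) (V.smul_mem μ hw)
        simpa using this
      refine ⟨V, inferInstance, hVinv, ?_, ?_⟩
      · rw [eigs_eq_add hEV fun w hw => by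
          rw [Submodule.starProjection_eq_self_iff.2 (hEV (hinv w hw))]; exact hinv w hw]
        intro l hl'
        rcases Multiset.mem_add.1 hl' with hl' | hl'
        · exact hl l hl'
        · obtain ⟨u, hu0, hu⟩ := mem_eigs_iff.1 hl'
          have h1 := hdec u u.2.1
          have h2 : (V ⊓ Eᗮ).starProjection (A u - μ • (u : H)) = 0 := by
            rw [starProjection_inf_orthogonal hEV,
              Submodule.starProjection_eq_self_iff.2 (hEV h1),
              Submodule.starProjection_eq_self_iff.2 h1, sub_self]
          rw [map_sub, map_smul, Submodule.starProjection_eq_self_iff.2 u.2,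
            ← coe_compress_apply, hu, Submodule.coe_smul, ← sub_smul] at h2
          have h3 : l = μ := by
            rcases smul_eq_zero.1 h2 with h3 | h3
            · exact sub_eq_zero.1 h3
            · exact absurd (Subtype.ext h3) hu0
          rwa [h3]
      · have hlt : E < V := lt_of_le_of_ne hEV fun hEq => hvE (hEq ▸ hvV)
        have := Submodule.finrank_lt_finrank_of_lt hlt
        omega
  obtain ⟨n, hn⟩ := exists_nat_gt ((∑' k, ‖x k‖ * ‖y k‖) / ρ)
  obtain ⟨E, _, -, hl, hE⟩ := key n
  have h1 := h.finrank_mul_le E hl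
  rw [div_lt_iff₀ hρ] at hn
  have h2 : (n : ℝ) ≤ Module.finrank ℂ E := by exact_mod_cast hE
  nlinarith

end NuclearRep

/-- The maximality of `E` pulls a vector killed by a power of `A - μ` into `E`, one factor at a
time. So the generalized eigenspace is that of the restriction to `E`, whose dimension is the
multiplicity of the root `μ`. -/
lemma algMult_eq_count {A : H →L[ℂ] H} {E : Submodule ℂ H} [FiniteDimensional ℂ E]
    (hinv : ∀ v ∈ E, A v ∈ E) {μ : ℂ} (hmax : ∀ v : H, A v - μ • v ∈ E → v ∈ E) :
    algMult A μ = (eigs A E).count μ := by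
  have hc : compress A E = (A : H →ₗ[ℂ] H).restrict hinv := by
    ext v
    rw [coe_compress_apply, Submodule.starProjection_eq_self_iff.2 (hinv v v.2)]
    rfl
  have hle : Module.End.maxGenEigenspace (A : H →ₗ[ℂ] H) μ ≤ E := by
    intro v hv
    obtain ⟨k, hk⟩ := (Module.End.mem_maxGenEigenspace _ _ _).1 hv
    clear hv
    induction k generalizing v with
    | zero => simp at hk; simp [hk]
    | succ k ih =>
      rw [pow_succ, Module.End.mul_apply] at hk
      exact hmax v (ih hk)
  rw [eigs, Polynomial.count_roots, ← LinearMap.finrank_maxGenEigenspace_eq, hc, algMult,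
    Module.End.maxGenEigenspace, Module.End.maxGenEigenspace,
    Module.End.genEigenspace_restrict (A : H →ₗ[ℂ] H) E ⊤ μ hinv]
  exact (Submodule.comapSubtypeEquivOfLe hle).finrank_eq.symm

namespace NuclearRep

variable {A : H →L[ℂ] H} {x y : ℕ → H}

theorem detConverges (h : NuclearRep A x y) : DetConverges A := by
  classical
  refine summable_of_sum_le (c := ∑' k, ‖x k‖ * ‖y k‖) (fun μ => by positivity) fun T => ?_
  obtain ⟨ρ, hρ, hT⟩ : ∃ ρ : ℝ, 0 < ρ ∧ ∀ μ ∈ T, ρ ≤ ‖(μ : ℂ)‖ := by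
    rcases T.eq_empty_or_nonempty with rfl | hne
    · exact ⟨1, one_pos, by simp⟩
    · obtain ⟨μ₀, -, h0⟩ := T.exists_min_image (fun μ => ‖(μ : ℂ)‖) hne
      exact ⟨_, norm_pos_iff.2 μ₀.2, h0⟩
  -- With `ρ` below all moduli in the finite set `T`, one subspace `E` sees all multiplicities
  -- involved. The partial sum is part of the eigenvalue sum over `E`, which is bounded
  -- independently of `E`.
  obtain ⟨E, _, hinv, -, hmax⟩ := h.exists_maximal_invariant hρ
  refine le_trans ?_ (h.sum_norm_eigs_le E)
  rw [Finset.sum_multiset_map_count]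
  have h1 : ∑ μ ∈ T, (algMult A μ : ℝ) * ‖(μ : ℂ)‖ =
      ∑ l ∈ T.map (Function.Embedding.subtype _), ((eigs A E).count l : ℝ) * ‖l‖ := by
    rw [Finset.sum_map]
    exact Finset.sum_congr rfl fun μ hμ => by
      rw [algMult_eq_count hinv fun v => hmax μ v (hT μ hμ)]; rfl
  rw [h1]
  simp only [nsmul_eq_mul]
  rw [← Finset.sum_filter_of_ne (p := fun l => l ∈ (eigs A E).toFinset)]
  · exact Finset.sum_le_sum_of_subset_of_nonneg (fun l hl => (Finset.mem_filter.1 hl).2)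
      fun _ _ _ => by positivity
  · intro l _ hl
    rw [Multiset.mem_toFinset]
    by_contra hcon
    exact hl (by rw [Multiset.count_eq_zero.2 hcon]; simp)

/-- The compressions to a complement of a spectral subspace eventually have no large eigenvalues. -/
lemma exists_compress_eigs_lt [CompleteSpace H] (h : NuclearRep A x y) {ρ : ℝ} (hρ : 0 < ρ)
    {E : Submodule ℂ H} [FiniteDimensional ℂ E]
    (hmax : ∀ (μ : ℂ) (v : H), ρ ≤ ‖μ‖ → A v - μ • v ∈ E → v ∈ E) (n₀ : ℕ) :
    ∃ (V : Submodule ℂ H) (_ : FiniteDimensional ℂ V), E ≤ V ∧ (∀ k < n₀, x k ∈ V) ∧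
      ∀ l ∈ eigs A (V ⊓ Eᗮ), ‖l‖ < ρ := by
  classical
  -- A compactness argument along growing subspaces `V n`. Unit eigenvectors `v n ⊥ E` subconverge
  -- to a unit vector `v' ⊥ E` with `A v' - m • v' ∈ E` and `ρ ≤ ‖m‖`; maximality then puts `v'`
  -- into `E`, a contradiction.
  by_contra! hcon
  let V : ℕ → Submodule ℂ H := fun n => E ⊔ Submodule.span ℂ
    (((Finset.range (n + n₀)).image x ∪ (Finset.range (n + n₀)).image y : Finset H) : Set H)
  have hEV : ∀ n, E ≤ V n := fun n => le_sup_left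
  have hspan : ∀ n (z : H), z ∈ ((Finset.range (n + n₀)).image x ∪
      (Finset.range (n + n₀)).image y : Finset H) → z ∈ V n := fun n z hz =>
    le_sup_right (a := E) (Submodule.subset_span hz)
  have hx : ∀ n, ∀ k < n + n₀, x k ∈ V n := fun n k hk => hspan n _ <|
    Finset.mem_union_left _ <| Finset.mem_image_of_mem x (Finset.mem_range.2 hk)
  have hy : ∀ n, ∀ k < n + n₀, y k ∈ V n := fun n k hk => hspan n _ <|
    Finset.mem_union_right _ <| Finset.mem_image_of_mem y (Finset.mem_range.2 hk)
  have hunit : ∀ n, ∃ (μ : ℂ) (v : H), ρ ≤ ‖μ‖ ∧ ‖v‖ = 1 ∧ v ∈ Eᗮ ∧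
      (V n).starProjection (A v) - E.starProjection (A v) = μ • v := by
    intro n
    obtain ⟨l, hl, hlρ⟩ := hcon (V n) inferInstance (hEV n) fun k hk => hx n k (by omega)
    obtain ⟨u, hu0, hu⟩ := mem_eigs_iff.1 hl
    have hu0' : ‖(u : H)‖ ≠ 0 := by simpa using hu0
    refine ⟨l, ((‖(u : H)‖⁻¹ : ℝ) : ℂ) • (u : H), hlρ, ?_, Eᗮ.smul_mem _ u.2.2, ?_⟩
    · rw [norm_smul, Complex.norm_real, norm_inv, norm_norm, inv_mul_cancel₀ hu0']
    · have h1 := congrArg Subtype.val hu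
      rw [coe_compress_apply, starProjection_inf_orthogonal (hEV n)] at h1
      rw [map_smul, map_smul, map_smul, ← smul_sub, h1, Submodule.coe_smul, smul_comm]
  choose μ v hμ hv1 hvE hev using hunit
  -- `V n` contains the first vectors `y k`, so `A (v n)` lies in `V n` up to a tail of the
  -- expansion and the projection hardly moves it.
  have hproj : Tendsto (fun n => (V n).starProjection (A (v n)) - A (v n)) atTop (𝓝 0) := by
    have h1 : Tendsto (fun n => 2 * ∑' k, ‖x (k + (n + n₀))‖ * ‖y (k + (n + n₀))‖) atTop
        (𝓝 (2 * 0)) := ((tendsto_sum_nat_add fun k => ‖x k‖ * ‖y k‖).comp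
          (tendsto_add_atTop_nat n₀)).const_mul 2
    rw [mul_zero] at h1
    refine squeeze_zero_norm (fun n => ?_) h1
    set S := ∑ k ∈ Finset.range (n + n₀), inner ℂ (x k) (v n) • y k with hS
    have hSV : S ∈ V n := Submodule.sum_mem _ fun k hk =>
      (V n).smul_mem _ (hy n k (Finset.mem_range.1 hk))
    have h2 : (V n).starProjection (A (v n)) - A (v n) =
        (V n).starProjection (A (v n) - S) - (A (v n) - S) := by
      rw [map_sub, Submodule.starProjection_eq_self_iff.2 hSV]
      abel
    have h3 := h.norm_sub_sum_le (n + n₀) (v n)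
    rw [hv1, mul_one] at h3
    rw [h2]
    refine (norm_sub_le _ _).trans ?_
    have h4 := (V n).norm_starProjection_apply_le (A (v n) - S)
    linarith
  have hμb : ∀ n, ‖μ n‖ ≤ ‖A‖ + ‖A‖ := by
    intro n
    have h1 : ‖μ n‖ = ‖μ n • v n‖ := by rw [norm_smul, hv1, mul_one]
    have h2 := A.le_opNorm (v n)
    rw [hv1, mul_one] at h2
    rw [h1, ← hev]
    exact (norm_sub_le _ _).trans (add_le_add (((V n).norm_starProjection_apply_le _).trans h2)
      ((E.norm_starProjection_apply_le _).trans h2))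
  have hcomp : IsCompact (closure (A '' Metric.closedBall 0 1)) :=
    h.isCompactOperator.isCompact_closure_image_closedBall (f := (A : H →ₗ[ℂ] H)) 1
  obtain ⟨⟨w, m⟩, -, φ, hφ, hlim⟩ := (hcomp.prod
    (isCompact_closedBall (0 : ℂ) (‖A‖ + ‖A‖))).tendsto_subseq (x := fun n => (A (v n), μ n))
    fun n => ⟨subset_closure ⟨v n, by simp [hv1], rfl⟩, by simpa using hμb n⟩
  have hw : Tendsto (fun n => A (v (φ n))) atTop (𝓝 w) :=
    (continuous_fst.tendsto _).comp hlim
  have hm : Tendsto (fun n => μ (φ n)) atTop (𝓝 m) := (continuous_snd.tendsto _).comp hlim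
  have hmρ : ρ ≤ ‖m‖ := ge_of_tendsto hm.norm (Eventually.of_forall fun n => hμ _)
  have hm0 : m ≠ 0 := norm_pos_iff.1 (hρ.trans_le hmρ)
  have hv : Tendsto (fun n => v (φ n)) atTop (𝓝 (m⁻¹ • (w - E.starProjection w))) := by
    have h1 : Tendsto (fun n => (V (φ n)).starProjection (A (v (φ n)))) atTop (𝓝 w) := by
      simpa using (hproj.comp hφ.tendsto_atTop).add hw
    have h2 := (h1.sub ((E.starProjection.continuous.tendsto w).comp hw))
    refine ((hm.inv₀ hm0).smul h2).congr fun n => ?_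
    simp only [Function.comp_apply]
    rw [hev, smul_smul, inv_mul_cancel₀, one_smul]
    exact norm_pos_iff.1 (hρ.trans_le (hμ _))
  set v' := m⁻¹ • (w - E.starProjection w) with hv'
  have hnorm : ‖v'‖ = 1 := tendsto_nhds_unique hv.norm (by simp [hv1])
  have hperp : v' ∈ Eᗮ := E.isClosed_orthogonal.mem_of_tendsto hv
    (Eventually.of_forall fun n => hvE _)
  have hA : A v' = w := tendsto_nhds_unique ((A.continuous.tendsto v').comp hv) hw
  have hE : v' ∈ E := by
    refine hmax m v' hmρ ?_
    rw [hA, hv', smul_smul, mul_inv_cancel₀ hm0, one_smul, sub_sub_cancel]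
    exact E.starProjection_apply_mem w
  have := Submodule.inner_right_of_mem_orthogonal hE hperp
  rw [inner_self_eq_zero] at this
  rw [this, norm_zero] at hnorm
  exact zero_ne_one hnorm

end NuclearRep

/-! ### The determinant of a nuclear operator -/

/-- If all `l ∈ R` are small, and `∏ (1 + t l)` has growth order at most `1 / 2` in `t`, then
`∏ (1 + l)` is close to `1`. -/
lemma norm_prod_one_add_sub_one_le {R : Multiset ℂ} {ρ S : ℝ} (hρ : 0 < ρ) (hρ2 : ρ ≤ 1 / 2)
    (hS : 0 ≤ S) (hR : ∀ l ∈ R, ‖l‖ < ρ)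
    (hgrow : ∀ t : ℂ, ‖(R.map fun l => 1 + t * l).prod‖ ≤ Real.exp (2 * (√‖t‖ * S)))
    (hsmall : 8 * (S + 1) * √ρ ≤ 1) :
    ‖(R.map fun l => 1 + l).prod - 1‖ ≤ 16 * (S + 1) * √ρ := by
  -- For `‖t‖ < ρ⁻¹` every factor `1 + t * l` lies within distance `1` of `1`, so the principal
  -- logarithms add up to a holomorphic logarithm of the product.
  have hlog : ∃ f : ℂ → ℂ, DifferentiableOn ℂ f (Metric.ball 0 ρ⁻¹) ∧ f 0 = 0 ∧
      ∀ t ∈ Metric.ball (0 : ℂ) ρ⁻¹, Complex.exp (f t) = (R.map fun l => 1 + t * l).prod := by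
    clear hgrow
    induction R using Multiset.induction with
    | empty => exact ⟨fun _ => 0, differentiableOn_const 0, rfl, fun t _ => by simp⟩
    | cons l R ih =>
      obtain ⟨f, hf, hf0, hfe⟩ := ih fun l' hl' => hR l' (Multiset.mem_cons_of_mem hl')
      have hl := hR l (Multiset.mem_cons_self l R)
      have hsl : ∀ t ∈ Metric.ball (0 : ℂ) ρ⁻¹, 1 + t * l ∈ Complex.slitPlane := by
        intro t ht
        refine Complex.mem_slitPlane_of_norm_lt_one ?_
        rw [norm_mul]
        rw [mem_ball_zero_iff] at ht
        calc ‖t‖ * ‖l‖ ≤ ‖t‖ * ρ := mul_le_mul_of_nonneg_left hl.le (norm_nonneg _)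
          _ < ρ⁻¹ * ρ := mul_lt_mul_of_pos_right ht hρ
          _ = 1 := inv_mul_cancel₀ hρ.ne'
      refine ⟨fun t => Complex.log (1 + t * l) + f t, DifferentiableOn.add ?_ hf, by simp [hf0], ?_⟩
      · exact DifferentiableOn.clog (by fun_prop) hsl
      · intro t ht
        rw [Complex.exp_add, Complex.exp_log (Complex.slitPlane_ne_zero (hsl t ht)), hfe t ht,
          Multiset.map_cons, Multiset.prod_cons]
  obtain ⟨f, hf, hf0, hfe⟩ := hlog
  have hsρ : 0 < √ρ := Real.sqrt_pos.2 hρ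
  have hsq : √ρ * √ρ = ρ := Real.mul_self_sqrt hρ.le
  -- Order `1/2` growth bounds the real part of the logarithm on the disc of radius `ρ⁻¹` by only
  -- `O(ρ^(-1/2))`. Since the logarithm vanishes at `0`, Borel-Carathéodory gives `‖f 1‖ = O(M ρ) =
  -- O(√ρ)`. Taking `S + 1` instead of `S` keeps `M` positive.
  set M : ℝ := 2 * (S + 1) * (√ρ)⁻¹ with hM
  have hM0 : 0 < M := by positivity
  have hre : Set.MapsTo f (Metric.ball 0 ρ⁻¹) {z | z.re ≤ M} := by
    intro t ht
    have h1 := hgrow t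
    rw [← hfe t ht, Complex.norm_exp, Real.exp_le_exp] at h1
    refine h1.trans ?_
    rw [mem_ball_zero_iff] at ht
    have h2 : √‖t‖ ≤ (√ρ)⁻¹ := by
      rw [← Real.sqrt_inv]; exact Real.sqrt_le_sqrt ht.le
    have h3 : 0 ≤ (√ρ)⁻¹ := by positivity
    rw [hM]
    nlinarith [mul_le_mul_of_nonneg_right h2 hS]
  have h2ρ : 2 ≤ ρ⁻¹ := by
    rw [le_inv_comm₀ two_pos hρ]; linarith
  have h1mem : (1 : ℂ) ∈ Metric.ball (0 : ℂ) ρ⁻¹ := by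
    rw [mem_ball_zero_iff, norm_one]; linarith
  have hf1 := Complex.borelCaratheodory_zero hM0 hf hre (by positivity) h1mem hf0
  rw [norm_one, mul_one] at hf1
  have hf1' : ‖f 1‖ ≤ 8 * (S + 1) * √ρ := by
    refine hf1.trans ?_
    rw [div_le_iff₀ (by linarith)]
    have h4 : ρ⁻¹ / 2 ≤ ρ⁻¹ - 1 := by linarith
    calc 2 * M = 8 * (S + 1) * √ρ * (ρ⁻¹ / 2) := by
          have h7 : (√ρ)⁻¹ = √ρ * ρ⁻¹ := by
            rw [eq_mul_inv_iff_mul_eq₀ hρ.ne', inv_mul_eq_iff_eq_mul₀ hsρ.ne', hsq]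
          rw [hM, h7]
          ring
      _ ≤ _ := mul_le_mul_of_nonneg_left h4 (by positivity)
  have h5 := Complex.norm_exp_sub_one_le (hf1'.trans hsmall)
  have h6 := hfe 1 h1mem
  simp only [one_mul] at h6
  rw [← h6]
  linarith

variable {H : Type*} [NormedAddCommGroup H] [InnerProductSpace ℂ H]

lemma multipliable_detOneAdd {A : H →L[ℂ] H} (h : DetConverges A) :
    Multipliable fun μ : {μ : ℂ // μ ≠ 0} => (1 + (μ : ℂ)) ^ algMult A μ := by
  set a : {μ : ℂ // μ ≠ 0} → ℝ := fun μ => (algMult A μ : ℝ) * ‖(μ : ℂ)‖ with ha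
  have ha0 : ∀ μ, 0 ≤ a μ := fun μ => by positivity
  have key : ∀ μ : {μ : ℂ // μ ≠ 0}, ‖(1 + (μ : ℂ)) ^ algMult A μ - 1‖ ≤
      a μ * Real.exp (∑' ν, a ν) := by
    intro μ
    -- As a product of equal factors, the power differs from `1` by at most `e^a - 1 ≤ a e^a`, where
    -- `a` is the multiplicity times the modulus.
    have h1 := Finset.norm_prod_one_add_sub_one_le (Finset.range (algMult A μ)) fun _ => (μ : ℂ)
    rw [Finset.prod_const, Finset.sum_const, Finset.card_range, nsmul_eq_mul] at h1
    refine h1.trans ?_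
    have h2 := Real.add_one_le_exp (-a μ)
    have h3 : Real.exp (-a μ) * Real.exp (a μ) = 1 := by rw [← Real.exp_add]; simp
    have h4 : Real.exp (a μ) ≤ Real.exp (∑' ν, a ν) :=
      Real.exp_le_exp.2 (h.le_tsum μ fun ν _ => ha0 ν)
    change Real.exp (a μ) - 1 ≤ _
    nlinarith [Real.exp_pos (a μ), ha0 μ]
  have h5 : Summable fun μ : {μ : ℂ // μ ≠ 0} => (1 + (μ : ℂ)) ^ algMult A μ - 1 :=
    Summable.of_norm_bounded (h.mul_right _) key
  simpa using Complex.multipliable_one_add_of_summable h5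

namespace NuclearRep

variable {A : H →L[ℂ] H} {x y : ℕ → H}

/-- The compression to a large `V ⊇ E` has determinant `p * q`. Here `p` is the product over the
eigenvalues of modulus at least `ρ`, near `detOneAdd A`, and `q` is the product over the complement
of `E`, near `1`. The determinant itself is near the infinite matrix determinant. -/
theorem detOneAdd_eq_infDet [CompleteSpace H] (h : NuclearRep A x y) :
    detOneAdd A = infDet fun k l => inner ℂ (x k) (y l) := by
  classical
  set D := infDet fun k l => inner ℂ (x k) (y l) with hD
  set P := detOneAdd A with hP
  set S := ∑' k, √(rowBd x y k) with hS
  have hS0 : 0 ≤ S := tsum_nonneg fun _ => Real.sqrt_nonneg _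
  have hprod := (multipliable_detOneAdd h.detConverges).hasProd
  have key : ∀ ε : ℝ, 0 < ε → ε ≤ 1 → ‖P - D‖ ≤ ε * (3 + ‖P‖) := by
    intro ε hε hε1
    have hev := Metric.tendsto_atTop.1 (show Tendsto _ atTop _ from hprod) ε hε
    obtain ⟨T₀, hT₀⟩ := hev
    obtain ⟨ρ₀, hρ₀, hT₀ρ⟩ : ∃ ρ : ℝ, 0 < ρ ∧ ∀ μ ∈ T₀, ρ ≤ ‖(μ : ℂ)‖ := by
      rcases T₀.eq_empty_or_nonempty with rfl | hne
      · exact ⟨1, one_pos, by simp⟩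
      · obtain ⟨μ₀, -, h0⟩ := T₀.exists_min_image (fun μ => ‖(μ : ℂ)‖) hne
        exact ⟨_, norm_pos_iff.2 μ₀.2, h0⟩
    obtain ⟨ρ, hρ, hρ2, hρT, hρs⟩ : ∃ ρ : ℝ, 0 < ρ ∧ ρ ≤ 1 / 2 ∧ ρ ≤ ρ₀ ∧
        16 * (S + 1) * √ρ ≤ ε := by
      have hc : 0 < (ε / (16 * (S + 1))) ^ 2 := by positivity
      refine ⟨min (min (1 / 2) ρ₀) ((ε / (16 * (S + 1))) ^ 2), by positivity,
        (min_le_left _ _).trans (min_le_left _ _), (min_le_left _ _).trans (min_le_right _ _), ?_⟩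
      have h1 : √(min (min (1 / 2) ρ₀) ((ε / (16 * (S + 1))) ^ 2)) ≤ ε / (16 * (S + 1)) := by
        rw [← Real.sqrt_sq (show 0 ≤ ε / (16 * (S + 1)) by positivity)]
        exact Real.sqrt_le_sqrt ((min_le_right _ _).trans (by rw [Real.sqrt_sq (by positivity)]))
      calc _ ≤ 16 * (S + 1) * (ε / (16 * (S + 1))) := by gcongr
        _ = ε := by field_simp
    obtain ⟨E, _, hinv, hEρ, hmax⟩ := h.exists_maximal_invariant hρ
    have hcount : ∀ μ : ℂ, ρ ≤ ‖μ‖ → algMult A μ = (eigs A E).count μ := fun μ hμ =>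
      algMult_eq_count hinv fun v => hmax μ v hμ
    set p := ((eigs A E).map fun l => 1 + l).prod with hp
    -- the eigenvalue product over the spectral subspace
    have hE0 : ∀ l ∈ eigs A E, l ≠ 0 := fun l hl => norm_pos_iff.1 (hρ.trans_le (hEρ l hl))
    -- Adding all eigenvalues on `E` to `T₀` makes the partial product over `T` equal to `p`: the
    -- other members of `T₀` have multiplicity `0` and contribute the factor `1`.
    let T : Finset {μ : ℂ // μ ≠ 0} := T₀ ∪ (eigs A E).toFinset.subtype (· ≠ 0)
    have hTρ : ∀ μ ∈ T, ρ ≤ ‖(μ : ℂ)‖ := by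
      intro μ hμ
      rcases Finset.mem_union.1 hμ with hμ | hμ
      · exact hρT.trans (hT₀ρ μ hμ)
      · exact hEρ _ (Multiset.mem_toFinset.1 (Finset.mem_subtype.1 hμ))
    have hTp : ∏ μ ∈ T, (1 + (μ : ℂ)) ^ algMult A μ = p := by
      rw [hp, Finset.prod_multiset_map_count]
      calc ∏ μ ∈ T, (1 + (μ : ℂ)) ^ algMult A μ
          = ∏ l ∈ T.map (Function.Embedding.subtype _), (1 + l) ^ (eigs A E).count l := by
            rw [Finset.prod_map]
            exact Finset.prod_congr rfl fun μ hμ => by rw [hcount _ (hTρ μ hμ)]; rfl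
        _ = ∏ l ∈ (eigs A E).toFinset, (1 + l) ^ (eigs A E).count l := by
            symm
            refine Finset.prod_subset (fun l hl => ?_) fun l _ hl => ?_
            · have hl' := hE0 l (Multiset.mem_toFinset.1 hl)
              exact Finset.mem_map.2 ⟨⟨l, hl'⟩, Finset.mem_union_right _
                (Finset.mem_subtype.2 hl), rfl⟩
            · rw [Multiset.count_eq_zero.2 fun h' => hl (Multiset.mem_toFinset.2 h'), pow_zero]
    have h1 : ‖p - P‖ < ε := by
      have := hT₀ T (Finset.subset_union_left)
      rwa [hTp, dist_eq_norm] at this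
    -- a large compression
    have htail : Tendsto (fun n => 2 * (Real.exp (∑' k, rowBd x y k) * ∑' k, rowBd x y (n + k)))
        atTop (𝓝 0) := by
      have := ((tendsto_sum_nat_add (rowBd x y)).const_mul
        (Real.exp (∑' k, rowBd x y k))).const_mul 2
      simpa [add_comm] using this
    obtain ⟨n₀, hn₀⟩ := (htail.eventually (gt_mem_nhds hε)).exists
    obtain ⟨V, _, hEV, hxV, hVρ⟩ := h.exists_compress_eigs_lt hρ hmax n₀
    have h2 := (h.dist_det_compress_le V n₀ hxV).trans hn₀.le
    have h3 : (1 + compress A V).det = p * ((eigs A (V ⊓ Eᗮ)).map fun l => 1 + l).prod := by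
      have := det_one_add_smul_compress (A := A) (V := V) 1
      simp only [one_smul, one_mul] at this
      rw [this, eigs_eq_add hEV fun v hv => by
        rw [Submodule.starProjection_eq_self_iff.2 (hEV (hinv v hv))]; exact hinv v hv,
        Multiset.map_add, Multiset.prod_add]
    set q := ((eigs A (V ⊓ Eᗮ)).map fun l => 1 + l).prod with hq
    have h4 : ‖q - 1‖ ≤ ε :=
      (norm_prod_one_add_sub_one_le hρ hρ2 hS0 hVρ (h.norm_prod_eigs_le _)
        (by linarith [mul_nonneg (by positivity : 0 ≤ S + 1) (Real.sqrt_nonneg ρ)])).trans hρs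
    rw [h3, dist_eq_norm] at h2
    have h5 : P - D = (P - p) - p * (q - 1) + (p * q - D) := by ring
    have h6 : ‖p‖ ≤ ‖P‖ + ε := by
      have := norm_sub_norm_le p P
      linarith
    rw [norm_sub_rev] at h1
    rw [h5]
    calc _ ≤ ‖P - p‖ + ‖p‖ * ‖q - 1‖ + ‖p * q - D‖ := by
          refine (norm_add_le _ _).trans (add_le_add ((norm_sub_le _ _).trans ?_) le_rfl)
          rw [norm_mul]
      _ ≤ ε + (‖P‖ + ε) * ε + ε := by gcongr
      _ ≤ ε * (3 + ‖P‖) := by nlinarith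
  have hlim : Tendsto (fun ε : ℝ => ε * (3 + ‖P‖)) (𝓝[>] 0) (𝓝 0) := by
    have : Tendsto (fun ε : ℝ => ε * (3 + ‖P‖)) (𝓝 0) (𝓝 (0 * (3 + ‖P‖))) :=
      (continuous_id.mul continuous_const).tendsto 0
    rw [zero_mul] at this
    exact this.mono_left nhdsWithin_le_nhds
  have h0 : ‖P - D‖ ≤ 0 := by
    refine ge_of_tendsto hlim ?_
    filter_upwards [Ioc_mem_nhdsGT (zero_lt_one' ℝ)] with ε hε
    exact key ε hε.1 hε.2
  exact sub_eq_zero.1 (norm_le_zero_iff.1 h0)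

/-- Let `f` run through orthonormal eigenvectors of `|A|` with eigenvalues `ν > 0`. Because `A* A =
|A|²`, the vectors `e = ν⁻¹ A f` are orthonormal too, and `⟪e, A f⟫ = ν`. So `sum_norm_inner_le`
bounds the sum of the characteristic values. -/
theorem isTraceClass [CompleteSpace H] (h : NuclearRep A x y) : IsTraceClass A := by
  classical
  refine ⟨h.isCompactOperator, ?_⟩
  set B : H →L[ℂ] H := CFC.abs A with hB
  have hBB : B * B = star A * A := CFC.abs_mul_abs A
  have hBsa : IsSelfAdjoint B := (CFC.abs_nonneg A).isSelfAdjoint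
  have hsymm : (B : H →ₗ[ℂ] H).IsSymmetric :=
    (ContinuousLinearMap.isSelfAdjoint_iff_isSymmetric).1 hBsa
  have hbasis : ∀ ν : {ν : ℝ // 0 < ν}, ∃ b : Fin (Module.finrank ℂ
      (Module.End.eigenspace (B : H →ₗ[ℂ] H) ((ν : ℝ) : ℂ))) →
      Module.End.eigenspace (B : H →ₗ[ℂ] H) ((ν : ℝ) : ℂ), Orthonormal ℂ b := by
    intro ν
    by_cases hfd : FiniteDimensional ℂ (Module.End.eigenspace (B : H →ₗ[ℂ] H) ((ν : ℝ) : ℂ))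
    · exact ⟨stdOrthonormalBasis ℂ _, (stdOrthonormalBasis ℂ _).orthonormal⟩
    -- An infinite dimensional eigenspace would have `finrank` equal to `0` and contribute nothing
    -- to the sum, so the empty family suffices.
    · have h0 := Module.finrank_of_infinite_dimensional hfd
      have : IsEmpty (Fin (Module.finrank ℂ
        (Module.End.eigenspace (B : H →ₗ[ℂ] H) ((ν : ℝ) : ℂ)))) := by rw [h0]; infer_instance
      exact ⟨fun i => isEmptyElim i, ⟨fun i => isEmptyElim i, fun i => isEmptyElim i⟩⟩
  choose b hb using hbasis
  have hfam := (hsymm.orthogonalFamily_eigenspaces).comp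
    (γ := {ν : ℝ // 0 < ν}) (f := fun ν => ((ν : ℝ) : ℂ))
    (fun ν ν' hνν => Subtype.ext (Complex.ofReal_injective hνν))
  let ι := Σ ν : {ν : ℝ // 0 < ν}, Fin (Module.finrank ℂ
      (Module.End.eigenspace (B : H →ₗ[ℂ] H) ((ν : ℝ) : ℂ)))
  let f : ι → H := fun a => (b a.1 a.2 : H)
  have hf : Orthonormal ℂ f := hfam.orthonormal_sigma_orthonormal hb
  have hBf : ∀ a : ι, B (f a) = ((a.1 : ℝ) : ℂ) • f a := fun a =>
    Module.End.mem_eigenspace_iff.1 (b a.1 a.2).2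
  have hν : ∀ a : ι, ((a.1 : ℝ) : ℂ) ≠ 0 := fun a => Complex.ofReal_ne_zero.2 a.1.2.ne'
  let e : ι → H := fun a => ((a.1 : ℝ) : ℂ)⁻¹ • A (f a)
  have hAA : ∀ a a' : ι, inner ℂ (A (f a)) (A (f a')) =
      ((a'.1 : ℝ) : ℂ) * ((a'.1 : ℝ) : ℂ) * inner ℂ (f a) (f a') := by
    intro a a'
    rw [← ContinuousLinearMap.adjoint_inner_right]
    have : (ContinuousLinearMap.adjoint A) (A (f a')) = (star A * A) (f a') := rfl
    rw [this, ← hBB, mul_apply_eq_comp, hBf, map_smul, hBf, smul_smul,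
      inner_smul_right]
  have he : Orthonormal ℂ e := by
    rw [orthonormal_iff_ite] at hf ⊢
    intro a a'
    simp only [e, inner_smul_left, inner_smul_right, hAA, hf a a']
    split_ifs with haa
    · subst haa
      rw [map_inv₀, Complex.conj_ofReal]
      field_simp [hν a]
    · simp
  have hea : ∀ a : ι, ‖inner ℂ (e a) (A (f a))‖ = a.1 := by
    intro a
    simp only [e, inner_smul_left, hAA, inner_self_eq_norm_sq_to_K, hf.1]
    rw [map_inv₀, Complex.conj_ofReal]
    have h1 : ((a.1 : ℝ) : ℂ)⁻¹ * (((a.1 : ℝ) : ℂ) * ((a.1 : ℝ) : ℂ) * (((1 : ℝ) : ℂ)) ^ 2) =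
        ((a.1 : ℝ) : ℂ) := by field_simp [hν a]; simp
    have h2 : ‖((a.1 : ℝ) : ℂ)‖ = a.1 := by
      rw [Complex.norm_real, Real.norm_of_nonneg a.1.2.le]
    exact (congrArg norm h1).trans h2
  refine summable_of_sum_le (c := ∑' k, ‖x k‖ * ‖y k‖)
    (fun ν => mul_nonneg (Nat.cast_nonneg _) ν.2.le) fun T => ?_
  have h1 := h.sum_norm_inner_le (T.sigma fun _ => Finset.univ) he hf
  rw [Finset.sum_sigma] at h1
  refine le_trans (le_of_eq ?_) h1
  refine Finset.sum_congr rfl fun ν _ => ?_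
  simp [hea]

end NuclearRep

/-! ### Holomorphic families of nuclear operators -/

lemma RowBound.mono {M : ℕ → ℕ → ℂ} {b b' : ℕ → ℝ} (h : RowBound M b) (hb : ∀ k, b k ≤ b' k) :
    RowBound M b' := fun i n => (h i n).trans (hb i)

lemma differentiable_secDet {M : ℂ → ℕ → ℕ → ℂ} (hM : ∀ k l, Differentiable ℂ fun s => M s k l)
    (n : ℕ) : Differentiable ℂ fun s => secDet (M s) n := by
  simp only [secDet, Matrix.det_apply]
  refine Differentiable.fun_sum fun σ _ => Differentiable.const_smul ?_ _
  refine Differentiable.fun_finsetProd fun i _ => ?_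
  simp only [Matrix.add_apply, Matrix.of_apply]
  exact (hM _ _).const_add _

/-- The sections are polynomials in entire functions, and a common row bound on each disc makes them
converge locally uniformly. -/
lemma differentiable_infDet {M : ℂ → ℕ → ℕ → ℂ} (hM : ∀ k l, Differentiable ℂ fun s => M s k l)
    (hb : ∀ R : ℝ, ∃ b : ℕ → ℝ, Summable b ∧ ∀ s, ‖s‖ < R → RowBound (M s) b) :
    Differentiable ℂ fun s => infDet (M s) := by
  rw [← differentiableOn_univ]
  refine TendstoLocallyUniformlyOn.differentiableOn (φ := atTop)
    (F := fun n s => secDet (M s) n) ?_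
    (Eventually.of_forall fun n => (differentiable_secDet hM n).differentiableOn) isOpen_univ
  rw [Metric.tendstoLocallyUniformlyOn_iff]
  intro ε hε s _
  obtain ⟨b, hbs, hbM⟩ := hb (‖s‖ + 1)
  refine ⟨Metric.ball s 1, mem_nhdsWithin_of_mem_nhds (Metric.ball_mem_nhds s one_pos), ?_⟩
  have htail : Tendsto (fun n => Real.exp (∑' k, b k) * ∑' k, b (n + k)) atTop (𝓝 0) := by
    have := (tendsto_sum_nat_add b).const_mul (Real.exp (∑' k, b k))
    simpa [add_comm] using this
  filter_upwards [htail.eventually (gt_mem_nhds hε)] with n hn t ht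
  rw [dist_comm]
  refine (dist_secDet_infDet_le (hbM t ?_) hbs n).trans_lt hn
  have := norm_sub_norm_le t s
  rw [mem_ball_iff_norm] at ht
  linarith

lemma summable_pow_add_pow {τ : Type*} [Finite τ] {r : ℝ} (h0 : 0 ≤ r) (h1 : r < 1) :
    HasSum (fun k : τ × ℕ × ℕ => r ^ (k.2.1 + k.2.2)) (Nat.card τ * ((1 - r)⁻¹ * (1 - r)⁻¹)) := by
  have hg := hasSum_geometric_of_lt_one h0 h1
  have h2 : HasSum (fun k : ℕ × ℕ => r ^ (k.1 + k.2)) ((1 - r)⁻¹ * (1 - r)⁻¹) := by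
    simp only [pow_add]
    have hs : Summable fun k : ℕ × ℕ => r ^ k.1 * r ^ k.2 :=
      Summable.mul_of_nonneg (f := fun n => r ^ n) (g := fun n => r ^ n) hg.summable hg.summable
        (fun _ => pow_nonneg h0 _) fun _ => pow_nonneg h0 _
    exact HasSum.mul (f := fun n => r ^ n) (g := fun n => r ^ n) hg hg hs
  have := Fintype.ofFinite τ
  have h3 : HasSum (fun _ : τ => (1 : ℝ)) (Nat.card τ) := by
    simpa using hasSum_fintype fun _ : τ => (1 : ℝ)
  have hs : Summable fun k : τ × ℕ × ℕ => (1 : ℝ) * r ^ (k.2.1 + k.2.2) :=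
    Summable.mul_of_nonneg (f := fun _ : τ => (1 : ℝ)) (g := fun k : ℕ × ℕ => r ^ (k.1 + k.2))
      h3.summable h2.summable (fun _ => zero_le_one) fun _ => pow_nonneg h0 _
  have h4 := HasSum.mul (f := fun _ : τ => (1 : ℝ)) (g := fun k : ℕ × ℕ => r ^ (k.1 + k.2)) h3 h2 hs
  simpa only [one_mul] using h4

lemma inv_one_sub_exp_neg_le {c : ℝ} (hc : 0 < c) : (1 - Real.exp (-c))⁻¹ ≤ 1 + c⁻¹ := by
  have h1 : Real.exp (-c) ≤ (1 + c)⁻¹ := by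
    rw [Real.exp_neg]
    exact inv_anti₀ (by positivity) (by linarith [Real.add_one_le_exp c])
  have h2 : 1 - (1 + c)⁻¹ = c / (1 + c) := by field_simp; ring
  have h3 : 1 + c⁻¹ = (c / (1 + c))⁻¹ := by field_simp; ring
  rw [h3]
  exact inv_anti₀ (by positivity) (by linarith)

lemma one_add_pow_le_one_add_pow {w : ℝ} (hw : 0 ≤ w) {p : ℕ} (hp : 1 ≤ p) :
    1 + w ^ p ≤ (1 + w) ^ p := by
  induction p, hp using Nat.le_induction with
  | base => simp
  | succ p _ ih =>
    calc 1 + w ^ (p + 1) ≤ (1 + w ^ p) * (1 + w) := by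
          rw [pow_succ]; nlinarith [pow_nonneg hw p]
      _ ≤ (1 + w) ^ p * (1 + w) := by gcongr
      _ = _ := (pow_succ _ _).symm

/-- Products over a two-dimensional geometric array grow like `exp (O(T ^ 3))`. -/
lemma prod_one_add_exp_mul_pow_le {τ : Type*} [Finite τ] {c T : ℝ} (hc : 0 < c) (hT : 0 ≤ T)
    (F : Finset (τ × ℕ × ℕ)) :
    ∏ k ∈ F, (1 + Real.exp T * Real.exp (-c) ^ (k.2.1 + k.2.2)) ≤
      Real.exp (Real.exp 1 * Nat.card τ * (1 + c⁻¹) ^ 2 * (T + 2) ^ 3) := by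
  -- With an integer `p ≥ max T 1` and `w = e * r ^ n`, the inequality `1 + w ^ p ≤ (1 + w) ^ p`
  -- removes `e^T` at the price of the slower ratio `r = e^(-c/p)`. The double geometric series in
  -- `r` is `O(p²)`, and the exponent `p` makes this `O(p³)`.
  set p : ℕ := ⌈T⌉₊ + 1 with hp
  have hp0 : (0 : ℝ) < p := by rw [hp]; positivity
  have hTp : T ≤ p := (Nat.le_ceil T).trans (by rw [hp]; push_cast; linarith)
  have hpT : (p : ℝ) ≤ T + 2 := by
    rw [hp]; push_cast; linarith [Nat.ceil_lt_add_one hT]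
  set r := Real.exp (-(c / p)) with hr
  have hr0 : 0 ≤ r := (Real.exp_pos _).le
  have hcp : 0 < c / p := by positivity
  have hr1 : r < 1 := by rw [hr, Real.exp_lt_one_iff]; linarith
  have hsum := summable_pow_add_pow (τ := τ) hr0 hr1
  have hterm : ∀ n : ℕ, 1 + Real.exp T * Real.exp (-c) ^ n ≤
      Real.exp (p * (Real.exp 1 * r ^ n)) := by
    intro n
    have h1 : Real.exp T * Real.exp (-c) ^ n ≤ (Real.exp 1 * r ^ n) ^ p := by
      rw [mul_pow, ← pow_mul, mul_comm n p, pow_mul, hr,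
        ← Real.exp_nat_mul (-(c / p)) p]
      have h2 : (p : ℝ) * -(c / p) = -c := by field_simp
      rw [h2]
      have h3 : Real.exp T ≤ Real.exp 1 ^ p := by
        rw [← Real.exp_nat_mul, mul_one]
        exact Real.exp_le_exp.2 hTp
      exact mul_le_mul_of_nonneg_right h3 (pow_pos (Real.exp_pos _) _).le
    have h3 : 1 + (Real.exp 1 * r ^ n) ^ p ≤ (1 + Real.exp 1 * r ^ n) ^ p := by
      exact one_add_pow_le_one_add_pow (w := Real.exp 1 * r ^ n) (by positivity) (by omega)
    calc _ ≤ _ := by gcongr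
      _ ≤ _ := h3
      _ ≤ (Real.exp (Real.exp 1 * r ^ n)) ^ p := by
          gcongr
          rw [add_comm]
          exact Real.add_one_le_exp _
      _ = _ := (Real.exp_nat_mul _ _).symm
  calc ∏ k ∈ F, (1 + Real.exp T * Real.exp (-c) ^ (k.2.1 + k.2.2))
      ≤ ∏ k ∈ F, Real.exp (p * (Real.exp 1 * r ^ (k.2.1 + k.2.2))) :=
        Finset.prod_le_prod (fun _ _ => by positivity) fun k _ => hterm _
    _ = Real.exp (p * (Real.exp 1 * ∑ k ∈ F, r ^ (k.2.1 + k.2.2))) := by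
        rw [← Real.exp_sum, Finset.mul_sum, Finset.mul_sum]
    _ ≤ _ := by
        rw [Real.exp_le_exp]
        have h4 : ∑ k ∈ F, r ^ (k.2.1 + k.2.2) ≤ Nat.card τ * (((1 + c⁻¹) * p) * ((1 + c⁻¹) * p)) := by
          refine (sum_le_hasSum F (fun k _ => pow_nonneg hr0 _) hsum).trans ?_
          have h5 : (1 - r)⁻¹ ≤ (1 + c⁻¹) * p := by
            refine (inv_one_sub_exp_neg_le hcp).trans ?_
            have hp1 : (1 : ℝ) ≤ p := by rw [hp]; push_cast; linarith [Nat.cast_nonneg (α := ℝ) ⌈T⌉₊]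
            rw [inv_div, add_mul, one_mul, inv_mul_eq_div]
            linarith
          have h6 : 0 ≤ (1 - r)⁻¹ := inv_nonneg.2 (by linarith)
          gcongr
        calc _ ≤ p * (Real.exp 1 * (Nat.card τ * (((1 + c⁻¹) * p) * ((1 + c⁻¹) * p)))) := by gcongr
          _ = Real.exp 1 * Nat.card τ * (1 + c⁻¹) ^ 2 * (p : ℝ) ^ 3 := by ring
          _ ≤ _ := by gcongr

/-- The constant in the exponent is absorbed into `‖s‖ ^ ε` for large `‖s‖`, for every `ε > 0`. -/
lemma entireOrder_le_of_norm_le {F : ℂ → ℂ} {C : ℝ} {d : ℝ≥0}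
    (h : ∀ s, ‖F s‖ ≤ C * Real.exp (C * ‖s‖ ^ (d : ℝ))) : entireOrder F ≤ d := by
  refine ENNReal.le_of_forall_pos_le_add fun ε hε _ => ?_
  refine iInf₂_le_of_le (d + ε) ?_ (by push_cast; rfl)
  refine Asymptotics.IsBigO.of_bound |C| ?_
  have h1 : Tendsto (fun s : ℂ => ‖s‖ ^ (ε : ℝ)) (cocompact ℂ) atTop :=
    (tendsto_rpow_atTop (by exact_mod_cast hε)).comp tendsto_norm_cocompact_atTop
  filter_upwards [h1.eventually_ge_atTop C,
    tendsto_norm_cocompact_atTop.eventually_gt_atTop 0] with s hs hs0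
  rw [Real.norm_of_nonneg (Real.exp_pos _).le]
  refine (h s).trans ?_
  refine mul_le_mul (le_abs_self C) ?_ (Real.exp_pos _).le (abs_nonneg C)
  rw [Real.exp_le_exp, NNReal.coe_add, Real.rpow_add hs0, mul_comm]
  gcongr

variable {H : Type*} [NormedAddCommGroup H] [InnerProductSpace ℂ H]

/-- A family of operators `L s = ∑ k, ⟪x k, ·⟫ y s k`, with vectors that decay geometrically in a
two-dimensional array and depend holomorphically on `s`, at most with exponential growth. -/
structure GeometricFamily {τ : Type*} (L : ℂ → H →L[ℂ] H) (x : τ × ℕ × ℕ → H)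
    (y : ℂ → τ × ℕ × ℕ → H) (c K : ℝ) : Prop where
  rate_pos : 0 < c
  const_pos : 0 < K
  norm_left : ∀ k, ‖x k‖ ≤ K * Real.exp (-c) ^ (k.2.1 + k.2.2)
  norm_right : ∀ s k, ‖y s k‖ ≤ K * Real.exp (K * ‖s‖) * Real.exp (-c) ^ (k.2.1 + k.2.2)
  differentiable : ∀ k l, Differentiable ℂ fun s => inner ℂ (x k) (y s l)
  hasSum : ∀ s u, HasSum (fun k => inner ℂ (x k) u • y s k) (L s u)

namespace GeometricFamily

variable {τ : Type*} {L : ℂ → H →L[ℂ] H} {x : τ × ℕ × ℕ → H}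
  {y : ℂ → τ × ℕ × ℕ → H} {c K : ℝ}

lemma neg (h : GeometricFamily L x y c K) :
    GeometricFamily (fun s => -(L s)) (fun k => -(x k)) y c K where
  rate_pos := h.rate_pos
  const_pos := h.const_pos
  norm_left k := by rw [norm_neg]; exact h.norm_left k
  norm_right := h.norm_right
  differentiable k l := by
    simp only [inner_neg_left]
    exact (h.differentiable k l).neg
  hasSum s u := by simpa [inner_neg_left] using (h.hasSum s u).neg

variable [Finite τ]

lemma nuclearRep (h : GeometricFamily L x y c K) (e : ℕ ≃ τ × ℕ × ℕ) (s : ℂ) :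
    NuclearRep (L s) (x ∘ e) (y s ∘ e) where
  summable_left := by
    have hc := h.rate_pos
    have h1 : √(Real.exp (-c)) < 1 := by
      rw [Real.sqrt_lt' one_pos, one_pow, Real.exp_lt_one_iff]; linarith
    have h2 := ((summable_pow_add_pow (τ := τ) (Real.sqrt_nonneg _) h1).summable).mul_left √K
    refine (e.summable_iff (f := fun k => √‖x k‖)).2
      (Summable.of_nonneg_of_le (fun _ => Real.sqrt_nonneg _) (fun k => ?_) h2)
    refine (Real.sqrt_le_sqrt (h.norm_left k)).trans (le_of_eq ?_)
    rw [Real.sqrt_mul h.const_pos.le, Real.sqrt_eq_rpow (_ ^ _), Real.sqrt_eq_rpow (Real.exp _),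
      Real.rpow_pow_comm (Real.exp_pos _).le]
  summable_right := by
    have hc := h.rate_pos
    have h1 : Real.exp (-c) < 1 := by rw [Real.exp_lt_one_iff]; linarith
    have h2 := ((summable_pow_add_pow (τ := τ) (Real.exp_pos (-c)).le h1).summable).mul_left
      (K * Real.exp (K * ‖s‖))
    exact (e.summable_iff (f := fun k => ‖y s k‖)).2
      (Summable.of_nonneg_of_le (fun _ => norm_nonneg _) (h.norm_right s) h2)
  hasSum u := (e.hasSum_iff (f := fun k => inner ℂ (x k) u • y s k)).2 (h.hasSum s u)

/-- All constants are moved into one exponential `e^T` with `T` linear in `‖s‖`, the form required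
by `prod_one_add_exp_mul_pow_le`. -/
lemma exists_rowBd_le (h : GeometricFamily L x y c K) (e : ℕ ≃ τ × ℕ × ℕ) :
    ∃ K' : ℝ, 0 < K' ∧ ∀ s n, rowBd (x ∘ e) (y s ∘ e) n ≤
      Real.exp (K' * (1 + ‖s‖)) * Real.exp (-c) ^ ((e n).2.1 + (e n).2.2) := by
  have hc := h.rate_pos
  have hK := h.const_pos
  have h1 : Real.exp (-c) < 1 := by rw [Real.exp_lt_one_iff]; linarith
  have hs := summable_pow_add_pow (τ := τ) (Real.exp_pos (-c)).le h1
  set Q : ℝ := Nat.card τ * ((1 - Real.exp (-c))⁻¹ * (1 - Real.exp (-c))⁻¹) with hQ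
  have hQ0 : 0 ≤ Q := by
    have : 0 ≤ (1 - Real.exp (-c))⁻¹ := inv_nonneg.2 (by linarith)
    positivity
  refine ⟨K + K * K * Q, by positivity, fun s n => ?_⟩
  have h2 : ∑' l, ‖(y s ∘ e) l‖ ≤ K * Real.exp (K * ‖s‖) * Q := by
    refine (h.nuclearRep e s).summable_right.tsum_le_of_sum_le fun F => ?_
    have h3 : ∑ l ∈ F, ‖(y s ∘ e) l‖ = ∑ k ∈ F.map e.toEmbedding, ‖y s k‖ := by
      rw [Finset.sum_map]; rfl
    rw [h3]
    calc _ ≤ ∑ k ∈ F.map e.toEmbedding, K * Real.exp (K * ‖s‖) * Real.exp (-c) ^ (k.2.1 + k.2.2) :=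
          Finset.sum_le_sum fun k _ => h.norm_right s k
      _ ≤ _ := by
          rw [← Finset.mul_sum]
          gcongr
          exact sum_le_hasSum _ (fun _ _ => by positivity) hs
  have h4 : K * K * Q ≤ Real.exp (K * K * Q) := by linarith [Real.add_one_le_exp (K * K * Q)]
  calc rowBd (x ∘ e) (y s ∘ e) n
      ≤ (K * Real.exp (-c) ^ ((e n).2.1 + (e n).2.2)) * (K * Real.exp (K * ‖s‖) * Q) :=
        mul_le_mul (h.norm_left (e n)) h2 (tsum_nonneg fun _ => norm_nonneg _) (by positivity)
    _ = (K * K * Q) * Real.exp (K * ‖s‖) * Real.exp (-c) ^ ((e n).2.1 + (e n).2.2) := by ring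
    _ ≤ Real.exp (K * K * Q) * Real.exp (K * ‖s‖) * Real.exp (-c) ^ ((e n).2.1 + (e n).2.2) := by
        gcongr
    _ ≤ _ := by
        rw [← Real.exp_add]
        gcongr
        have h5 : 0 ≤ K * K * Q * ‖s‖ := by positivity
        linarith

theorem det_neg [Nonempty τ] [CompleteSpace H] (h : GeometricFamily L x y c K) :
    (∀ s, IsTraceClass (L s)) ∧ (∀ s, DetConverges (-(L s))) ∧
      (∃ C : ℝ, 0 < C ∧ ∀ s : ℂ, ‖detOneAdd (-(L s))‖ ≤ C * Real.exp (C * ‖s‖ ^ 3)) ∧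
      Differentiable ℂ (fun s : ℂ => detOneAdd (-(L s))) ∧
      entireOrder (fun s : ℂ => detOneAdd (-(L s))) ≤ 3 := by
  obtain ⟨_⟩ := nonempty_fintype τ
  obtain ⟨hden⟩ := nonempty_denumerable (τ × ℕ × ℕ)
  let e : ℕ ≃ τ × ℕ × ℕ := (Denumerable.eqv _).symm
  have hn := h.neg
  have hrep := hn.nuclearRep e
  have hdet : ∀ s, detOneAdd (-(L s)) =
      infDet fun k l => inner ℂ (((fun k => -(x k)) ∘ e) k) ((y s ∘ e) l) := fun s =>
    (hrep s).detOneAdd_eq_infDet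
  obtain ⟨K', hK', hb⟩ := hn.exists_rowBd_le e
  have hc := h.rate_pos
  have hbound : ∃ C : ℝ, 0 < C ∧ ∀ s : ℂ, ‖detOneAdd (-(L s))‖ ≤ C * Real.exp (C * ‖s‖ ^ 3) := by
    set K₁ := Real.exp 1 * Nat.card τ * (1 + c⁻¹) ^ 2 with hK₁
    have hK₁0 : 0 ≤ K₁ := by positivity
    -- The factor `4` comes from `(1 + a)³ ≤ 4 (1 + a³)`, which leaves a pure cube in the exponent.
    set K₂ := 4 * K₁ * (K' + 2) ^ 3 with hK₂
    have hK₂0 : 0 ≤ K₂ := by positivity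
    refine ⟨Real.exp K₂ + K₂, by positivity, fun s => ?_⟩
    have h1 : ‖detOneAdd (-(L s))‖ ≤ Real.exp (K₁ * (K' * (1 + ‖s‖) + 2) ^ 3) := by
      rw [hdet]
      refine norm_infDet_le (hrep s).rowBound (hrep s).summable_rowBd fun n => ?_
      calc _ ≤ ∏ i ∈ Finset.range n, (1 + Real.exp (K' * (1 + ‖s‖)) *
              Real.exp (-c) ^ ((e i).2.1 + (e i).2.2)) :=
            Finset.prod_le_prod (fun i _ => add_nonneg zero_le_one (rowBd_nonneg _ _ i))
              fun i _ => by linarith [hb s i]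
        _ = ∏ k ∈ (Finset.range n).map e.toEmbedding, (1 + Real.exp (K' * (1 + ‖s‖)) *
              Real.exp (-c) ^ (k.2.1 + k.2.2)) := by rw [Finset.prod_map]; rfl
        _ ≤ _ := prod_one_add_exp_mul_pow_le hc (by positivity) _
    refine h1.trans ?_
    have hs := norm_nonneg s
    have h2 : K₁ * (K' * (1 + ‖s‖) + 2) ^ 3 ≤ K₂ + K₂ * ‖s‖ ^ 3 := by
      have h3 : (K' * (1 + ‖s‖) + 2) ^ 3 ≤ ((K' + 2) * (1 + ‖s‖)) ^ 3 := by
        gcongr; nlinarith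
      have h4 : (1 + ‖s‖) ^ 3 ≤ 4 * (1 + ‖s‖ ^ 3) := by
        nlinarith [mul_nonneg (add_nonneg zero_le_one hs) (sq_nonneg (‖s‖ - 1))]
      calc _ ≤ K₁ * ((K' + 2) ^ 3 * (4 * (1 + ‖s‖ ^ 3))) := by
            rw [mul_pow] at h3
            exact mul_le_mul_of_nonneg_left (h3.trans (by gcongr)) hK₁0
        _ = _ := by rw [hK₂]; ring
    calc _ ≤ Real.exp K₂ * Real.exp (K₂ * ‖s‖ ^ 3) := by
          rw [← Real.exp_add]; exact Real.exp_le_exp.2 h2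
      _ ≤ _ := by
          gcongr
          · linarith
          · linarith [Real.exp_pos K₂]
  refine ⟨fun s => (h.nuclearRep e s).isTraceClass, fun s => (hrep s).detConverges, hbound, ?_, ?_⟩
  · simp only [hdet]
    refine differentiable_infDet (fun k l => hn.differentiable _ _) fun R => ?_
    refine ⟨fun n => Real.exp (K' * (1 + R)) * Real.exp (-c) ^ ((e n).2.1 + (e n).2.2), ?_, ?_⟩
    · have h1 : Real.exp (-c) < 1 := by rw [Real.exp_lt_one_iff]; linarith
      exact ((e.summable_iff (f := fun k => Real.exp (-c) ^ (k.2.1 + k.2.2))).2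
        (summable_pow_add_pow (τ := τ) (Real.exp_pos (-c)).le h1).summable).mul_left _
    · intro s hs
      refine (hrep s).rowBound.mono fun n => (hb s n).trans ?_
      gcongr
  · obtain ⟨C, -, hC⟩ := hbound
    have := entireOrder_le_of_norm_le (F := fun s => detOneAdd (-(L s))) (C := C) (d := 3)
      fun s => by
        have := hC s
        rwa [← Real.rpow_natCast] at this
    exact_mod_cast this

end GeometricFamily

/-! ### Taylor coefficients in one and two variables -/

/-- The Taylor coefficients of a holomorphic function at `w`, from its values on a circle. -/
def taylorCoeff (f : ℂ → ℂ) (w : ℂ) (R : ℝ) (n : ℕ) : ℂ :=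
  ((2 * π)⁻¹ : ℝ) * ∫ θ in 0..2 * π, (circleMap 0 R θ)⁻¹ ^ n * f (circleMap w R θ)

lemma hasSum_taylorCoeff {f : ℂ → ℂ} {w z : ℂ} {R : ℝ}
    (hf : ∀ v ∈ Metric.closedBall w R, DifferentiableAt ℂ f v) (hz : ‖z - w‖ < R) :
    HasSum (fun n => taylorCoeff f w R n * (z - w) ^ n) (f z) := by
  have hd : DifferentiableOn ℂ f (Metric.closedBall w R) := fun v hv =>
    (hf v hv).differentiableWithinAt
  have hR : 0 < R := (norm_nonneg _).trans_lt hz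
  have h1 := hasSum_cauchyPowerSeries_integral (f := f) (c := w) (R := R) (w := z - w)
    ((hd.continuousOn.mono Metric.sphere_subset_closedBall).circleIntegrable hR.le) hz
  have hc := hd.circleIntegral_sub_inv_smul (w := z) (mem_ball_iff_norm.2 hz)
  rw [add_sub_cancel, hc, smul_smul, inv_mul_cancel₀ Complex.two_pi_I_ne_zero, one_smul] at h1
  have key : ∀ n, (cauchyPowerSeries f w R n fun _ => z - w) =
      taylorCoeff f w R n * (z - w) ^ n := by
    intro n
    rw [cauchyPowerSeries_apply, taylorCoeff, circleIntegral, smul_eq_mul,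
      ← intervalIntegral.integral_const_mul, ← intervalIntegral.integral_const_mul,
      ← intervalIntegral.integral_mul_const]
    refine intervalIntegral.integral_congr fun θ _ => ?_
    have h0 : circleMap 0 R θ ≠ 0 := circleMap_ne_center hR.ne'
    have hπ : (π : ℂ) ≠ 0 := Complex.ofReal_ne_zero.2 Real.pi_ne_zero
    simp only [deriv_circleMap, circleMap_sub_center, smul_eq_mul, div_pow, inv_pow]
    push_cast
    field_simp [Complex.I_ne_zero]
  simp only [key] at h1
  exact h1

lemma norm_taylorCoeff_le {f : ℂ → ℂ} {w : ℂ} {R M : ℝ} (hR : 0 < R)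
    (hf : ∀ v ∈ Metric.sphere w R, ‖f v‖ ≤ M) (n : ℕ) : ‖taylorCoeff f w R n‖ ≤ M * R⁻¹ ^ n := by
  have h1 : ‖∫ θ in 0..2 * π, (circleMap 0 R θ)⁻¹ ^ n * f (circleMap w R θ)‖ ≤
      R⁻¹ ^ n * M * |2 * π - 0| := by
    refine intervalIntegral.norm_integral_le_of_norm_le_const fun θ _ => ?_
    rw [norm_mul, norm_pow, norm_inv, norm_circleMap_zero, abs_of_pos hR]
    gcongr
    exact hf _ (circleMap_mem_sphere w hR.le θ)
  have hπ := Real.pi_pos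
  rw [taylorCoeff, norm_mul]
  rw [sub_zero, abs_of_pos (by positivity)] at h1
  rw [Complex.norm_real, Real.norm_of_nonneg (by positivity)]
  calc _ ≤ (2 * π)⁻¹ * (R⁻¹ ^ n * M * (2 * π)) := by gcongr
    _ = _ := by field_simp

/-- The Taylor coefficients of a holomorphic function of two variables. -/
def taylorCoeff₂ (u : ℂ × ℂ → ℂ) (w : ℂ × ℂ) (R : ℝ) (a b : ℕ) : ℂ :=
  taylorCoeff (fun v => taylorCoeff (fun v' => u (v, v')) w.2 R b) w.1 R a

section

variable {u : ℂ × ℂ → ℂ} {w : ℂ × ℂ} {R : ℝ}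

lemma prodMk_mem_closedBall {v v' : ℂ} (hv : v ∈ Metric.closedBall w.1 R)
    (hv' : v' ∈ Metric.closedBall w.2 R) : (v, v') ∈ Metric.closedBall w R := by
  rw [← closedBall_prod_same]; exact ⟨hv, hv'⟩

lemma norm_taylorCoeff₂_le {M : ℝ} (hR : 0 < R) (hu : ∀ v ∈ Metric.closedBall w R, ‖u v‖ ≤ M)
    (a b : ℕ) : ‖taylorCoeff₂ u w R a b‖ ≤ M * R⁻¹ ^ (a + b) := by
  rw [pow_add, mul_comm (R⁻¹ ^ a), ← mul_assoc]
  exact norm_taylorCoeff_le hR (fun v hv => norm_taylorCoeff_le hR (fun v' hv' =>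
    hu _ (prodMk_mem_closedBall (Metric.sphere_subset_closedBall hv)
      (Metric.sphere_subset_closedBall hv'))) b) a

lemma continuous_comp_circleMap (hR : 0 < R) (hu : ContinuousOn u (Metric.closedBall w R)) :
    Continuous fun p : ℝ × ℝ => u (circleMap w.1 R p.1, circleMap w.2 R p.2) := by
  refine hu.comp_continuous (by fun_prop) fun p => ?_
  exact prodMk_mem_closedBall (circleMap_mem_closedBall _ hR.le _)
    (circleMap_mem_closedBall _ hR.le _)

lemma continuous_inv_circleMap_pow (hR : 0 < R) (n : ℕ) :
    Continuous fun θ : ℝ => (circleMap 0 R θ)⁻¹ ^ n :=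
  ((continuous_circleMap 0 R).inv₀ fun _ => circleMap_ne_center hR.ne').pow n

lemma continuous_taylorCoeff_circleMap (hR : 0 < R) (hu : ContinuousOn u (Metric.closedBall w R))
    (b : ℕ) : Continuous fun θ : ℝ =>
      taylorCoeff (fun v' => u (circleMap w.1 R θ, v')) w.2 R b := by
  refine continuous_const.mul ?_
  refine intervalIntegral.continuous_parametric_intervalIntegral_of_continuous' ?_ _ _
  exact ((continuous_inv_circleMap_pow hR b).comp continuous_snd).mul
    (continuous_comp_circleMap hR hu)

lemma taylorCoeff₂_add {v : ℂ × ℂ → ℂ} (hR : 0 < R) (hu : ContinuousOn u (Metric.closedBall w R))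
    (hv : ContinuousOn v (Metric.closedBall w R)) (a b : ℕ) :
    taylorCoeff₂ (u + v) w R a b = taylorCoeff₂ u w R a b + taylorCoeff₂ v w R a b := by
  have h1 : ∀ θ, taylorCoeff (fun v' => (u + v) (circleMap w.1 R θ, v')) w.2 R b =
      taylorCoeff (fun v' => u (circleMap w.1 R θ, v')) w.2 R b +
        taylorCoeff (fun v' => v (circleMap w.1 R θ, v')) w.2 R b := by
    intro θ
    simp only [taylorCoeff, Pi.add_apply, mul_add]
    rw [intervalIntegral.integral_add, mul_add]
    · exact (((continuous_inv_circleMap_pow hR b).mul ((continuous_comp_circleMap hR hu).comp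
        (Continuous.prodMk_right θ)))).intervalIntegrable _ _
    · exact (((continuous_inv_circleMap_pow hR b).mul ((continuous_comp_circleMap hR hv).comp
        (Continuous.prodMk_right θ)))).intervalIntegrable _ _
  have h2 : ∀ u' : ℂ × ℂ → ℂ, taylorCoeff₂ u' w R a b =
      ((2 * π)⁻¹ : ℝ) * ∫ θ in 0..2 * π, (circleMap 0 R θ)⁻¹ ^ a *
        taylorCoeff (fun v' => u' (circleMap w.1 R θ, v')) w.2 R b := fun _ => rfl
  rw [h2, h2, h2]
  simp only [h1, mul_add]
  rw [intervalIntegral.integral_add, mul_add]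
  · exact ((continuous_inv_circleMap_pow hR a).mul
      (continuous_taylorCoeff_circleMap hR hu b)).intervalIntegrable _ _
  · exact ((continuous_inv_circleMap_pow hR a).mul
      (continuous_taylorCoeff_circleMap hR hv b)).intervalIntegrable _ _

lemma taylorCoeff_const_mul (c : ℂ) (f : ℂ → ℂ) (w : ℂ) (R : ℝ) (n : ℕ) :
    taylorCoeff (fun v => c * f v) w R n = c * taylorCoeff f w R n := by
  simp only [taylorCoeff, mul_left_comm _ c, intervalIntegral.integral_const_mul]

lemma taylorCoeff₂_smul (c : ℂ) (a b : ℕ) :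
    taylorCoeff₂ (c • u) w R a b = c * taylorCoeff₂ u w R a b := by
  simp only [taylorCoeff₂, Pi.smul_apply, smul_eq_mul, taylorCoeff_const_mul]

lemma taylorCoeff_congr {f g : ℂ → ℂ} {w : ℂ} (hR : 0 < R) (n : ℕ)
    (h : ∀ v ∈ Metric.closedBall w R, f v = g v) : taylorCoeff f w R n = taylorCoeff g w R n := by
  simp only [taylorCoeff]
  congr 1
  refine intervalIntegral.integral_congr fun θ _ => ?_
  simp only [h _ (circleMap_mem_closedBall _ hR.le _)]

lemma taylorCoeff₂_congr {v : ℂ × ℂ → ℂ} (hR : 0 < R) (a b : ℕ)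
    (h : ∀ z ∈ Metric.closedBall w R, u z = v z) :
    taylorCoeff₂ u w R a b = taylorCoeff₂ v w R a b :=
  taylorCoeff_congr hR a fun _ hx => taylorCoeff_congr hR b fun _ hy =>
    h _ (prodMk_mem_closedBall hx hy)

/-- The Taylor expansion of a holomorphic function in a bidisc. -/
lemma hasSum_taylorCoeff₂ {z : ℂ × ℂ} (hu : ∀ v ∈ Metric.closedBall w R, DifferentiableAt ℂ u v)
    (hz : ‖z - w‖ < R) :
    HasSum (fun n : ℕ × ℕ => taylorCoeff₂ u w R n.1 n.2 *
      ((z.1 - w.1) ^ n.1 * (z.2 - w.2) ^ n.2)) (u z) := by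
  have hR : 0 < R := (norm_nonneg _).trans_lt hz
  have hz1 : ‖z.1 - w.1‖ < R := (norm_fst_le (z - w)).trans_lt hz
  have hz2 : ‖z.2 - w.2‖ < R := (norm_snd_le (z - w)).trans_lt hz
  have huc : ContinuousOn u (Metric.closedBall w R) := fun v hv =>
    (hu v hv).continuousAt.continuousWithinAt
  obtain ⟨M, hM⟩ := (isCompact_closedBall w R).exists_bound_of_continuousOn huc
  have hM0 : 0 ≤ M := (norm_nonneg _).trans (hM w (Metric.mem_closedBall_self hR.le))
  have hq1 : ‖z.1 - w.1‖ / R < 1 := (div_lt_one hR).2 hz1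
  have hq2 : ‖z.2 - w.2‖ / R < 1 := (div_lt_one hR).2 hz2
  have hg1 := summable_geometric_of_lt_one (by positivity) hq1
  have hg2 := summable_geometric_of_lt_one (by positivity) hq2
  -- Absolute summability is settled first, by Cauchy's estimates. The value is then found by
  -- iterated summation: over `b` under the circle integral, by dominated convergence, and over `a`
  -- by the expansion in the first variable.
  have hsum : Summable fun n : ℕ × ℕ => taylorCoeff₂ u w R n.1 n.2 *
      ((z.1 - w.1) ^ n.1 * (z.2 - w.2) ^ n.2) := by
    have hg := Summable.mul_of_nonneg (f := fun n => (‖z.1 - w.1‖ / R) ^ n)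
      (g := fun n => (‖z.2 - w.2‖ / R) ^ n) hg1 hg2 (fun _ => by positivity)
      (fun _ => by positivity)
    refine Summable.of_norm_bounded (hg.mul_left M) fun n => ?_
    rw [norm_mul, norm_mul, norm_pow, norm_pow]
    calc _ ≤ M * R⁻¹ ^ (n.1 + n.2) * (‖z.1 - w.1‖ ^ n.1 * ‖z.2 - w.2‖ ^ n.2) := by
          gcongr
          exact norm_taylorCoeff₂_le hR hM _ _
      _ = _ := by rw [pow_add, div_pow, div_pow]; simp only [inv_pow]; field_simp
  have hfst : HasSum (fun a => taylorCoeff (fun v => u (v, z.2)) w.1 R a * (z.1 - w.1) ^ a)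
      (u z) := by
    refine hasSum_taylorCoeff (f := fun v => u (v, z.2)) (fun v hv => ?_) hz1
    have h1 := hu (v, z.2) (prodMk_mem_closedBall hv (mem_closedBall_iff_norm.2 hz2.le))
    exact h1.comp v (by fun_prop : DifferentiableAt ℂ (fun v : ℂ => (v, z.2)) v)
  have hfib : ∀ a, HasSum (fun b => taylorCoeff₂ u w R a b *
      ((z.1 - w.1) ^ a * (z.2 - w.2) ^ b))
      (taylorCoeff (fun v => u (v, z.2)) w.1 R a * (z.1 - w.1) ^ a) := by
    intro a
    have h1 : HasSum (fun b => ∫ θ in 0..2 * π, (circleMap 0 R θ)⁻¹ ^ a *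
        (taylorCoeff (fun v' => u (circleMap w.1 R θ, v')) w.2 R b * (z.2 - w.2) ^ b))
        (∫ θ in 0..2 * π, (circleMap 0 R θ)⁻¹ ^ a * u (circleMap w.1 R θ, z.2)) := by
      refine intervalIntegral.hasSum_integral_of_dominated_convergence
        (fun b _ => R⁻¹ ^ a * (M * (‖z.2 - w.2‖ / R) ^ b)) (fun b => ?_) (fun b => ?_) ?_ ?_ ?_
      · exact ((continuous_inv_circleMap_pow hR a).mul ((continuous_taylorCoeff_circleMap hR huc
          b).mul continuous_const)).aestronglyMeasurable
      · refine Eventually.of_forall fun θ _ => ?_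
        rw [norm_mul, norm_mul, norm_pow, norm_inv, norm_circleMap_zero, abs_of_pos hR, norm_pow]
        have h2 := norm_taylorCoeff_le (f := fun v' => u (circleMap w.1 R θ, v')) (w := w.2)
          hR (fun v' hv' => hM _ (prodMk_mem_closedBall (circleMap_mem_closedBall _ hR.le θ)
            (Metric.sphere_subset_closedBall hv'))) b
        calc _ ≤ R⁻¹ ^ a * (M * R⁻¹ ^ b * ‖z.2 - w.2‖ ^ b) := by gcongr
          _ = _ := by rw [div_pow]; simp only [inv_pow]; field_simp
      · exact Eventually.of_forall fun θ _ => (hg2.mul_left _).mul_left _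
      · exact intervalIntegrable_const
      · refine Eventually.of_forall fun θ _ => HasSum.mul_left _ ?_
        refine hasSum_taylorCoeff (f := fun v' => u (circleMap w.1 R θ, v')) (fun v' hv' => ?_) hz2
        have h1 := hu (circleMap w.1 R θ, v')
          (prodMk_mem_closedBall (circleMap_mem_closedBall _ hR.le θ) hv')
        exact h1.comp v' (by fun_prop : DifferentiableAt ℂ (fun v' : ℂ => (circleMap w.1 R θ, v')) v')
    have h3 := (h1.mul_left ((((2 * π)⁻¹ : ℝ)) : ℂ)).mul_right ((z.1 - w.1) ^ a)
    refine h3.congr_fun fun b => ?_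
    simp only [← mul_assoc, intervalIntegral.integral_mul_const]
    rw [taylorCoeff₂, taylorCoeff]
    ring
  have h4 := hsum.hasSum.prod_fiberwise hfib
  rw [← h4.unique hfst]
  exact hsum.hasSum

end

/-! ### Transfer operators on Bergman spaces -/

variable {D : TopologicalSpace.Opens (ℂ × ℂ)}

/-- Continuous functions that agree almost everywhere on an open set agree on it. Thus the chosen
representative is determined on `D`, and its linearity can be used there. -/
lemma holRep_eqOn {u : bergmanSpace D} {F : ℂ × ℂ → ℂ} (hF : DifferentiableOn ℂ F D)
    (h : (u : Lp ℂ 2 ((volume : Measure (ℂ × ℂ)).restrict D))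
      =ᵐ[(volume : Measure (ℂ × ℂ)).restrict D] F) : EqOn (holRep u) F D :=
  Measure.eqOn_open_of_ae_eq ((holRep_ae_eq u).symm.trans h) D.isOpen
    (holRep_differentiableOn u).continuousOn hF.continuousOn

lemma holRep_add (u v : bergmanSpace D) : EqOn (holRep (u + v)) (holRep u + holRep v) D :=
  holRep_eqOn ((holRep_differentiableOn u).add (holRep_differentiableOn v))
    ((Lp.coeFn_add _ _).trans ((holRep_ae_eq u).add (holRep_ae_eq v)))

lemma holRep_smul (c : ℂ) (u : bergmanSpace D) : EqOn (holRep (c • u)) (c • holRep u) D :=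
  holRep_eqOn ((holRep_differentiableOn u).const_smul c)
    ((Lp.coeFn_smul _ _).trans ((holRep_ae_eq u).const_smul c))

lemma exists_norm_holRep_le {r : ℝ} (hr : 0 < r) : ∃ C : ℝ, 0 ≤ C ∧
    ∀ w : ℂ × ℂ, Metric.closedBall w r ⊆ D → ∀ u : bergmanSpace D, ‖holRep u w‖ ≤ C * ‖u‖ := by
  obtain ⟨C, hC, h⟩ := sup_bound D.isOpen hr
  exact ⟨C, hC, fun w hw u => h w hw u _ (holRep_differentiableOn u) (holRep_ae_eq u)⟩

/-- The Taylor coefficients of the elements of a Bergman space are bounded functionals. -/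
lemma exists_riesz_taylorCoeff₂ {r : ℝ} (hr : 0 < r) : ∃ C : ℝ, 0 ≤ C ∧
    ∀ w : ℂ × ℂ, Metric.closedBall w (3 * r) ⊆ D → ∀ a b : ℕ, ∃ x : bergmanSpace D,
      ‖x‖ ≤ C * (2 * r)⁻¹ ^ (a + b) ∧
      ∀ u, inner ℂ x u = taylorCoeff₂ (holRep u) w (2 * r) a b := by
  obtain ⟨C, hC, hb⟩ := exists_norm_holRep_le (D := D) hr
  refine ⟨C, hC, fun w hw a b => ?_⟩
  have hr2 : 0 < 2 * r := by positivity
  have hsub : Metric.closedBall w (2 * r) ⊆ D :=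
    (Metric.closedBall_subset_closedBall (by linarith)).trans hw
  have hcont (u : bergmanSpace D) : ContinuousOn (holRep u) (Metric.closedBall w (2 * r)) :=
    (holRep_differentiableOn u).continuousOn.mono hsub
  let l : bergmanSpace D →ₗ[ℂ] ℂ :=
    { toFun := fun u => taylorCoeff₂ (holRep u) w (2 * r) a b
      map_add' := fun u v => by
        rw [← taylorCoeff₂_add hr2 (hcont u) (hcont v)]
        exact taylorCoeff₂_congr hr2 a b fun z hz => holRep_add u v (hsub hz)
      map_smul' := fun c u => by
        rw [RingHom.id_apply, smul_eq_mul, ← taylorCoeff₂_smul]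
        exact taylorCoeff₂_congr hr2 a b fun z hz => holRep_smul c u (hsub hz) }
  -- The expansion uses radius `2 * r`; each point of that bidisc still has a ball of radius `r`
  -- inside `D`, where the mean value property bounds point evaluations.
  have hl : ∀ u, ‖l u‖ ≤ C * (2 * r)⁻¹ ^ (a + b) * ‖u‖ := by
    intro u
    rw [mul_right_comm]
    refine norm_taylorCoeff₂_le hr2 (fun v hv => hb v ?_ u) a b
    refine (Metric.closedBall_subset_closedBall' ?_).trans hw
    linarith [Metric.mem_closedBall.1 hv]
  refine ⟨(InnerProductSpace.toDual ℂ (bergmanSpace D)).symm (l.mkContinuous _ hl), ?_, ?_⟩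
  · rw [LinearIsometryEquiv.norm_map]
    exact l.mkContinuous_norm_le (by positivity) hl
  · intro u
    rw [InnerProductSpace.toDual_symm_apply]
    rfl

section BoundedFunctions

variable [hfin : IsFiniteMeasure ((volume : Measure (ℂ × ℂ)).restrict D)]

lemma memLp_of_forall_norm_le {F : ℂ × ℂ → ℂ} {M : ℝ}
    (hF : AEStronglyMeasurable F ((volume : Measure (ℂ × ℂ)).restrict D))
    (hM : ∀ z ∈ D, ‖F z‖ ≤ M) : MemLp F 2 ((volume : Measure (ℂ × ℂ)).restrict D) :=
  MemLp.of_bound hF M ((ae_restrict_mem D.isOpen.measurableSet).mono hM)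

lemma norm_le_of_forall_norm_le {M : ℝ} (hM0 : 0 ≤ M) {F : ℂ × ℂ → ℂ}
    {S : Lp ℂ 2 ((volume : Measure (ℂ × ℂ)).restrict D)}
    (hS : S =ᵐ[(volume : Measure (ℂ × ℂ)).restrict D] F) (hM : ∀ z ∈ D, ‖F z‖ ≤ M) :
    ‖S‖ ≤ measureUnivNNReal ((volume : Measure (ℂ × ℂ)).restrict D) ^ (2⁻¹ : ℝ) * M := by
  have h := Lp.norm_le_of_ae_bound (f := S) hM0 (by
    filter_upwards [hS, ae_restrict_mem D.isOpen.measurableSet] with z hz hzD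
    rw [hz]; exact hM z hzD)
  simpa using h

/-- Tails are small uniformly on `D`, and `D` has finite measure, so they are small in `L²`. -/
lemma hasSum_Lp_of_forall_hasSum {ι : Type*} {h : ι → ℂ × ℂ → ℂ} {F : ℂ × ℂ → ℂ} {b : ι → ℝ}
    {f : ι → Lp ℂ 2 ((volume : Measure (ℂ × ℂ)).restrict D)}
    {S : Lp ℂ 2 ((volume : Measure (ℂ × ℂ)).restrict D)}
    (hf : ∀ k, f k =ᵐ[(volume : Measure (ℂ × ℂ)).restrict D] h k)
    (hS : S =ᵐ[(volume : Measure (ℂ × ℂ)).restrict D] F)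
    (hb : Summable b) (hb0 : ∀ k, 0 ≤ b k) (hhb : ∀ k, ∀ z ∈ D, ‖h k z‖ ≤ b k)
    (hsum : ∀ z ∈ D, HasSum (fun k => h k z) (F z)) : HasSum f S := by
  have htail := tendsto_tsum_compl_atTop_zero b
  have h1 : ∀ s : Finset ι, ‖(∑ k ∈ s, f k) - S‖ ≤
      measureUnivNNReal ((volume : Measure (ℂ × ℂ)).restrict D) ^ (2⁻¹ : ℝ) *
        ∑' k : { k // k ∉ s }, b k := by
    intro s
    have h0 : 0 ≤ ∑' k : { k // k ∉ s }, b k := tsum_nonneg fun k => hb0 k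
    refine norm_le_of_forall_norm_le (F := fun z => (∑ k ∈ s, h k z) - F z) h0 ?_ fun z hz => ?_
    · refine (Lp.coeFn_sub _ _).trans (EventuallyEq.sub ?_ hS)
      refine (Lp.coeFn_finsetSum s f).trans ?_
      have := (eventually_countable_ball (s.countable_toSet)).2 fun k _ => hf k
      filter_upwards [this] with z hz
      rw [Finset.sum_apply]
      exact Finset.sum_congr rfl fun k hk => hz k hk
    · have h2 := (hsum z hz).summable.sum_add_tsum_subtype_compl s
      rw [← (hsum z hz).tsum_eq, ← h2, sub_add_cancel_left, norm_neg]
      exact tsum_of_norm_bounded (hb.subtype _).hasSum fun k => hhb k z hz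
  refine tendsto_iff_norm_sub_tendsto_zero.2 (squeeze_zero (fun _ => norm_nonneg _) h1 ?_)
  simpa using htail.const_mul _

end BoundedFunctions

/-- Differentiation under the integral; the bound on `l` makes the derivative integrable uniformly
for `s` near `s₀`. -/
lemma differentiable_inner_exp {X : Type*} [MeasurableSpace X] {μ : Measure X}
    [IsFiniteMeasure μ] {Y : ℂ → Lp ℂ 2 μ} {p l : X → ℂ} {M B : ℝ} (hB : 0 ≤ B)
    (hp : AEStronglyMeasurable p μ) (hl : AEStronglyMeasurable l μ)
    (hpM : ∀ᵐ z ∂μ, ‖p z‖ ≤ M) (hlB : ∀ᵐ z ∂μ, ‖l z‖ ≤ B)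
    (hY : ∀ s, Y s =ᵐ[μ] fun z => p z * Complex.exp (s * l z)) (φ : Lp ℂ 2 μ) :
    Differentiable ℂ fun s => inner ℂ φ (Y s) := by
  set g : X → ℂ := fun z => p z * star (φ z) with hg
  have hφ : Integrable (fun z => star (φ z)) μ := by
    have h1 := (Lp.memLp φ).integrable one_le_two
    exact (h1.norm.congr' ((Lp.aestronglyMeasurable φ).star) (by simp) : _)
  have hgi : Integrable g μ := hφ.bdd_mul (c := M) hp hpM
  have heq : (fun s => inner ℂ φ (Y s)) = fun s => ∫ z, Complex.exp (s * l z) * g z ∂μ := by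
    ext s
    rw [L2.inner_def]
    refine integral_congr_ae ((hY s).mono fun z hz => ?_)
    simp only [hz, hg, RCLike.inner_apply, starRingEnd_apply]
    ring
  rw [heq]
  have hem : ∀ s : ℂ, AEStronglyMeasurable (fun z => Complex.exp (s * l z)) μ := fun s =>
    Complex.continuous_exp.comp_aestronglyMeasurable (hl.const_mul s)
  have hexp : ∀ {s w : ℂ} {R : ℝ}, ‖s‖ ≤ R → 0 ≤ R → ‖w‖ ≤ B →
      ‖Complex.exp (s * w)‖ ≤ Real.exp (R * B) := by
    intro s w R hs hR hw
    rw [Complex.norm_exp]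
    gcongr
    refine (Complex.re_le_norm _).trans ?_
    rw [norm_mul]
    gcongr
  intro s₀
  have h := hasDerivAt_integral_of_dominated_loc_of_deriv_le (μ := μ)
    (F := fun s z => Complex.exp (s * l z) * g z)
    (F' := fun s z => l z * Complex.exp (s * l z) * g z) (x₀ := s₀)
    (s := Metric.ball s₀ 1) (bound := fun z => B * Real.exp ((‖s₀‖ + 1) * B) * ‖g z‖)
    (Metric.ball_mem_nhds s₀ one_pos)
    (Eventually.of_forall fun s => (hem s).mul hgi.aestronglyMeasurable)
    (hgi.bdd_mul (c := Real.exp (‖s₀‖ * B)) (hem s₀)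
      (hlB.mono fun z hz => hexp le_rfl (norm_nonneg _) hz))
    ((hl.mul (hem s₀)).mul hgi.aestronglyMeasurable) ?_ (hgi.norm.const_mul _) ?_
  · exact h.2.differentiableAt
  · filter_upwards [hlB] with z hz s hs
    rw [norm_mul, norm_mul]
    have h1 : ‖s‖ ≤ ‖s₀‖ + 1 := by
      have := norm_sub_norm_le s s₀
      rw [mem_ball_iff_norm] at hs
      linarith
    gcongr
    exact hexp h1 (by positivity) hz
  · refine Eventually.of_forall fun z s _ => ?_
    have h1 : HasDerivAt (fun s => Complex.exp (s * l z)) (Complex.exp (s * l z) * l z) s := by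
      simpa using ((hasDerivAt_id s).mul_const (l z)).cexp
    rw [mul_comm (l z)]
    exact h1.mul_const _

/-- A finite open cover has a subordinate measurable partition of unity. -/
lemma exists_measurable_partition {X ι : Type*} [MeasurableSpace X] [Fintype ι] {O : ι → Set X}
    (hO : ∀ j, MeasurableSet (O j)) : ∃ χ : ι → X → ℂ, (∀ j, Measurable (χ j)) ∧
      (∀ j z, ‖χ j z‖ ≤ 1) ∧ (∀ j, ∀ z ∉ O j, χ j z = 0) ∧
      ∀ z, (∃ j, z ∈ O j) → ∑ j, χ j z = 1 := by
  classical
  set e : ι → X → ℝ := fun j => (O j).indicator 1 with he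
  have he0 : ∀ j z, 0 ≤ e j z := fun j z => indicator_nonneg (fun _ _ => zero_le_one) z
  have hem : ∀ j, Measurable (e j) := fun j => measurable_one.indicator (hO j)
  refine ⟨fun j z => ((e j z / ∑ i, e i z : ℝ) : ℂ), fun j => ?_, fun j z => ?_,
    fun j z hz => ?_, fun z hz => ?_⟩
  · exact Complex.measurable_ofReal.comp
      ((hem j).div (Finset.measurable_fun_sum _ fun i _ => hem i))
  · rw [Complex.norm_real, Real.norm_of_nonneg
      (div_nonneg (he0 j z) (Finset.sum_nonneg fun i _ => he0 i z))]
    exact div_le_one_of_le₀ (Finset.single_le_sum (fun i _ => he0 i z) (Finset.mem_univ j))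
      (Finset.sum_nonneg fun i _ => he0 i z)
  · simp [he, hz]
  · obtain ⟨j, hj⟩ := hz
    have h1 : 0 < ∑ i, e i z := by
      refine lt_of_lt_of_le ?_ (Finset.single_le_sum (fun i _ => he0 i z) (Finset.mem_univ j))
      simp [he, hj]
    rw [← Complex.ofReal_sum, ← Finset.sum_div, div_self h1.ne', Complex.ofReal_one]

/-- A system of holomorphic maps `G i` of a bounded open set `D` into a compact subset `K` of `D`,
with bounded holomorphic functions `Λ i`. -/
structure IsContractingSystem {m : ℕ} (D : TopologicalSpace.Opens (ℂ × ℂ))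
    (G : Fin m → ℂ × ℂ → ℂ × ℂ) (Λ : Fin m → ℂ × ℂ → ℂ) (K : Set (ℂ × ℂ)) (B : ℝ) : Prop where
  isBounded : Bornology.IsBounded (D : Set (ℂ × ℂ))
  differentiableOn_map : ∀ i, DifferentiableOn ℂ (G i) D
  differentiableOn_log : ∀ i, DifferentiableOn ℂ (Λ i) D
  norm_log_le : ∀ i, ∀ z ∈ D, ‖Λ i z‖ ≤ B
  isCompact : IsCompact K
  subset : K ⊆ D
  mapsTo : ∀ i, ∀ z ∈ D, G i z ∈ K

namespace IsContractingSystem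

variable {m : ℕ} {D : TopologicalSpace.Opens (ℂ × ℂ)} {G : Fin m → ℂ × ℂ → ℂ × ℂ}
  {Λ : Fin m → ℂ × ℂ → ℂ} {K : Set (ℂ × ℂ)} {B : ℝ}

lemma isFiniteMeasure (h : IsContractingSystem D G Λ K B) :
    IsFiniteMeasure ((volume : Measure (ℂ × ℂ)).restrict D) :=
  ⟨by rw [Measure.restrict_apply_univ]; exact h.isBounded.measure_lt_top⟩

lemma norm_exp_le (h : IsContractingSystem D G Λ K B) (s : ℂ) (i : Fin m) {z : ℂ × ℂ}
    (hz : z ∈ D) : ‖Complex.exp (s * Λ i z)‖ ≤ Real.exp (B * ‖s‖) := by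
  rw [Complex.norm_exp, mul_comm B]
  gcongr
  refine (Complex.re_le_norm _).trans ?_
  rw [norm_mul]
  gcongr
  exact h.norm_log_le i z hz

lemma differentiableOn_transfer (h : IsContractingSystem D G Λ K B) (s : ℂ) (u : bergmanSpace D) :
    DifferentiableOn ℂ (fun z => ∑ i, Complex.exp (s * Λ i z) * holRep u (G i z)) D := by
  refine DifferentiableOn.fun_sum fun i _ => ?_
  refine ((h.differentiableOn_log i).const_mul s).cexp.mul ?_
  exact (holRep_differentiableOn u).comp (h.differentiableOn_map i)
    fun z hz => h.subset (h.mapsTo i z hz)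

lemma exists_closedBall_subset (h : IsContractingSystem D G Λ K B) :
    ∃ r > 0, ∀ w ∈ K, Metric.closedBall w (3 * r) ⊆ D := by
  obtain ⟨δ, hδ, hsub⟩ := h.isCompact.exists_cthickening_subset_open D.isOpen h.subset
  refine ⟨δ / 3, by positivity, fun w hw => ?_⟩
  rw [mul_div_cancel₀ _ three_ne_zero]
  exact (Metric.closedBall_subset_cthickening hw δ).trans hsub

lemma exists_transferOperator (h : IsContractingSystem D G Λ K B) (s : ℂ) :
    ∃ T : bergmanSpace D →L[ℂ] bergmanSpace D, ∀ u,
      (T u : Lp ℂ 2 ((volume : Measure (ℂ × ℂ)).restrict D))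
        =ᵐ[(volume : Measure (ℂ × ℂ)).restrict D]
          fun z => ∑ i, Complex.exp (s * Λ i z) * holRep u (G i z) := by
  have := h.isFiniteMeasure
  obtain ⟨r, hr, hball⟩ := h.exists_closedBall_subset
  obtain ⟨C, hC, hCb⟩ := exists_norm_holRep_le (D := D) (r := 3 * r) (by positivity)
  set F : bergmanSpace D → ℂ × ℂ → ℂ := fun u z =>
    ∑ i, Complex.exp (s * Λ i z) * holRep u (G i z) with hF
  have hFb : ∀ u, ∀ z ∈ D, ‖F u z‖ ≤ m * Real.exp (B * ‖s‖) * C * ‖u‖ := by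
    intro u z hz
    have : ∀ i : Fin m, ‖Complex.exp (s * Λ i z) * holRep u (G i z)‖ ≤
        Real.exp (B * ‖s‖) * (C * ‖u‖) := by
      intro i
      rw [norm_mul]
      gcongr
      · exact h.norm_exp_le s i hz
      · exact hCb _ (hball _ (h.mapsTo i z hz)) u
    refine (norm_sum_le_of_le _ fun i _ => this i).trans (le_of_eq ?_)
    simp; ring
  have hFd : ∀ u, DifferentiableOn ℂ (F u) D := h.differentiableOn_transfer s
  have hFm : ∀ u, MemLp (F u) 2 ((volume : Measure (ℂ × ℂ)).restrict D) := fun u =>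
    memLp_of_forall_norm_le ((hFd u).continuousOn.aestronglyMeasurable D.isOpen.measurableSet)
      (hFb u)
  have hmemD : ∀ᵐ z ∂((volume : Measure (ℂ × ℂ)).restrict D), z ∈ D :=
    ae_restrict_mem D.isOpen.measurableSet
  let T : bergmanSpace D →ₗ[ℂ] bergmanSpace D :=
    { toFun := fun u => ⟨(hFm u).toLp (F u), F u, hFd u, (hFm u).coeFn_toLp⟩
      map_add' := fun u v => by
        refine Subtype.ext ?_
        change (hFm (u + v)).toLp _ = (hFm u).toLp _ + (hFm v).toLp _
        rw [← MemLp.toLp_add]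
        refine MemLp.toLp_congr _ _ (hmemD.mono fun z hz => ?_)
        simp only [hF, Pi.add_apply, ← Finset.sum_add_distrib]
        refine Finset.sum_congr rfl fun i _ => ?_
        rw [holRep_add u v (h.subset (h.mapsTo i z hz)), Pi.add_apply, mul_add]
      map_smul' := fun c u => by
        refine Subtype.ext ?_
        change (hFm (c • u)).toLp _ = c • (hFm u).toLp _
        rw [← MemLp.toLp_const_smul]
        refine MemLp.toLp_congr _ _ (hmemD.mono fun z hz => ?_)
        simp only [hF, Pi.smul_apply, smul_eq_mul, Finset.mul_sum]
        refine Finset.sum_congr rfl fun i _ => ?_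
        rw [holRep_smul c u (h.subset (h.mapsTo i z hz)), Pi.smul_apply, smul_eq_mul,
          mul_left_comm] }
  refine ⟨T.mkContinuous (measureUnivNNReal ((volume : Measure (ℂ × ℂ)).restrict D) ^ (2⁻¹ : ℝ) *
    (m * Real.exp (B * ‖s‖) * C)) fun u => ?_, fun u => (hFm u).coeFn_toLp⟩
  rw [mul_assoc]
  exact norm_le_of_forall_norm_le (by positivity) (hFm u).coeFn_toLp (hFb u)

end IsContractingSystem

/-- The index set of a `GeometricFamily` may be taken to be nonempty. -/
lemma GeometricFamily.option {H : Type*} [NormedAddCommGroup H] [InnerProductSpace ℂ H]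
    {τ : Type*} {L : ℂ → H →L[ℂ] H} {x : τ × ℕ × ℕ → H} {y : ℂ → τ × ℕ × ℕ → H} {c K : ℝ}
    (h : GeometricFamily L x y c K) :
    GeometricFamily (τ := Option τ) L (fun k => k.1.elim 0 fun t => x (t, k.2))
      (fun s k => k.1.elim 0 fun t => y s (t, k.2)) c K where
  rate_pos := h.rate_pos
  const_pos := h.const_pos
  norm_left := by
    have := h.const_pos
    rintro ⟨_ | t, n⟩
    · simp only [Option.elim_none, norm_zero]; positivity
    · exact h.norm_left (t, n)
  norm_right := by
    have := h.const_pos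
    rintro s ⟨_ | t, n⟩
    · simp only [Option.elim_none, norm_zero]; positivity
    · exact h.norm_right s (t, n)
  differentiable := by
    rintro ⟨_ | t, n⟩ ⟨_ | t', n'⟩
    · simp
    · simp
    · simp
    · exact h.differentiable (t, n) (t', n')
  hasSum := by
    intro s u
    have hinj : Function.Injective fun k : τ × ℕ × ℕ => ((some k.1, k.2) : Option τ × ℕ × ℕ) := by
      rintro ⟨a, b⟩ ⟨a', b'⟩ hab
      simpa using hab
    refine (hinj.hasSum_iff ?_).1 (h.hasSum s u)
    rintro ⟨_ | t, n⟩ hk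
    · simp
    · exact (hk ⟨(t, n), rfl⟩).elim

/-! ### Geometric expansion of the transfer operators -/

section

variable {E : Type*} [NormedAddCommGroup E] [InnerProductSpace ℂ E]

lemma inner_smul_orthogonalProjectionOnto (K : Submodule ℂ E) [K.HasOrthogonalProjection]
    (c : ℂ) (x : K) (v : E) :
    inner ℂ x (c • K.orthogonalProjectionOnto v) = c * inner ℂ (x : E) v := by
  rw [inner_smul_right, Submodule.inner_orthogonalProjectionOnto_eq_of_mem_left]

/-- The projection is continuous and fixes `v`, so it may be applied term by term. The real scalars
`c k` only shift weight from one factor of each term to the other. -/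
lemma hasSum_inner_smul_orthogonalProjectionOnto {ι : Type*} (K : Submodule ℂ E)
    [K.HasOrthogonalProjection] {x : ι → K} {Q : ι → E} {u v : K} {a : ι → ℝ} {c : ι → ℂ}
    (ha : ∀ k, a k ≠ 0) (hc : ∀ k, c k = a k)
    (h : HasSum (fun k => inner ℂ (x k) u • Q k) (v : E)) :
    HasSum (fun k => inner ℂ (c k • x k) u • (c k)⁻¹ • K.orthogonalProjectionOnto (Q k)) v := by
  have h1 := h.mapL K.orthogonalProjectionOnto
  rw [Submodule.orthogonalProjectionOnto_mem_subspace_eq_self] at h1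
  refine h1.congr_fun fun k => ?_
  rw [map_smul, inner_smul_left, hc, Complex.conj_ofReal, smul_smul, mul_right_comm,
    mul_inv_cancel₀ (Complex.ofReal_ne_zero.2 (ha k)), one_mul]

end

namespace IsContractingSystem

variable {m : ℕ} {D : TopologicalSpace.Opens (ℂ × ℂ)} {G : Fin m → ℂ × ℂ → ℂ × ℂ}
  {Λ : Fin m → ℂ × ℂ → ℂ} {K : Set (ℂ × ℂ)} {B : ℝ}

lemma exists_partition (h : IsContractingSystem D G Λ K B) {r : ℝ} (hr : 0 < r) :
    ∃ (t : Finset (ℂ × ℂ)) (χ : Fin m → t → ℂ × ℂ → ℂ), (∀ w ∈ t, w ∈ K) ∧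
      (∀ i j, Measurable (χ i j)) ∧ (∀ i j z, ‖χ i j z‖ ≤ 1) ∧
      (∀ i, ∀ j : t, ∀ z ∈ D, χ i j z ≠ 0 → ‖G i z - j‖ < r) ∧
      ∀ i, ∀ z ∈ D, ∑ j, χ i j z = 1 := by
  obtain ⟨t', htK, htf, hcov⟩ := h.isCompact.finite_cover_balls hr
  lift t' to Finset (ℂ × ℂ) using htf with t
  have hO : ∀ i, ∀ j : t, MeasurableSet ((D : Set (ℂ × ℂ)) ∩ G i ⁻¹' Metric.ball (j : ℂ × ℂ) r) :=
    fun i j => ((h.differentiableOn_map i).continuousOn.isOpen_inter_preimage D.isOpen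
      Metric.isOpen_ball).measurableSet
  choose χ hχm hχ1 hχ0 hχs using fun i => exists_measurable_partition (hO i)
  refine ⟨t, χ, fun w hw => htK hw, hχm, hχ1, fun i j z hz hne => ?_, fun i z hz => hχs i z ?_⟩
  · by_contra hlt
    exact hne (hχ0 i j z fun hmem => hlt (mem_ball_iff_norm.1 hmem.2))
  · obtain ⟨j, hj, hzj⟩ := mem_iUnion₂.1 (hcov (h.mapsTo i z hz))
    exact ⟨⟨j, hj⟩, hz, hzj⟩

/-- Where `χ i j ≠ 0`, the point `G i z` is within `r` of the centre `j`, while `u` is expanded with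
radius `2 * r`; the terms are thus dominated by `2^(-a-b)`. The functions `q s k` are only
measurable because of the cut-offs, so they are projected back to the Bergman space. This leaves the
sum unchanged, as `L s u` already lies there. -/
lemma exists_geometricFamily (h : IsContractingSystem D G Λ K B) (hB : 0 ≤ B)
    {L : ℂ → bergmanSpace D →L[ℂ] bergmanSpace D}
    (hL : ∀ s u, (L s u : Lp ℂ 2 ((volume : Measure (ℂ × ℂ)).restrict D))
        =ᵐ[(volume : Measure (ℂ × ℂ)).restrict D]
          fun z => ∑ i, Complex.exp (s * Λ i z) * holRep u (G i z)) :
    ∃ (τ : Type) (_ : Finite τ) (x : τ × ℕ × ℕ → bergmanSpace D)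
      (y : ℂ → τ × ℕ × ℕ → bergmanSpace D) (c C : ℝ), GeometricFamily L x y c C := by
  have := h.isFiniteMeasure
  set μ := (volume : Measure (ℂ × ℂ)).restrict D with hμ
  obtain ⟨r, hr, hball⟩ := h.exists_closedBall_subset
  obtain ⟨t, χ, htK, hχm, hχ1, hχ0, hχs⟩ := h.exists_partition hr
  obtain ⟨C, hC, hriesz⟩ := exists_riesz_taylorCoeff₂ (D := D) hr
  choose ξ hξn hξ using fun w : t => hriesz w (hball w (htK w w.2))
  have hmemD : ∀ᵐ z ∂μ, z ∈ D := ae_restrict_mem D.isOpen.measurableSet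
  -- the functions that carry the Taylor expansion
  set p : (Fin m × t) × ℕ × ℕ → ℂ × ℂ → ℂ := fun k z => χ k.1.1 k.1.2 z *
    (((G k.1.1 z).1 - (k.1.2 : ℂ × ℂ).1) ^ k.2.1 *
      ((G k.1.1 z).2 - (k.1.2 : ℂ × ℂ).2) ^ k.2.2) with hp
  have hpb : ∀ k, ∀ z ∈ D, ‖p k z‖ ≤ r ^ (k.2.1 + k.2.2) := by
    intro k z hz
    by_cases h0 : χ k.1.1 k.1.2 z = 0
    · simp only [hp, h0, zero_mul, norm_zero]; positivity
    have h1 := hχ0 _ _ z hz h0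
    simp only [hp, norm_mul, norm_pow]
    rw [pow_add, ← one_mul (r ^ k.2.1 * r ^ k.2.2)]
    gcongr
    · exact hχ1 _ _ _
    · exact (norm_fst_le _).trans h1.le
    · exact (norm_snd_le _).trans h1.le
  have hGm : ∀ i, AEStronglyMeasurable (G i) μ := fun i =>
    (h.differentiableOn_map i).continuousOn.aestronglyMeasurable D.isOpen.measurableSet
  have hΛm : ∀ i, AEStronglyMeasurable (Λ i) μ := fun i =>
    (h.differentiableOn_log i).continuousOn.aestronglyMeasurable D.isOpen.measurableSet
  have hpm : ∀ k, AEStronglyMeasurable (p k) μ := by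
    intro k
    refine (hχm _ _).aestronglyMeasurable.mul (AEStronglyMeasurable.mul ?_ ?_)
    · exact (((continuous_fst.comp_aestronglyMeasurable (hGm _)).sub
        aestronglyMeasurable_const).pow _)
    · exact (((continuous_snd.comp_aestronglyMeasurable (hGm _)).sub
        aestronglyMeasurable_const).pow _)
  set q : ℂ → (Fin m × t) × ℕ × ℕ → ℂ × ℂ → ℂ := fun s k z =>
    p k z * Complex.exp (s * Λ k.1.1 z) with hq
  have hqb : ∀ s k, ∀ z ∈ D, ‖q s k z‖ ≤ Real.exp (B * ‖s‖) * r ^ (k.2.1 + k.2.2) := by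
    intro s k z hz
    rw [hq, norm_mul, mul_comm]
    gcongr
    · exact h.norm_exp_le s _ hz
    · exact hpb k z hz
  have hqm : ∀ s k, MemLp (q s k) 2 μ := fun s k => memLp_of_forall_norm_le
    ((hpm k).mul (Complex.continuous_exp.comp_aestronglyMeasurable ((hΛm _).const_mul s)))
    (hqb s k)
  set Q : ℂ → (Fin m × t) × ℕ × ℕ → Lp ℂ 2 μ := fun s k => (hqm s k).toLp (q s k) with hQ
  set A : ℝ := measureUnivNNReal μ ^ (2⁻¹ : ℝ) with hA
  have hA0 : 0 ≤ A := by positivity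
  have hQn : ∀ s k, ‖Q s k‖ ≤ A * (Real.exp (B * ‖s‖) * r ^ (k.2.1 + k.2.2)) := fun s k =>
    norm_le_of_forall_norm_le (by positivity) (hqm s k).coeFn_toLp (hqb s k)
  -- the Taylor expansion of the transfer operator
  have hsum : ∀ s u, HasSum (fun k => inner ℂ (ξ k.1.2 k.2.1 k.2.2) u • Q s k)
      (L s u : Lp ℂ 2 μ) := by
    intro s u
    set b : (Fin m × t) × ℕ × ℕ → ℝ := fun k =>
      C * ‖u‖ * Real.exp (B * ‖s‖) * (1 / 2 : ℝ) ^ (k.2.1 + k.2.2) with hb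
    have hbs : Summable b := ((summable_pow_add_pow (τ := Fin m × t) (r := 1 / 2)
      (by norm_num) (by norm_num)).summable.mul_left _)
    have hle : ∀ k, ∀ z ∈ D, ‖inner ℂ (ξ k.1.2 k.2.1 k.2.2) u * q s k z‖ ≤ b k := by
      intro k z hz
      rw [norm_mul]
      calc _ ≤ C * (2 * r)⁻¹ ^ (k.2.1 + k.2.2) * ‖u‖ *
            (Real.exp (B * ‖s‖) * r ^ (k.2.1 + k.2.2)) := by
            gcongr
            · exact (norm_inner_le_norm _ _).trans (mul_le_mul_of_nonneg_right (hξn _ _ _) (norm_nonneg _))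
            · exact hqb s k z hz
        _ = C * ‖u‖ * Real.exp (B * ‖s‖) * ((2 * r)⁻¹ * r) ^ (k.2.1 + k.2.2) := by
            rw [mul_pow]; ring
        _ = b k := by
            rw [hb]; congr 2; field_simp
    refine hasSum_Lp_of_forall_hasSum
      (h := fun k z => inner ℂ (ξ k.1.2 k.2.1 k.2.2) u * q s k z) (b := b) (fun k => ?_) (hL s u)
      hbs (fun k => by simp only [hb]; positivity) hle fun z hz => ?_
    · exact (Lp.coeFn_smul _ _).trans ((hqm s k).coeFn_toLp.const_smul _)
    · have hs1 : Summable fun k => inner ℂ (ξ k.1.2 k.2.1 k.2.2) u * q s k z :=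
        Summable.of_norm_bounded hbs fun k => hle k z hz
      have hfib : ∀ ij : Fin m × t, HasSum (fun n : ℕ × ℕ =>
          inner ℂ (ξ ij.2 n.1 n.2) u * q s (ij, n) z)
          (χ ij.1 ij.2 z * Complex.exp (s * Λ ij.1 z) * holRep u (G ij.1 z)) := by
        rintro ⟨i, j⟩
        by_cases h0 : χ i j z = 0
        · simp only [hq, hp, h0, zero_mul, mul_zero]
          exact hasSum_zero
        have h1 := hχ0 _ _ z hz h0
        have h2 := (hasSum_taylorCoeff₂ (u := holRep u) (w := j) (R := 2 * r) (z := G i z)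
          (fun v hv => (holRep_differentiableOn u).differentiableAt (D.isOpen.mem_nhds
            (hball j (htK j j.2) (Metric.closedBall_subset_closedBall (by linarith) hv))))
          (by linarith)).mul_left (χ i j z * Complex.exp (s * Λ i z))
        refine h2.congr_fun fun n => ?_
        simp only [hq, hp, hξ]
        ring
      have h3 := hs1.hasSum.prod_fiberwise hfib
      have h4 : ∑ ij : Fin m × t, χ ij.1 ij.2 z * Complex.exp (s * Λ ij.1 z) *
          holRep u (G ij.1 z) = ∑ i, Complex.exp (s * Λ i z) * holRep u (G i z) := by
        rw [Fintype.sum_prod_type]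
        refine Finset.sum_congr rfl fun i _ => ?_
        simp only [mul_assoc]
        rw [← Finset.sum_mul, hχs i z hz, one_mul]
      rw [← h4, ← h3.unique (hasSum_fintype _)]
      exact hs1.hasSum
  -- `σ` is the geometric mean of `r` and `2 * r`: it splits the decay `2^(-a-b)` evenly between the
  -- two factors of each term.
  obtain ⟨σ, hσ⟩ : ∃ σ : ℝ, σ = √2 * r := ⟨_, rfl⟩
  have h2 : (0 : ℝ) < √2 := by positivity
  have hsq : √2 * √2 = 2 := Real.mul_self_sqrt zero_le_two
  have hσ0 : 0 < σ := by rw [hσ]; positivity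
  have hrate : Real.exp (-Real.log √2) = (√2)⁻¹ := by rw [Real.exp_neg, Real.exp_log h2]
  have hσn : ∀ n : ℕ, ((σ : ℂ) ^ n) ≠ 0 := fun n =>
    pow_ne_zero _ (Complex.ofReal_ne_zero.2 hσ0.ne')
  set M : ℝ := C + A + B + 1 with hM
  have hCM : C ≤ M := by linarith
  have hAM : A ≤ M := by linarith
  have hBM : B ≤ M := by linarith
  refine ⟨Fin m × t, inferInstance, fun k => ((σ : ℂ) ^ (k.2.1 + k.2.2)) • ξ k.1.2 k.2.1 k.2.2,
    fun s k => ((σ : ℂ) ^ (k.2.1 + k.2.2))⁻¹ • (bergmanSpace D).orthogonalProjectionOnto (Q s k),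
    Real.log √2, M, ?_⟩
  refine ⟨Real.log_pos ?_, by linarith, fun k => ?_, fun s k => ?_, fun k l => ?_, fun s u => ?_⟩
  · exact Real.lt_sqrt_of_sq_lt (by norm_num)
  · rw [hrate, norm_smul, norm_pow, Complex.norm_real, Real.norm_of_nonneg hσ0.le]
    calc _ ≤ σ ^ (k.2.1 + k.2.2) * (C * (2 * r)⁻¹ ^ (k.2.1 + k.2.2)) := by
          gcongr; exact hξn _ _ _
      _ = C * (σ * (2 * r)⁻¹) ^ (k.2.1 + k.2.2) := by rw [mul_pow]; ring
      _ ≤ M * (σ * (2 * r)⁻¹) ^ (k.2.1 + k.2.2) := by gcongr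
      _ = _ := by
          congr 2
          rw [hσ]
          field_simp
          rw [pow_two, hsq]
  · rw [hrate, norm_smul, norm_inv, norm_pow, Complex.norm_real, Real.norm_of_nonneg hσ0.le]
    calc _ ≤ (σ ^ (k.2.1 + k.2.2))⁻¹ * (A * (Real.exp (B * ‖s‖) * r ^ (k.2.1 + k.2.2))) := by
          gcongr
          exact (Submodule.norm_orthogonalProjectionOnto_apply_le _ _).trans (hQn s k)
      _ = A * Real.exp (B * ‖s‖) * (σ⁻¹ * r) ^ (k.2.1 + k.2.2) := by
          rw [mul_pow, inv_pow]; ring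
      _ ≤ M * Real.exp (M * ‖s‖) * (σ⁻¹ * r) ^ (k.2.1 + k.2.2) := by gcongr
      _ = _ := by
          congr 2
          rw [hσ]
          field_simp
  · have h5 := (differentiable_inner_exp hB (hpm l) (hΛm l.1.1) (hmemD.mono (hpb l))
      (hmemD.mono (h.norm_log_le _)) (fun s => (hqm s l).coeFn_toLp)
      ((((σ : ℂ) ^ (k.2.1 + k.2.2)) • ξ k.1.2 k.2.1 k.2.2 : bergmanSpace D) : Lp ℂ 2 μ)).const_mul
      ((σ : ℂ) ^ (l.2.1 + l.2.2))⁻¹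
    refine (congrArg (Differentiable ℂ) (funext fun s => ?_)).mp h5
    exact (inner_smul_orthogonalProjectionOnto _ _ _ _).symm
  · exact hasSum_inner_smul_orthogonalProjectionOnto (bergmanSpace D)
      (fun k => pow_ne_zero _ hσ0.ne') (fun k => by push_cast; rfl) (hsum s u)

/-- The transfer operators of a contracting system and their determinant. -/
theorem exists_transferOperator_det (h : IsContractingSystem D G Λ K B) (hB : 0 ≤ B) :
    ∃ L : ℂ → (bergmanSpace D →L[ℂ] bergmanSpace D),
      (∀ s, IsTransferOperator D G Λ s (L s)) ∧
      (∀ s, IsTraceClass (L s)) ∧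
      (∀ s, DetConverges (-(L s))) ∧
      (∃ C : ℝ, 0 < C ∧
        ∀ s : ℂ, ‖detOneAdd (-(L s))‖ ≤ C * Real.exp (C * ‖s‖ ^ 3)) ∧
      Differentiable ℂ (fun s : ℂ => detOneAdd (-(L s))) ∧
      entireOrder (fun s : ℂ => detOneAdd (-(L s))) ≤ 3 := by
  choose L hL using h.exists_transferOperator
  obtain ⟨τ, hτ, x, y, c, C, hfam⟩ := h.exists_geometricFamily hB hL
  -- The passage to `Option τ` makes the index set infinite, so that `det_neg` can enumerate it by
  -- `ℕ` without knowing that the cover is nonempty.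
  exact ⟨L, fun s u => holRep_eqOn (h.differentiableOn_transfer s u) (hL s u),
    hfam.option.det_neg⟩

end IsContractingSystem

/-- `K` is the union of the images of the compact closure of `D`. No metric contraction enters: that
the closure of `D` is mapped into `D` is enough. -/
lemma IsAdmissible.exists_isContractingSystem {f : RatFunc ℂ} {V : Set ℂ}
    {g : Fin (ratDegree f) → ℂ → ℂ} {Ω : Set (ℂ × ℂ)}
    {G : Fin (ratDegree f) → ℂ × ℂ → ℂ × ℂ} {Λ : Fin (ratDegree f) → ℂ × ℂ → ℂ}
    {D : Fin (ratDegree f) → TopologicalSpace.Opens (ℂ × ℂ)}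
    (hE : IsHolomorphicExtension f V g Ω G Λ) (hA : IsAdmissible f g Ω G D) :
    ∃ K B, 0 ≤ B ∧ IsContractingSystem (⨆ i, D i) G Λ K B := by
  set U : TopologicalSpace.Opens (ℂ × ℂ) := ⨆ i, D i with hU
  have hcpt : IsCompact (closure (U : Set (ℂ × ℂ))) := hA.isBounded.isCompact_closure
  have hsub : (U : Set (ℂ × ℂ)) ⊆ Ω := subset_closure.trans hA.closure_subset
  choose b hb using fun i => hcpt.exists_bound_of_continuousOn
    ((hE.differentiableOn_log i).continuousOn.mono hA.closure_subset)
  refine ⟨⋃ i, G i '' closure (U : Set (ℂ × ℂ)), ∑ i, |b i|,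
    Finset.sum_nonneg fun i _ => abs_nonneg _, hA.isBounded,
    fun i => (hE.differentiableOn_map i).mono hsub, fun i => (hE.differentiableOn_log i).mono hsub,
    fun i z hz => ?_, ?_, ?_, fun i z hz => ?_⟩
  · exact (hb i z (subset_closure hz)).trans ((le_abs_self _).trans
      (Finset.single_le_sum (f := fun i => |b i|) (fun i _ => abs_nonneg _) (Finset.mem_univ i)))
  · exact isCompact_iUnion fun i => hcpt.image_of_continuousOn
      ((hE.differentiableOn_map i).continuousOn.mono hA.closure_subset)
  · refine iUnion_subset fun i => ?_
    rintro _ ⟨z, hz, rfl⟩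
    exact (le_iSup D i : D i ≤ U) (hA.mapsTo i hz)
  · exact mem_iUnion.2 ⟨i, mem_image_of_mem _ (subset_closure hz)⟩

/-! ### Rational maps are continuous and open on the sphere -/

/-- The inversion `z ↦ 1 / z` of the sphere. -/
def sphereInv : OnePoint ℂ → OnePoint ℂ
  | OnePoint.infty => ((0 : ℂ) : OnePoint ℂ)
  | OnePoint.some z => if z = 0 then OnePoint.infty else ((z⁻¹ : ℂ) : OnePoint ℂ)

lemma sphereInv_coe_of_ne {z : ℂ} (hz : z ≠ 0) : sphereInv z = ((z⁻¹ : ℂ) : OnePoint ℂ) :=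
  if_neg hz

lemma sphereInv_zero : sphereInv ((0 : ℂ) : OnePoint ℂ) = OnePoint.infty := if_pos rfl

lemma sphereInv_infty : sphereInv OnePoint.infty = ((0 : ℂ) : OnePoint ℂ) := rfl

lemma sphereInv_involutive : Function.Involutive sphereInv := by
  intro p
  induction p using OnePoint.rec with
  | infty => rw [sphereInv_infty, sphereInv_zero]
  | coe z =>
    by_cases hz : z = 0
    · rw [hz, sphereInv_zero, sphereInv_infty]
    · rw [sphereInv_coe_of_ne hz, sphereInv_coe_of_ne (inv_ne_zero hz), inv_inv]

lemma continuous_sphereInv : Continuous sphereInv := by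
  rw [OnePoint.continuous_iff]
  constructor
  · rw [sphereInv_infty]
    rw [Filter.coclosedCompact_eq_cocompact, ← Metric.cobounded_eq_cocompact]
    have h1 : Tendsto (fun z : ℂ => ((z⁻¹ : ℂ) : OnePoint ℂ)) (Bornology.cobounded ℂ)
        (𝓝 ((0 : ℂ) : OnePoint ℂ)) :=
      (OnePoint.continuous_coe.tendsto 0).comp tendsto_inv₀_cobounded
    refine h1.congr' ?_
    filter_upwards [Bornology.isBounded_singleton (x := (0 : ℂ))] with z hz
    exact (sphereInv_coe_of_ne hz).symm
  · rw [continuous_iff_continuousAt]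
    intro z
    by_cases hz : z = 0
    · subst hz
      rw [continuousAt_iff_punctured_nhds]
      rw [sphereInv_zero]
      have h1 : Tendsto (fun z : ℂ => ((z⁻¹ : ℂ) : OnePoint ℂ)) (𝓝[≠] 0)
          (𝓝 (OnePoint.infty : OnePoint ℂ)) := by
        refine Tendsto.comp ?_ (tendsto_inv₀_nhdsNE_zero (α := ℂ))
        rw [Metric.cobounded_eq_cocompact, ← Filter.coclosedCompact_eq_cocompact]
        exact OnePoint.tendsto_coe_infty
      refine h1.congr' ?_
      filter_upwards [self_mem_nhdsWithin] with z hz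
      exact (sphereInv_coe_of_ne hz).symm
    · have h1 : ContinuousAt (fun z : ℂ => ((z⁻¹ : ℂ) : OnePoint ℂ)) z :=
        OnePoint.continuous_coe.continuousAt.comp (continuousAt_inv₀ hz)
      refine h1.congr ?_
      filter_upwards [isOpen_ne.mem_nhds hz] with w hw
      exact (sphereInv_coe_of_ne hw).symm

lemma map_sphereInv_nhds (p : OnePoint ℂ) : map sphereInv (𝓝 p) = 𝓝 (sphereInv p) :=
  (Homeomorph.mk sphereInv_involutive.toPerm continuous_sphereInv continuous_sphereInv).map_nhds_eq p

open Polynomial in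
/-- The quotient of two polynomials as a map from the plane to the sphere. -/
def polyQuot (A B : ℂ[X]) (z : ℂ) : OnePoint ℂ :=
  if B.eval z = 0 then OnePoint.infty else ((A.eval z / B.eval z : ℂ) : OnePoint ℂ)

section

open Polynomial

variable {A B : ℂ[X]}

/-- The equality of filters expresses continuity and openness at once. By the open mapping theorem
openness fails only if the quotient is locally constant, which would make `A` a multiple of `B`. -/
lemma map_polyQuot_nhds_of_eval_ne_zero {z : ℂ} (hB : B.eval z ≠ 0) (hne : ∀ c, A ≠ C c * B) :
    map (polyQuot A B) (𝓝 z) = 𝓝 (polyQuot A B z) := by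
  have hev : ∀ᶠ w in 𝓝 z, B.eval w ≠ 0 := B.continuous.continuousAt.eventually_ne hB
  have h1 : polyQuot A B =ᶠ[𝓝 z] fun w => ((A.eval w / B.eval w : ℂ) : OnePoint ℂ) :=
    hev.mono fun w hw => if_neg hw
  rw [Filter.map_congr h1, h1.eq_of_nhds]
  have han : AnalyticAt ℂ (fun w => A.eval w / B.eval w) z :=
    by
    refine AnalyticAt.fun_div ?_ ?_ hB
    · exact (A.differentiable.analyticAt z)
    · exact (B.differentiable.analyticAt z)
  have h2 : map (fun w => A.eval w / B.eval w) (𝓝 z) = 𝓝 (A.eval z / B.eval z) := by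
    refine le_antisymm han.continuousAt ?_
    refine han.eventually_constant_or_nhds_le_map_nhds.resolve_left fun hc => ?_
    set c := A.eval z / B.eval z
    refine hne c (Polynomial.eq_of_infinite_eval_eq _ _ ?_)
    refine infinite_of_mem_nhds z ?_
    filter_upwards [hc, hev] with w hw hw'
    rw [div_eq_iff hw'] at hw
    simpa using hw
  rw [← Function.comp_def (fun w : ℂ => (w : OnePoint ℂ)), ← Filter.map_map, h2]
  exact OnePoint.isOpenEmbedding_coe.map_nhds_eq _

lemma polyQuot_eq_sphereInv {z : ℂ} (h : A.eval z ≠ 0 ∨ B.eval z ≠ 0) :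
    polyQuot A B z = sphereInv (polyQuot B A z) := by
  unfold polyQuot
  by_cases hA : A.eval z = 0
  · have hB : B.eval z ≠ 0 := by tauto
    rw [if_neg hB, if_pos hA, hA, zero_div, sphereInv_infty]
  · rw [if_neg hA]
    by_cases hB : B.eval z = 0
    · rw [if_pos hB, hB, zero_div, sphereInv_zero]
    · rw [if_neg hB, sphereInv_coe_of_ne (div_ne_zero hB hA), inv_div]

/-- At a pole the roles of `A` and `B` are exchanged by the inversion of the sphere, a
homeomorphism. -/
lemma map_polyQuot_nhds {z : ℂ} (h : A.eval z ≠ 0 ∨ B.eval z ≠ 0) (hne : ∀ c, A ≠ C c * B)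
    (hne' : ∀ c, B ≠ C c * A) : map (polyQuot A B) (𝓝 z) = 𝓝 (polyQuot A B z) := by
  rcases h with h | h
  · have hev : ∀ᶠ w in 𝓝 z, A.eval w ≠ 0 := A.continuous.continuousAt.eventually_ne h
    have h1 : polyQuot A B =ᶠ[𝓝 z] sphereInv ∘ polyQuot B A :=
      hev.mono fun w hw => polyQuot_eq_sphereInv (Or.inl hw)
    rw [Filter.map_congr h1, h1.eq_of_nhds, ← Filter.map_map,
      map_polyQuot_nhds_of_eval_ne_zero h hne', map_sphereInv_nhds, Function.comp]
  · exact map_polyQuot_nhds_of_eval_ne_zero h hne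

end

section RatMap

open Polynomial

variable {f : RatFunc ℂ}

lemma eval_num_ne_zero_or (f : RatFunc ℂ) (z : ℂ) :
    f.num.eval z ≠ 0 ∨ f.denom.eval z ≠ 0 := by
  obtain ⟨a, b, hab⟩ := f.isCoprime_num_denom
  by_contra! h
  have := congrArg (Polynomial.eval z) hab
  simp [h.1, h.2] at this

lemma num_ne_C_mul_denom (hdeg : 2 ≤ ratDegree f) (c : ℂ) : f.num ≠ C c * f.denom := by
  intro h
  have h1 : IsUnit f.denom := f.isCoprime_num_denom.symm.isUnit_of_dvd (h ▸ Dvd.intro_left _ rfl)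
  have h2 : f.denom.natDegree = 0 := Polynomial.natDegree_eq_zero_of_isUnit h1
  have h3 : f.num.natDegree ≤ 0 := by
    rw [h, ← h2]; exact Polynomial.natDegree_C_mul_le _ _
  unfold ratDegree at hdeg
  omega

lemma denom_ne_C_mul_num (hdeg : 2 ≤ ratDegree f) (c : ℂ) : f.denom ≠ C c * f.num := by
  intro h
  have h1 : IsUnit f.num := f.isCoprime_num_denom.isUnit_of_dvd (h ▸ Dvd.intro_left _ rfl)
  have h2 : f.num.natDegree = 0 := Polynomial.natDegree_eq_zero_of_isUnit h1
  have h3 : f.denom.natDegree ≤ 0 := by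
    rw [h, ← h2]; exact Polynomial.natDegree_C_mul_le _ _
  unfold ratDegree at hdeg
  omega

lemma eval_reflect {A : ℂ[X]} {n : ℕ} (hA : A.natDegree ≤ n) {w : ℂ} (hw : w ≠ 0) :
    (reflect n A).eval w = A.eval w⁻¹ * w ^ n := by
  have : Invertible w⁻¹ := invertibleOfNonzero (inv_ne_zero hw)
  have h := eval₂_reflect_mul_pow (RingHom.id ℂ) w⁻¹ n A hA
  rw [invOf_eq_inv, inv_inv, eval₂_id, eval₂_id, inv_pow] at h
  rw [← h, inv_mul_cancel_right₀ (pow_ne_zero n hw)]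

lemma eval_reflect_zero (A : ℂ[X]) (n : ℕ) : (reflect n A).eval 0 = A.coeff n := by
  rw [← coeff_zero_eq_eval_zero, coeff_reflect, revAt_zero]

lemma natDegree_num_le (f : RatFunc ℂ) : f.num.natDegree ≤ ratDegree f := le_max_left _ _

lemma natDegree_denom_le (f : RatFunc ℂ) : f.denom.natDegree ≤ ratDegree f := le_max_right _ _

lemma ratMap_coe (z : ℂ) : ratMap f z = polyQuot f.num f.denom z := rfl

lemma ratMap_infty_of_lt (h : f.denom.natDegree < f.num.natDegree) :
    ratMap f OnePoint.infty = OnePoint.infty := if_pos h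

lemma ratMap_infty_of_le (h : f.num.natDegree ≤ f.denom.natDegree) :
    ratMap f OnePoint.infty =
      ((f.num.coeff f.denom.natDegree / f.denom.leadingCoeff : ℂ) : OnePoint ℂ) :=
  if_neg h.not_gt

/-- In the coordinate `1 / z` the map is again a quotient of polynomials, with coefficients reversed
in degree `ratDegree f`. So the point `∞` reduces to the point `0`. -/
lemma ratMap_sphereInv (w : ℂ) : ratMap f (sphereInv w) =
    polyQuot (reflect (ratDegree f) f.num) (reflect (ratDegree f) f.denom) w := by
  by_cases hw : w = 0
  · subst hw
    rw [sphereInv_zero]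
    unfold polyQuot
    rw [eval_reflect_zero, eval_reflect_zero]
    rcases lt_or_ge f.denom.natDegree f.num.natDegree with h | h
    · rw [ratMap_infty_of_lt h, if_pos]
      exact coeff_eq_zero_of_natDegree_lt (h.trans_le (natDegree_num_le f))
    · have h1 : ratDegree f = f.denom.natDegree := max_eq_right h
      rw [ratMap_infty_of_le h, h1, if_neg]
      · rfl
      · exact leadingCoeff_ne_zero.2 f.denom_ne_zero
  · rw [sphereInv_coe_of_ne hw, ratMap_coe]
    unfold polyQuot
    rw [eval_reflect (natDegree_num_le f) hw, eval_reflect (natDegree_denom_le f) hw,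
      mul_div_mul_right _ _ (pow_ne_zero _ hw)]
    simp [hw]

/-- A rational map is continuous and open. -/
lemma map_ratMap_nhds (hdeg : 2 ≤ ratDegree f) (p : OnePoint ℂ) :
    map (ratMap f) (𝓝 p) = 𝓝 (ratMap f p) := by
  have hcoe : ∀ w : ℂ, 𝓝 (w : OnePoint ℂ) = map (↑) (𝓝 w) := fun w =>
    (OnePoint.isOpenEmbedding_coe.map_nhds_eq w).symm
  induction p using OnePoint.rec with
  | coe z =>
    rw [hcoe, Filter.map_map]
    exact map_polyQuot_nhds (eval_num_ne_zero_or f z) (num_ne_C_mul_denom hdeg)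
      (denom_ne_C_mul_num hdeg)
  | infty =>
    have hinj : ∀ {A B : ℂ[X]} {c : ℂ}, reflect (ratDegree f) A = C c * reflect (ratDegree f) B →
        A = C c * B := by
      intro A B c h
      rw [← reflect_C_mul] at h
      simpa only [reflect_reflect] using congrArg (reflect (ratDegree f)) h
    rw [← sphereInv_zero, ← map_sphereInv_nhds, hcoe, Filter.map_map, Filter.map_map,
      ratMap_sphereInv]
    refine (Filter.map_congr (Eventually.of_forall fun w => ratMap_sphereInv w)).trans
      (map_polyQuot_nhds ?_ (fun c hc => num_ne_C_mul_denom hdeg c (hinj hc))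
        (fun c hc => denom_ne_C_mul_num hdeg c (hinj hc)))
    rw [eval_reflect_zero, eval_reflect_zero]
    rcases max_choice f.num.natDegree f.denom.natDegree with h | h
    · left
      have h1 : ratDegree f = f.num.natDegree := h
      rw [h1]
      refine leadingCoeff_ne_zero.2 fun h0 => ?_
      rw [h0, natDegree_zero] at h1
      omega
    · right
      have h1 : ratDegree f = f.denom.natDegree := h
      rw [h1]
      exact leadingCoeff_ne_zero.2 f.denom_ne_zero

end RatMap

/-! ### The Julia set -/

/-- Equicontinuity of the iterates of `F` at a point of the sphere. -/
def EquicontinuousIterates (F : OnePoint ℂ → OnePoint ℂ) (q : OnePoint ℂ) : Prop :=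
  @EquicontinuousAt ℕ (OnePoint ℂ) (OnePoint ℂ) _ uniformSpaceOfCompactR1 (fun n => F^[n]) q

lemma mem_fatouSet_iff {F : OnePoint ℂ → OnePoint ℂ} {p : OnePoint ℂ} :
    p ∈ fatouSet F ↔ ∀ᶠ q in 𝓝 p, EquicontinuousIterates F q := by
  rw [eventually_nhds_iff]
  constructor
  · rintro ⟨U, hU, hp, h⟩
    exact ⟨U, h, hU, hp⟩
  · rintro ⟨U, h, hU, hp⟩
    exact ⟨U, hU, hp, h⟩

lemma isOpen_fatouSet (F : OnePoint ℂ → OnePoint ℂ) : IsOpen (fatouSet F) := by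
  rw [isOpen_iff_mem_nhds]
  intro p hp
  have h := (mem_fatouSet_iff.1 hp).eventually_nhds
  exact h.mono fun q hq => mem_fatouSet_iff.2 hq

/-- `F` carries the neighbourhoods of `q` to those of `F q`, and composing with `F` shifts the
iterates by one. The missing iterate, the identity, is handled by shrinking the neighbourhood. This
gives the complete invariance of the Julia set. -/
lemma equicontinuousIterates_apply_iff {F : OnePoint ℂ → OnePoint ℂ} {q : OnePoint ℂ}
    (h : map F (𝓝 q) = 𝓝 (F q)) :
    EquicontinuousIterates F (F q) ↔ EquicontinuousIterates F q := by
  let _ : UniformSpace (OnePoint ℂ) := uniformSpaceOfCompactR1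
  constructor
  · intro hq U hU
    have h1 := hq U hU
    rw [← h, eventually_map] at h1
    filter_upwards [h1, UniformSpace.ball_mem_nhds q hU] with x hx hx' n
    cases n with
    | zero => exact hx'
    | succ n => exact hx n
  · intro hq U hU
    rw [← h, eventually_map]
    filter_upwards [hq U hU] with x hx n
    exact hx (n + 1)

section JuliaSet

open Polynomial

variable {f : RatFunc ℂ}

lemma ratMap_mem_juliaSet_iff (hdeg : 2 ≤ ratDegree f) {p : OnePoint ℂ} :
    ratMap f p ∈ juliaSet f ↔ p ∈ juliaSet f := by
  refine not_congr ?_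
  rw [mem_fatouSet_iff, mem_fatouSet_iff, ← map_ratMap_nhds hdeg, eventually_map]
  simp only [equicontinuousIterates_apply_iff (map_ratMap_nhds hdeg _)]

lemma coe_image_juliaPlane (hinf : OnePoint.infty ∉ juliaSet f) :
    (↑) '' juliaPlane f = juliaSet f := by
  ext p
  constructor
  · rintro ⟨z, hz, rfl⟩
    exact hz
  · intro hp
    obtain ⟨z, rfl⟩ := OnePoint.ne_infty_iff_exists.1 (fun h => hinf (h ▸ hp))
    exact ⟨z, hp, rfl⟩

lemma isCompact_juliaPlane (hinf : OnePoint.infty ∉ juliaSet f) : IsCompact (juliaPlane f) := by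
  have h : IsOpen ((↑) '' juliaPlane f : Set (OnePoint ℂ))ᶜ := by
    rw [coe_image_juliaPlane hinf, juliaSet, compl_compl]
    exact isOpen_fatouSet _
  exact (OnePoint.isOpen_compl_image_coe.1 h).2

lemma isTotallyDisconnected_juliaPlane (hinf : OnePoint.infty ∉ juliaSet f)
    (hdisc : IsTotallyDisconnected (juliaSet f)) : IsTotallyDisconnected (juliaPlane f) := by
  rw [← coe_image_juliaPlane hinf] at hdisc
  exact OnePoint.isOpenEmbedding_coe.isEmbedding.isTotallyDisconnected_image.1 hdisc

/-- The rational function on the plane. -/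
def planeMap (f : RatFunc ℂ) (z : ℂ) : ℂ := f.num.eval z / f.denom.eval z

lemma ratMap_coe_of_ne {z : ℂ} (hz : f.denom.eval z ≠ 0) : ratMap f z = (planeMap f z : OnePoint ℂ) :=
  if_neg hz

lemma ratMap_coe_eq_coe_iff {z w : ℂ} :
    ratMap f z = (w : OnePoint ℂ) ↔ f.denom.eval z ≠ 0 ∧ planeMap f z = w := by
  by_cases hz : f.denom.eval z = 0
  · have : ratMap f z = OnePoint.infty := if_pos hz
    simp [this, hz]
  · rw [ratMap_coe_of_ne hz, OnePoint.coe_eq_coe]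
    simp [hz]

/-- Points of the Julia set are mapped into the Julia set, and not to `∞`. -/
lemma denom_ne_zero_of_mem_julia (hdeg : 2 ≤ ratDegree f) (hinf : OnePoint.infty ∉ juliaSet f)
    {z : ℂ} (hz : z ∈ juliaPlane f) : f.denom.eval z ≠ 0 := by
  intro h0
  have h1 : ratMap f z = OnePoint.infty := if_pos h0
  exact hinf (h1 ▸ (ratMap_mem_juliaSet_iff hdeg).2 hz)

lemma planeMap_mem_julia (hdeg : 2 ≤ ratDegree f) (hinf : OnePoint.infty ∉ juliaSet f)
    {z : ℂ} (hz : z ∈ juliaPlane f) : planeMap f z ∈ juliaPlane f := by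
  have h1 := ratMap_coe_of_ne (denom_ne_zero_of_mem_julia hdeg hinf hz)
  have h2 := (ratMap_mem_juliaSet_iff hdeg).2 hz
  rwa [h1] at h2

lemma mem_julia_of_ratMap_eq (hdeg : 2 ≤ ratDegree f) {p : OnePoint ℂ} {z : ℂ}
    (hz : z ∈ juliaPlane f) (h : ratMap f p = z) : p ∈ juliaSet f := by
  rw [← ratMap_mem_juliaSet_iff hdeg, h]
  exact hz

lemma analyticAt_planeMap {z : ℂ} (hz : f.denom.eval z ≠ 0) : AnalyticAt ℂ (planeMap f) z :=
  AnalyticAt.fun_div (f.num.differentiable.analyticAt z) (f.denom.differentiable.analyticAt z) hz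

lemma hasDerivAt_planeMap {z : ℂ} (hz : f.denom.eval z ≠ 0) :
    HasDerivAt (planeMap f) ((f.num.derivative.eval z * f.denom.eval z -
      f.num.eval z * f.denom.derivative.eval z) / f.denom.eval z ^ 2) z :=
  (f.num.hasDerivAt z).div (f.denom.hasDerivAt z) hz

lemma iterate_mem_julia (hdeg : 2 ≤ ratDegree f) (hinf : OnePoint.infty ∉ juliaSet f)
    {z : ℂ} (hz : z ∈ juliaPlane f) (k : ℕ) : (planeMap f)^[k] z ∈ juliaPlane f := by
  induction k generalizing z with
  | zero => exact hz
  | succ k ih => exact ih (planeMap_mem_julia hdeg hinf hz)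

lemma eventually_iterate_ratMap (hdeg : 2 ≤ ratDegree f) (hinf : OnePoint.infty ∉ juliaSet f)
    {z : ℂ} (hz : z ∈ juliaPlane f) (n : ℕ) :
    ∀ᶠ w : ℂ in 𝓝 z, (ratMap f)^[n] (w : OnePoint ℂ) = ((planeMap f)^[n] w : ℂ) := by
  induction n generalizing z with
  | zero => exact Eventually.of_forall fun w => rfl
  | succ n ih =>
    have h0 := denom_ne_zero_of_mem_julia hdeg hinf hz
    have h1 := (hasDerivAt_planeMap h0).continuousAt.eventually
      (ih (planeMap_mem_julia hdeg hinf hz))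
    filter_upwards [h1, f.denom.continuous.continuousAt.eventually_ne h0] with w hw hw'
    rw [Function.iterate_succ_apply, Function.iterate_succ_apply, ratMap_coe_of_ne hw', hw]

lemma hasDerivAt_iterate_planeMap (hdeg : 2 ≤ ratDegree f) (hinf : OnePoint.infty ∉ juliaSet f)
    {z : ℂ} (hz : z ∈ juliaPlane f) (n : ℕ) :
    HasDerivAt (planeMap f)^[n] (∏ k ∈ Finset.range n, deriv (planeMap f) ((planeMap f)^[k] z)) z := by
  induction n generalizing z with
  | zero => simpa using hasDerivAt_id z
  | succ n ih =>
    have h0 := (hasDerivAt_planeMap (denom_ne_zero_of_mem_julia hdeg hinf hz)).differentiableAt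
    rw [Finset.prod_range_succ', Function.iterate_succ]
    exact (ih (planeMap_mem_julia hdeg hinf hz)).comp z h0.hasDerivAt

/-- Hyperbolicity, in terms of the derivatives along orbits in the Julia set. -/
lemma IsHyperbolic.exists_prod (hhyp : IsHyperbolic f) (hdeg : 2 ≤ ratDegree f)
    (hinf : OnePoint.infty ∉ juliaSet f) : ∃ n : ℕ, 1 ≤ n ∧ ∃ κ : ℝ, 1 < κ ∧ ∀ z ∈ juliaPlane f,
      κ ≤ ∏ k ∈ Finset.range n, ‖deriv (planeMap f) ((planeMap f)^[k] z)‖ := by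
  obtain ⟨n, hn, κ, hκ, h⟩ := hhyp
  refine ⟨n, hn, κ, hκ, fun z hz => (h z hz).trans_eq ?_⟩
  have h1 : (fun w : ℂ => toPlane ((ratMap f)^[n] (w : OnePoint ℂ))) =ᶠ[𝓝 z] (planeMap f)^[n] := by
    filter_upwards [eventually_iterate_ratMap hdeg hinf hz n] with w hw
    rw [hw]
    rfl
  rw [h1.deriv_eq, (hasDerivAt_iterate_planeMap hdeg hinf hz n).deriv, norm_prod]

/-- The derivative at `z` is the first factor of a product of modulus greater than `1`; `1 ≤ n`
ensures that it occurs. -/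
lemma deriv_planeMap_ne_zero (hhyp : IsHyperbolic f) (hdeg : 2 ≤ ratDegree f)
    (hinf : OnePoint.infty ∉ juliaSet f) {z : ℂ} (hz : z ∈ juliaPlane f) :
    deriv (planeMap f) z ≠ 0 := by
  obtain ⟨n, hn, κ, hκ, h⟩ := hhyp.exists_prod hdeg hinf
  intro h0
  have h1 := h z hz
  rw [Finset.prod_eq_zero (Finset.mem_range.2 hn) (by simp [h0])] at h1
  linarith

/-- The polynomial whose roots are the preimages of `z`. -/
def fiberPoly (f : RatFunc ℂ) (z : ℂ) : ℂ[X] := f.num - C z * f.denom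

lemma ratMap_coe_eq_coe_iff_isRoot {w z : ℂ} :
    ratMap f w = (z : OnePoint ℂ) ↔ (fiberPoly f z).IsRoot w := by
  rw [ratMap_coe_eq_coe_iff, IsRoot.def, fiberPoly, eval_sub, eval_mul, eval_C, sub_eq_zero,
    planeMap]
  constructor
  · rintro ⟨h0, h⟩
    rwa [div_eq_iff h0] at h
  · intro h
    have h0 : f.denom.eval w ≠ 0 := by
      intro h0
      rw [h0, mul_zero] at h
      exact (eval_num_ne_zero_or f w).elim (fun h' => h' h) (fun h' => h' h0)
    exact ⟨h0, (div_eq_iff h0).2 h⟩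

lemma natDegree_fiberPoly_le (z : ℂ) : (fiberPoly f z).natDegree ≤ ratDegree f :=
  (natDegree_sub_le _ _).trans (max_le (natDegree_num_le f)
    ((natDegree_C_mul_le _ _).trans (natDegree_denom_le f)))

/-- The coefficient in degree `ratDegree f` vanishes only if `∞` is a preimage of `z`. Otherwise no
preimage is lost at `∞` and the fibre polynomial has full degree. -/
lemma coeff_fiberPoly_ne_zero (hdeg : 2 ≤ ratDegree f) {z : ℂ}
    (hz : ratMap f OnePoint.infty ≠ z) : (fiberPoly f z).coeff (ratDegree f) ≠ 0 := by
  rw [fiberPoly, coeff_sub, coeff_C_mul]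
  rcases lt_or_ge f.denom.natDegree f.num.natDegree with h | h
  · have h1 : ratDegree f = f.num.natDegree := max_eq_left h.le
    rw [h1, coeff_eq_zero_of_natDegree_lt h, mul_zero, sub_zero]
    refine leadingCoeff_ne_zero.2 fun h0 => ?_
    rw [h0, natDegree_zero] at h1
    omega
  · have h1 : ratDegree f = f.denom.natDegree := max_eq_right h
    have h2 : f.denom.leadingCoeff ≠ 0 := leadingCoeff_ne_zero.2 f.denom_ne_zero
    rw [ratMap_infty_of_le h, Ne, OnePoint.coe_eq_coe, div_eq_iff h2] at hz
    rw [h1, sub_ne_zero]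
    exact hz

/-- A multiple root of the fibre polynomial would be a critical point of `f`; it lies in the Julia
set by invariance, and hyperbolicity excludes it. -/
lemma nodup_roots_fiberPoly (hhyp : IsHyperbolic f) (hdeg : 2 ≤ ratDegree f)
    (hinf : OnePoint.infty ∉ juliaSet f) {z : ℂ} (hz : z ∈ juliaPlane f) :
    (fiberPoly f z).roots.Nodup := by
  have hne : fiberPoly f z ≠ 0 := by
    intro h0
    refine coeff_fiberPoly_ne_zero hdeg (f := f) (z := z) (fun h => hinf
      (mem_julia_of_ratMap_eq hdeg hz h)) ?_
    rw [h0, coeff_zero]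
  rw [Multiset.nodup_iff_count_le_one]
  intro w
  rw [count_roots]
  by_contra! hlt
  obtain ⟨h1, h2⟩ := (one_lt_rootMultiplicity_iff_isRoot hne).1 hlt
  have hw := ratMap_coe_eq_coe_iff_isRoot.2 h1
  obtain ⟨h0, hwz⟩ := ratMap_coe_eq_coe_iff.1 hw
  refine deriv_planeMap_ne_zero hhyp hdeg hinf (mem_julia_of_ratMap_eq hdeg hz hw) ?_
  rw [(hasDerivAt_planeMap h0).deriv]
  have h3 : f.num.eval w = z * f.denom.eval w := (div_eq_iff h0).1 hwz
  have h4 : f.num.derivative.eval w = z * f.denom.derivative.eval w := by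
    have := h2
    rw [fiberPoly] at this
    simpa [sub_eq_zero] using this
  rw [h3, h4]
  ring

/-- Over a point of the Julia set, a hyperbolic rational function has as many preimages as its
degree. -/
lemma exists_fiber_equiv (hhyp : IsHyperbolic f) (hdeg : 2 ≤ ratDegree f)
    (hinf : OnePoint.infty ∉ juliaSet f) {z : ℂ} (hz : z ∈ juliaPlane f) :
    ∃ w : Fin (ratDegree f) → ℂ, Function.Injective w ∧ ∀ i, ratMap f (w i) = (z : OnePoint ℂ) := by
  have hne : ratMap f OnePoint.infty ≠ z := fun h => hinf (mem_julia_of_ratMap_eq hdeg hz h)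
  have hdg : (fiberPoly f z).natDegree = ratDegree f :=
    le_antisymm (natDegree_fiberPoly_le z) (le_natDegree_of_ne_zero (coeff_fiberPoly_ne_zero hdeg hne))
  have hcard : (fiberPoly f z).roots.toFinset.card = ratDegree f := by
    rw [Multiset.toFinset_card_of_nodup (nodup_roots_fiberPoly hhyp hdeg hinf hz), ← hdg]
    exact (splits_iff_card_roots.1 (IsAlgClosed.splits _))
  refine ⟨fun i => (((fiberPoly f z).roots.toFinset.equivFinOfCardEq hcard).symm i : ℂ),
    fun i j hij => ?_, fun i => ?_⟩
  · exact (Equiv.injective _) (Subtype.ext hij)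
  · have h := (((fiberPoly f z).roots.toFinset.equivFinOfCardEq hcard).symm i).2
    exact ratMap_coe_eq_coe_iff_isRoot.2 (isRoot_of_mem_roots (Multiset.mem_toFinset.1 h))

end JuliaSet

/-! ### Inverse branches near the Julia set -/

lemma exists_localInverse {φ : ℂ → ℂ} {a : ℂ} (hφ : AnalyticAt ℂ φ a) (h0 : deriv φ a ≠ 0) :
    ∃ h : ℂ → ℂ, h (φ a) = a ∧ ∀ᶠ z in 𝓝 (φ a), DifferentiableAt ℂ h z ∧ φ (h z) = z := by
  have hs : HasStrictDerivAt φ (deriv φ a) a := hφ.hasStrictDerivAt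
  have hs' := hs.hasStrictFDerivAt_equiv h0
  refine ⟨hs'.localInverse φ _ a, hs'.localInverse_apply_image, ?_⟩
  have h1 : ContDiffAt ℂ 1 (hs'.localInverse φ _ a) (φ a) :=
    ContDiffAt.to_localInverse (n := 1) hφ.contDiffAt hs'.hasFDerivAt one_ne_zero
  have h2 := (h1.eventually (by simp)).mono fun z hz => hz.differentiableAt one_ne_zero
  exact h2.and hs'.eventually_right_inverse

/-- Inverse branches of `f` over an open set. -/
structure IsBranches (f : RatFunc ℂ) (V : Set ℂ) (g : Fin (ratDegree f) → ℂ → ℂ) : Prop where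
  isOpen : IsOpen V
  differentiableOn : ∀ i, DifferentiableOn ℂ (g i) V
  preimage_eq : ∀ z ∈ V, ratMap f ⁻¹' {(z : OnePoint ℂ)} = range fun i => (g i z : OnePoint ℂ)
  injective : ∀ z ∈ V, Function.Injective fun i => g i z

section Branches

open Polynomial

variable {f : RatFunc ℂ}

lemma ratMap_preimage_eq_range (hdeg : 2 ≤ ratDegree f) {z : ℂ} {w : Fin (ratDegree f) → ℂ}
    (hinf : ratMap f OnePoint.infty ≠ z) (hw : Function.Injective w)
    (h : ∀ i, ratMap f (w i) = (z : OnePoint ℂ)) :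
    ratMap f ⁻¹' {(z : OnePoint ℂ)} = range fun i => (w i : OnePoint ℂ) := by
  classical
  refine Subset.antisymm (fun p hp => ?_) (by rintro _ ⟨i, rfl⟩; exact h i)
  obtain ⟨v, rfl⟩ := OnePoint.ne_infty_iff_exists.1 (fun hpi : p = _ => hinf (hpi ▸ hp))
  have hne : fiberPoly f z ≠ 0 := fun h0 => coeff_fiberPoly_ne_zero hdeg hinf (by rw [h0, coeff_zero])
  have hmem : ∀ {u : ℂ}, ratMap f u = (z : OnePoint ℂ) → u ∈ (fiberPoly f z).roots.toFinset :=
    fun hu => Multiset.mem_toFinset.2 ((mem_roots hne).2 (ratMap_coe_eq_coe_iff_isRoot.1 hu))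
  have hsub : Finset.univ.image w ⊆ (fiberPoly f z).roots.toFinset := by
    intro u hu
    obtain ⟨i, -, rfl⟩ := Finset.mem_image.1 hu
    exact hmem (h i)
  have hle : (fiberPoly f z).roots.toFinset.card ≤ (Finset.univ.image w).card := by
    rw [Finset.card_image_of_injective _ hw, Finset.card_univ, Fintype.card_fin]
    exact (Multiset.toFinset_card_le _).trans ((card_roots' _).trans (natDegree_fiberPoly_le z))
  have hv := hmem hp
  rw [← Finset.eq_of_subset_of_card_le hsub hle] at hv
  obtain ⟨i, -, rfl⟩ := Finset.mem_image.1 hv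
  exact ⟨i, rfl⟩

lemma IsBranches.mono {V U : Set ℂ} {g : Fin (ratDegree f) → ℂ → ℂ} (h : IsBranches f V g)
    (hU : IsOpen U) (hUV : U ⊆ V) : IsBranches f U g :=
  ⟨hU, fun i => (h.differentiableOn i).mono hUV, fun z hz => h.preimage_eq z (hUV hz),
    fun z hz => h.injective z (hUV hz)⟩

lemma IsBranches.union {V₁ V₂ : Set ℂ} {g₁ g₂ : Fin (ratDegree f) → ℂ → ℂ}
    (h₁ : IsBranches f V₁ g₁) (h₂ : IsBranches f V₂ g₂) (hdisj : Disjoint V₁ V₂) :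
    ∃ g, IsBranches f (V₁ ∪ V₂) g := by
  classical
  have e₁ : ∀ i, EqOn (V₁.piecewise (g₁ i) (g₂ i)) (g₁ i) V₁ := fun i => piecewise_eqOn _ _ _
  have e₂ : ∀ i, EqOn (V₁.piecewise (g₁ i) (g₂ i)) (g₂ i) V₂ := fun i z hz =>
    piecewise_eq_of_notMem _ _ _ (disjoint_right.1 hdisj hz)
  refine ⟨fun i => V₁.piecewise (g₁ i) (g₂ i), h₁.isOpen.union h₂.isOpen, fun i z hz => ?_,
    fun z hz => ?_, fun z hz => ?_⟩
  · rcases hz with hz | hz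
    · exact (((h₁.differentiableOn i).congr (e₁ i)).differentiableAt
        (h₁.isOpen.mem_nhds hz)).differentiableWithinAt
    · exact (((h₂.differentiableOn i).congr (e₂ i)).differentiableAt
        (h₂.isOpen.mem_nhds hz)).differentiableWithinAt
  · rcases hz with hz | hz
    · simp only [fun i => e₁ i hz]; exact h₁.preimage_eq z hz
    · simp only [fun i => e₂ i hz]; exact h₂.preimage_eq z hz
  · rcases hz with hz | hz
    · simp only [fun i => e₁ i hz]; exact h₁.injective z hz
    · simp only [fun i => e₂ i hz]; exact h₂.injective z hz

/-- Invert `f` near each of the `m` preimages of `z₀`. The local inverses stay distinct nearby, and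
since the fibre polynomial has at most `m` roots they exhaust the fibre. -/
lemma exists_isBranches_nhds (hhyp : IsHyperbolic f) (hdeg : 2 ≤ ratDegree f)
    (hinf : OnePoint.infty ∉ juliaSet f) {z₀ : ℂ} (hz₀ : z₀ ∈ juliaPlane f) :
    ∃ V g, z₀ ∈ V ∧ IsBranches f V g := by
  obtain ⟨w, hwinj, hw⟩ := exists_fiber_equiv hhyp hdeg hinf hz₀
  have hwJ : ∀ i, w i ∈ juliaPlane f := fun i => mem_julia_of_ratMap_eq hdeg hz₀ (hw i)
  have hw0 : ∀ i, f.denom.eval (w i) ≠ 0 := fun i => (ratMap_coe_eq_coe_iff.1 (hw i)).1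
  have hwz : ∀ i, planeMap f (w i) = z₀ := fun i => (ratMap_coe_eq_coe_iff.1 (hw i)).2
  choose h hh0 hh using fun i => exists_localInverse (analyticAt_planeMap (hw0 i))
    (deriv_planeMap_ne_zero hhyp hdeg hinf (hwJ i))
  simp only [hwz] at hh0 hh
  have hcont : ∀ i, ContinuousAt (h i) z₀ := fun i => (hh i).self_of_nhds.1.continuousAt
  have hden : ∀ i, ∀ᶠ z in 𝓝 z₀, f.denom.eval (h i z) ≠ 0 := fun i =>
    (f.denom.continuous.continuousAt.comp (hcont i)).eventually_ne (by simpa [hh0] using hw0 i)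
  have hinj : ∀ i j, i ≠ j → ∀ᶠ z in 𝓝 z₀, h i z ≠ h j z := fun i j hij =>
    (((hcont i).sub (hcont j)).eventually_ne
      (by rw [Pi.sub_apply, hh0, hh0]; exact sub_ne_zero.2 (hwinj.ne hij))).mono fun z hz => sub_ne_zero.1 hz
  have hfin : ∀ᶠ z : ℂ in 𝓝 z₀, ratMap f OnePoint.infty ≠ z := by
    have h1 : ratMap f OnePoint.infty ≠ z₀ := fun h => hinf (mem_julia_of_ratMap_eq hdeg hz₀ h)
    exact (OnePoint.continuous_coe.continuousAt.eventually_ne h1.symm).mono fun z hz => hz.symm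
  have hall : ∀ᶠ z in 𝓝 z₀, (∀ i, DifferentiableAt ℂ (h i) z ∧ planeMap f (h i z) = z) ∧
      (∀ i, f.denom.eval (h i z) ≠ 0) ∧ (∀ i j, i ≠ j → h i z ≠ h j z) ∧
      ratMap f OnePoint.infty ≠ z := by
    refine (eventually_all.2 hh).and ((eventually_all.2 hden).and (Eventually.and ?_ hfin))
    refine eventually_all.2 fun i => eventually_all.2 fun j => ?_
    by_cases hij : i = j
    · simp [hij]
    · simpa [hij] using hinj i j hij
  obtain ⟨V, hV, hVo, hz₀V⟩ := eventually_nhds_iff.1 hall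
  have hVinj : ∀ z ∈ V, Function.Injective fun i => h i z := fun z hz i j hij => by
    by_contra hne
    exact (hV z hz).2.2.1 i j hne hij
  refine ⟨V, h, hz₀V, hVo, fun i z hz => ((hV z hz).1 i).1.differentiableWithinAt,
    fun z hz => ?_, hVinj⟩
  exact ratMap_preimage_eq_range hdeg (hV z hz).2.2.2 (hVinj z hz) fun i =>
    ratMap_coe_eq_coe_iff.2 ⟨(hV z hz).2.1 i, ((hV z hz).1 i).2⟩

/-- A point of a compact totally disconnected set has arbitrarily small open neighbourhoods whose
trace on the set is closed. -/
lemma exists_isOpen_inter_isClosed {J U : Set ℂ} (hJ : IsCompact J) (hd : IsTotallyDisconnected J)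
    (hU : IsOpen U) {z : ℂ} (hz : z ∈ J) (hzU : z ∈ U) :
    ∃ W ⊆ U, IsOpen W ∧ z ∈ W ∧ IsClosed (W ∩ J) := by
  have : CompactSpace J := isCompact_iff_compactSpace.1 hJ
  have : TotallyDisconnectedSpace J := (totallyDisconnectedSpace_subtype_iff).2 hd
  obtain ⟨K, hK, hzK, hKU⟩ := compact_exists_isClopen_in_isOpen
    (hU.preimage continuous_subtype_val) (show (⟨z, hz⟩ : J) ∈ _ from hzU)
  have hcl : ∀ K : Set J, IsClosed K → IsClosed ((↑) '' K : Set ℂ) := fun K hK =>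
    hJ.isClosed.isClosedEmbedding_subtypeVal.isClosedMap K hK
  have hcompl : IsClosed ((↑) '' Kᶜ : Set ℂ) := hcl _ hK.compl.1
  -- `K` is clopen in `J`; removing the rest of `J`, which is closed in the plane, leaves an open
  -- set whose trace on `J` is `K`.
  refine ⟨U \ ((↑) '' Kᶜ), sdiff_subset, hU.sdiff hcompl, ⟨hzU, ?_⟩, ?_⟩
  · rintro ⟨y, hy, hyz⟩
    exact hy ((Subtype.ext hyz : y = ⟨z, hz⟩) ▸ hzK)
  · have : U \ ((↑) '' Kᶜ) ∩ J = (↑) '' K := by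
      ext y
      constructor
      · rintro ⟨⟨hyU, hyK⟩, hyJ⟩
        refine ⟨⟨y, hyJ⟩, ?_, rfl⟩
        by_contra hn
        exact hyK ⟨_, hn, rfl⟩
      · rintro ⟨y, hy, rfl⟩
        refine ⟨⟨hKU hy, ?_⟩, y.2⟩
        rintro ⟨y', hy', he⟩
        exact hy' (Subtype.ext he ▸ hy)
    rw [this]
    exact hcl _ hK.1

/-- The inverse branches near the Julia set. -/
theorem exists_isInverseBranches (hhyp : IsHyperbolic f) (hdeg : 2 ≤ ratDegree f)
    (hinf : OnePoint.infty ∉ juliaSet f) (hdisc : IsTotallyDisconnected (juliaSet f)) :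
    ∃ V g, IsInverseBranches f V g := by
  have hJ := isCompact_juliaPlane hinf
  have hd := isTotallyDisconnected_juliaPlane hinf hdisc
  -- The closed trace of `V` on `J` is carried along so that the traces of `V₁` and of `V₂` minus
  -- `V₁` are disjoint compact sets. They are separated by open sets, and on disjoint open pieces
  -- the branches need no compatible labelling.
  have key : ∃ V g, juliaPlane f ∩ juliaPlane f ⊆ V ∧ IsClosed (V ∩ juliaPlane f) ∧ IsBranches f V g := by
    refine hJ.induction_on (p := fun S => ∃ V g, S ∩ juliaPlane f ⊆ V ∧ IsClosed (V ∩ juliaPlane f) ∧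
      IsBranches f V g) ?_ ?_ ?_ ?_
    · exact ⟨∅, fun _ _ => 0, by simp, by simp, isOpen_empty, fun i => differentiableOn_empty,
        by simp, by simp⟩
    · rintro S T hST ⟨V, g, hTV, h⟩
      exact ⟨V, g, (inter_subset_inter_left _ hST).trans hTV, h⟩
    · rintro S T ⟨V₁, g₁, hS, hc₁, h₁⟩ ⟨V₂, g₂, hT, hc₂, h₂⟩
      have hK₁ : IsCompact (V₁ ∩ juliaPlane f) := hJ.of_isClosed_subset hc₁ inter_subset_right
      have hK₂ : IsCompact ((V₂ ∩ juliaPlane f) \ V₁) :=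
        (hJ.of_isClosed_subset hc₂ inter_subset_right).diff h₁.isOpen
      obtain ⟨O₁, O₂, hO₁, hO₂, hKO₁, hKO₂, hO⟩ := SeparatedNhds.of_isCompact_isCompact hK₁ hK₂
        (disjoint_left.2 fun x hx hx' => hx'.2 hx.1)
      obtain ⟨g, hg⟩ := (h₁.mono (h₁.isOpen.inter hO₁) inter_subset_left).union
        (h₂.mono (h₂.isOpen.inter hO₂) inter_subset_left)
        (hO.mono inter_subset_right inter_subset_right)
      refine ⟨_, g, ?_, ?_, hg⟩
      · rintro x ⟨hx, hxJ⟩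
        by_cases hx₁ : x ∈ V₁
        · exact Or.inl ⟨hx₁, hKO₁ ⟨hx₁, hxJ⟩⟩
        · have hx₂ : x ∈ V₂ := hx.elim (fun h => (hx₁ (hS ⟨h, hxJ⟩)).elim) fun h => hT ⟨h, hxJ⟩
          exact Or.inr ⟨hx₂, hKO₂ ⟨⟨hx₂, hxJ⟩, hx₁⟩⟩
      · have : (V₁ ∩ O₁ ∪ V₂ ∩ O₂) ∩ juliaPlane f =
            (V₁ ∩ juliaPlane f) ∪ ((V₂ ∩ juliaPlane f) \ V₁) := by
          ext x
          constructor
          · rintro ⟨⟨h, -⟩ | ⟨h, -⟩, hxJ⟩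
            · exact Or.inl ⟨h, hxJ⟩
            · by_cases hx₁ : x ∈ V₁
              · exact Or.inl ⟨hx₁, hxJ⟩
              · exact Or.inr ⟨⟨h, hxJ⟩, hx₁⟩
          · rintro (h | h)
            · exact ⟨Or.inl ⟨h.1, hKO₁ h⟩, h.2⟩
            · exact ⟨Or.inr ⟨h.1.1, hKO₂ h⟩, h.1.2⟩
        rw [this]
        exact hK₁.isClosed.union hK₂.isClosed
    · intro z hz
      obtain ⟨V, g, hzV, hV⟩ := exists_isBranches_nhds hhyp hdeg hinf hz
      obtain ⟨W, hWV, hWo, hzW, hWc⟩ := exists_isOpen_inter_isClosed hJ hd hV.isOpen hz hzV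
      exact ⟨W, mem_nhdsWithin_of_mem_nhds (hWo.mem_nhds hzW), W, g, inter_subset_left, hWc,
        hV.mono hWo hWV⟩
  obtain ⟨V, g, hJV, -, h⟩ := key
  exact ⟨V, g, h.isOpen, by simpa using hJV, h.differentiableOn, h.preimage_eq, h.injective⟩

end Branches

/-! ### Holomorphic extension of the inverse branches -/

/-- The linear form `(x, y) ↦ x + i y`. -/
def coordPlus : ℂ × ℂ →L[ℂ] ℂ :=
  ContinuousLinearMap.fst ℂ ℂ ℂ + Complex.I • ContinuousLinearMap.snd ℂ ℂ ℂ

/-- The linear form `(x, y) ↦ x - i y`. -/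
def coordMinus : ℂ × ℂ →L[ℂ] ℂ :=
  ContinuousLinearMap.fst ℂ ℂ ℂ - Complex.I • ContinuousLinearMap.snd ℂ ℂ ℂ

lemma coordPlus_apply (ζ : ℂ × ℂ) : coordPlus ζ = ζ.1 + Complex.I * ζ.2 := rfl

lemma coordMinus_apply (ζ : ℂ × ℂ) : coordMinus ζ = ζ.1 - Complex.I * ζ.2 := rfl

lemma coordPlus_realEmb (z : ℂ) : coordPlus (realEmb z) = z := by
  rw [coordPlus_apply, realEmb, mul_comm, Complex.re_add_im]

lemma coordMinus_realEmb (z : ℂ) : coordMinus (realEmb z) = (starRingEnd ℂ) z := by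
  rw [coordMinus_apply, realEmb]
  apply Complex.ext <;> simp

/-- The point with given values of `coordPlus` and `coordMinus`. -/
def ofCoords (a b : ℂ) : ℂ × ℂ := ((a + b) / 2, (a - b) / (2 * Complex.I))

lemma ofCoords_conj (z : ℂ) : ofCoords z ((starRingEnd ℂ) z) = realEmb z := by
  have hI := Complex.I_ne_zero
  refine Prod.ext ?_ ?_
  · simp only [ofCoords, realEmb, Complex.add_conj]
    push_cast
    ring
  · simp only [ofCoords, realEmb, Complex.sub_conj]
    field_simp
    push_cast
    ring

lemma differentiableOn_conj_comp_conj {h : ℂ → ℂ} {V : Set ℂ} (hV : IsOpen V)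
    (hh : DifferentiableOn ℂ h V) :
    DifferentiableOn ℂ (fun b => (starRingEnd ℂ) (h ((starRingEnd ℂ) b)))
      ((starRingEnd ℂ) ⁻¹' V) := by
  intro b hb
  have h1 : DifferentiableAt ℂ h ((starRingEnd ℂ) b) := (hh _ hb).differentiableAt (hV.mem_nhds hb)
  have h2 := h1.conj_conj
  rw [Complex.conj_conj] at h2
  exact h2.differentiableWithinAt

section Extension

variable {f : RatFunc ℂ} {V : Set ℂ} {g : Fin (ratDegree f) → ℂ → ℂ}

namespace IsInverseBranches

lemma planeMap_apply (h : IsInverseBranches f V g) {z : ℂ} (hz : z ∈ V) (i : Fin (ratDegree f)) :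
    f.denom.eval (g i z) ≠ 0 ∧ planeMap f (g i z) = z := by
  rw [← ratMap_coe_eq_coe_iff]
  have h1 : (g i z : OnePoint ℂ) ∈ ratMap f ⁻¹' {(z : OnePoint ℂ)} := by
    rw [h.preimage_eq z hz]
    exact ⟨i, rfl⟩
  exact h1

lemma deriv_mul_deriv (h : IsInverseBranches f V g) {z : ℂ} (hz : z ∈ V) (i : Fin (ratDegree f)) :
    deriv (planeMap f) (g i z) * deriv (g i) z = 1 := by
  have h1 := ((h.differentiableOn i).differentiableAt (h.isOpen.mem_nhds hz)).hasDerivAt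
  have h2 := (hasDerivAt_planeMap (h.planeMap_apply hz i).1).differentiableAt.hasDerivAt
  have h3 : (planeMap f ∘ g i) =ᶠ[𝓝 z] id := by
    filter_upwards [h.isOpen.mem_nhds hz] with w hw
    exact (h.planeMap_apply hw i).2
  exact ((h2.comp z h1).congr_of_eventuallyEq h3.symm).unique (hasDerivAt_id z)

lemma deriv_ne_zero (h : IsInverseBranches f V g) {z : ℂ} (hz : z ∈ V) (i : Fin (ratDegree f)) :
    deriv (g i) z ≠ 0 := right_ne_zero_of_mul_eq_one (h.deriv_mul_deriv hz i)

/-- The inverse branches and the logarithms of their derivatives extend holomorphically. -/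
theorem exists_isHolomorphicExtension (h : IsInverseBranches f V g) :
    ∃ Ω G Λ, IsHolomorphicExtension f V g Ω G Λ := by
  -- The forms `x + iy` and `x - iy` are independent coordinates on `ℂ²`, conjugate to each other on
  -- `ℝ²`. The extension is `g` in the first coordinate and `b ↦ conj (g (conj b))`, again
  -- holomorphic, in the second.
  set U : Set (ℂ × ℂ) := coordPlus ⁻¹' V ∩ coordMinus ⁻¹' ((starRingEnd ℂ) ⁻¹' V) with hU
  have hUo : IsOpen U := (h.isOpen.preimage coordPlus.continuous).inter
    ((h.isOpen.preimage Complex.continuous_conj).preimage coordMinus.continuous)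
  have hUreal : ∀ z ∈ V, realEmb z ∈ U := by
    intro z hz
    refine ⟨?_, ?_⟩
    · rwa [mem_preimage, coordPlus_realEmb]
    · rwa [mem_preimage, coordMinus_realEmb, mem_preimage, Complex.conj_conj]
  have hdiff : ∀ {k : ℂ → ℂ}, DifferentiableOn ℂ k V →
      DifferentiableOn ℂ (fun ζ => k (coordPlus ζ)) U ∧ DifferentiableOn ℂ
        (fun ζ => (starRingEnd ℂ) (k ((starRingEnd ℂ) (coordMinus ζ)))) U := by
    intro k hk
    exact ⟨hk.comp coordPlus.differentiable.differentiableOn fun ζ hζ => hζ.1,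
      (differentiableOn_conj_comp_conj h.isOpen hk).comp
        coordMinus.differentiable.differentiableOn fun ζ hζ => hζ.2⟩
  -- `N i` extends `|g'|²`, which is positive on `J`, so half its principal logarithm extends `log
  -- |g'|` to a neighbourhood.
  set N : Fin (ratDegree f) → ℂ × ℂ → ℂ := fun i ζ => deriv (g i) (coordPlus ζ) *
    (starRingEnd ℂ) (deriv (g i) ((starRingEnd ℂ) (coordMinus ζ))) with hN
  have hNd : ∀ i, DifferentiableOn ℂ (N i) U := fun i =>
    (hdiff ((h.differentiableOn i).deriv h.isOpen)).1.mul
      (hdiff ((h.differentiableOn i).deriv h.isOpen)).2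
  have hNreal : ∀ i z, N i (realEmb z) = ((‖deriv (g i) z‖ ^ 2 : ℝ) : ℂ) := by
    intro i z
    simp only [hN, coordPlus_realEmb, coordMinus_realEmb, Complex.conj_conj]
    rw [Complex.mul_conj, Complex.normSq_eq_norm_sq]
  refine ⟨U ∩ ⋂ i, (U ∩ N i ⁻¹' Complex.slitPlane), fun i ζ =>
    ofCoords (g i (coordPlus ζ)) ((starRingEnd ℂ) (g i ((starRingEnd ℂ) (coordMinus ζ)))),
    fun i ζ => (1 / 2) * Complex.log (N i ζ), ?_, ?_, fun i => ?_, fun i => ?_,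
    fun i z hz _ => ?_, fun i z hz _ => ?_⟩
  · exact hUo.inter (isOpen_iInter_of_finite fun i =>
      (hNd i).continuousOn.isOpen_inter_preimage hUo Complex.isOpen_slitPlane)
  · rintro _ ⟨z, hz, rfl⟩
    have hzV := h.julia_subset hz
    refine ⟨hUreal z hzV, mem_iInter.2 fun i => ⟨hUreal z hzV, ?_⟩⟩
    rw [mem_preimage, hNreal, Complex.ofReal_mem_slitPlane]
    have := norm_pos_iff.2 (h.deriv_ne_zero hzV i)
    positivity
  · have hsub : U ∩ ⋂ i, (U ∩ N i ⁻¹' Complex.slitPlane) ⊆ U := inter_subset_left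
    have h1 := (hdiff (h.differentiableOn i)).1.mono hsub
    have h2 := (hdiff (h.differentiableOn i)).2.mono hsub
    simp only [ofCoords, div_eq_mul_inv]
    exact ((h1.add h2).mul_const _).prodMk ((h1.sub h2).mul_const _)
  · have h1 : DifferentiableOn ℂ (N i) (U ∩ ⋂ i, (U ∩ N i ⁻¹' Complex.slitPlane)) :=
      (hNd i).mono inter_subset_left
    exact (h1.clog fun ζ hζ => (mem_iInter.1 hζ.2 i).2).const_mul _
  · simp only [coordPlus_realEmb, coordMinus_realEmb, Complex.conj_conj]
    exact ofCoords_conj _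
  · simp only [hNreal]
    rw [← Complex.ofReal_log (by positivity), Real.log_pow]
    push_cast
    ring

end IsInverseBranches

end Extension

/-! ### A norm adapted to the complex structure of the real plane -/

/-- The norm `max |x ± i y|` on `ℂ²`. -/
def coordNorm (ξ : ℂ × ℂ) : ℝ := max ‖coordPlus ξ‖ ‖coordMinus ξ‖

lemma coordNorm_nonneg (ξ : ℂ × ℂ) : 0 ≤ coordNorm ξ := (norm_nonneg _).trans (le_max_left _ _)

lemma coordNorm_add_le (ξ η : ℂ × ℂ) : coordNorm (ξ + η) ≤ coordNorm ξ + coordNorm η := by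
  refine max_le ?_ ?_
  · rw [map_add]
    exact (norm_add_le _ _).trans (add_le_add (le_max_left _ _) (le_max_left _ _))
  · rw [map_add]
    exact (norm_add_le _ _).trans (add_le_add (le_max_right _ _) (le_max_right _ _))

lemma coordNorm_sub_comm (ξ η : ℂ × ℂ) : coordNorm (ξ - η) = coordNorm (η - ξ) := by
  simp only [coordNorm, map_sub, norm_sub_rev]

lemma coordNorm_le (ξ : ℂ × ℂ) : coordNorm ξ ≤ 2 * ‖ξ‖ := by
  have h1 := norm_fst_le ξ
  have h2 := norm_snd_le ξ
  refine max_le ?_ ?_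
  · rw [coordPlus_apply]
    refine (norm_add_le _ _).trans ?_
    rw [norm_mul, Complex.norm_I]
    linarith
  · rw [coordMinus_apply]
    refine (norm_sub_le _ _).trans ?_
    rw [norm_mul, Complex.norm_I]
    linarith

lemma norm_le_coordNorm (ξ : ℂ × ℂ) : ‖ξ‖ ≤ coordNorm ξ := by
  have h1 : ‖coordPlus ξ‖ ≤ coordNorm ξ := le_max_left _ _
  have h2 : ‖coordMinus ξ‖ ≤ coordNorm ξ := le_max_right _ _
  have e1 : ξ.1 = (coordPlus ξ + coordMinus ξ) / 2 := by
    rw [coordPlus_apply, coordMinus_apply]; ring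
  have e2 : ξ.2 = (coordPlus ξ - coordMinus ξ) / (2 * Complex.I) := by
    rw [coordPlus_apply, coordMinus_apply]
    have := Complex.I_ne_zero
    field_simp
    ring
  refine max_le ?_ ?_
  · rw [e1, norm_div, Complex.norm_ofNat, div_le_iff₀ two_pos]
    exact (norm_add_le _ _).trans (by linarith)
  · rw [e2, norm_div, norm_mul, Complex.norm_ofNat, Complex.norm_I, mul_one, div_le_iff₀ two_pos]
    exact (norm_sub_le _ _).trans (by linarith)

lemma coordNorm_realEmb_sub (z w : ℂ) : coordNorm (realEmb z - realEmb w) = ‖z - w‖ := by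
  rw [coordNorm, map_sub, map_sub, coordPlus_realEmb, coordPlus_realEmb, coordMinus_realEmb,
    coordMinus_realEmb, ← map_sub, RCLike.norm_conj, max_self]

lemma continuous_coordNorm : Continuous coordNorm :=
  coordPlus.continuous.norm.max coordMinus.continuous.norm

/-- The inclusion `ℝ² ⊆ ℂ²` as a real linear map. -/
def realEmbL : ℂ →L[ℝ] ℂ × ℂ :=
  (Complex.ofRealCLM.comp Complex.reCLM).prod (Complex.ofRealCLM.comp Complex.imCLM)

lemma realEmbL_apply (z : ℂ) : realEmbL z = realEmb z := rfl

lemma continuous_realEmb : Continuous realEmb := realEmbL.continuous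

/-- A second order Taylor estimate for holomorphic functions of two variables. -/
lemma norm_sub_sub_fderiv_le {F : ℂ × ℂ → ℂ} {p ξ : ℂ × ℂ} {R M : ℝ}
    (hF : ∀ z ∈ Metric.ball p R, DifferentiableAt ℂ F z) (hb : ∀ z ∈ Metric.ball p R, ‖F z‖ ≤ M)
    (hξ : ‖ξ‖ < R) :
    ‖F (p + ξ) - F p - fderiv ℂ F p ξ‖ ≤ 4 * M / R ^ 2 * ‖ξ‖ ^ 2 := by
  have hR : 0 < R := (norm_nonneg _).trans_lt hξ
  by_cases h0 : ξ = 0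
  · simp [h0]
  have hξ0 : 0 < ‖ξ‖ := norm_pos_iff.2 h0
  set r := R / ‖ξ‖ with hr
  have hr1 : 1 < r := (one_lt_div hξ0).2 hξ
  have hr0 : 0 < r := one_pos.trans hr1
  set h : ℂ → ℂ := fun t => F (p + t • ξ) with hh
  have hmem : ∀ t ∈ Metric.ball (0 : ℂ) r, p + t • ξ ∈ Metric.ball p R := by
    intro t ht
    rw [mem_ball_zero_iff, hr, lt_div_iff₀ hξ0] at ht
    rw [mem_ball_iff_norm, add_sub_cancel_left, norm_smul]
    exact ht
  have hder : ∀ t ∈ Metric.ball (0 : ℂ) r, HasDerivAt h (fderiv ℂ F (p + t • ξ) ξ) t := by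
    intro t ht
    have h1 := (hF _ (hmem t ht)).hasFDerivAt
    have h2 : HasDerivAt (fun t : ℂ => p + t • ξ) ξ t := by
      simpa using ((hasDerivAt_id t).smul_const ξ).const_add p
    exact h1.comp_hasDerivAt t h2
  have hhd : DifferentiableOn ℂ h (Metric.ball 0 r) := fun t ht =>
    (hder t ht).differentiableAt.differentiableWithinAt
  have hz : (0 : ℂ) ∈ Metric.ball (0 : ℂ) r := Metric.mem_ball_self hr0
  have hmaps : MapsTo h (Metric.ball 0 r) (Metric.closedBall (h 0) (2 * M)) := by
    intro t ht
    rw [mem_closedBall_iff_norm]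
    have h1 := norm_sub_le (h t) (h 0)
    have h2 := hb _ (hmem t ht)
    have h3 := hb _ (hmem 0 hz)
    simp only [hh] at h1 h2 h3 ⊢
    linarith
  -- Schwarz's lemma is used twice on the disc of radius `r = R / ‖ξ‖`: it bounds the slope `k` by
  -- `2 * M / r`, and then `k 1 - k 0` by `4 * M / r ^ 2`. Here `k 1` is the increment of `F` and `k
  -- 0` its derivative along `ξ`.
  set k := dslope h 0 with hk
  have hkb : ∀ t ∈ Metric.ball (0 : ℂ) r, ‖k t‖ ≤ 2 * M / r := fun t ht =>
    Complex.norm_dslope_le_div_of_mapsTo_ball hhd hmaps ht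
  have hkd : DifferentiableOn ℂ k (Metric.ball 0 r) :=
    (Complex.differentiableOn_dslope (Metric.ball_mem_nhds 0 hr0)).2 hhd
  have hkmaps : MapsTo k (Metric.ball 0 r) (Metric.closedBall (k 0) (4 * M / r)) := by
    intro t ht
    rw [mem_closedBall_iff_norm]
    have h1 := norm_sub_le (k t) (k 0)
    have h2 := hkb t ht
    have h3 := hkb 0 hz
    have h5 : 4 * M / r = 2 * (2 * M / r) := by ring
    linarith
  have h1 : (1 : ℂ) ∈ Metric.ball (0 : ℂ) r := by simpa using hr1
  have key := Complex.dist_le_div_mul_dist_of_mapsTo_ball hkd hkmaps h1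
  have e1 : k 1 = F (p + ξ) - F p := by
    rw [hk, dslope_of_ne _ one_ne_zero, slope_def_field]
    simp [hh]
  have e0 : k 0 = fderiv ℂ F p ξ := by
    rw [hk, dslope_same, (hder 0 hz).deriv, zero_smul, add_zero]
  rw [dist_eq_norm, dist_eq_norm, e1, e0, sub_zero, norm_one, mul_one] at key
  refine key.trans (le_of_eq ?_)
  rw [hr]
  field_simp

/-! ### Contraction of the extended branches near the Julia set -/

section

variable {f : RatFunc ℂ} {V : Set ℂ} {g : Fin (ratDegree f) → ℂ → ℂ} {Ω : Set (ℂ × ℂ)}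
  {G : Fin (ratDegree f) → ℂ × ℂ → ℂ × ℂ} {Λ : Fin (ratDegree f) → ℂ × ℂ → ℂ}

namespace IsHolomorphicExtension

lemma eventually_map_eq (hE : IsHolomorphicExtension f V g Ω G Λ) (h : IsInverseBranches f V g)
    {z : ℂ} (hz : z ∈ V) (hzΩ : realEmb z ∈ Ω) (i : Fin (ratDegree f)) :
    ∀ᶠ w in 𝓝 z, G i (realEmb w) = realEmb (g i w) := by
  filter_upwards [h.isOpen.mem_nhds hz,
    continuous_realEmb.continuousAt.preimage_mem_nhds (hE.isOpen.mem_nhds hzΩ)] with w hw hw'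
  exact hE.map_eq i w hw hw'

/-- Along `ℝ²` the extension coincides with `g i` near `z`, so the two real derivatives agree. -/
lemma fderiv_realEmb (hE : IsHolomorphicExtension f V g Ω G Λ) (h : IsInverseBranches f V g)
    {z : ℂ} (hz : z ∈ V) (hzΩ : realEmb z ∈ Ω) (i : Fin (ratDegree f)) (v : ℂ) :
    fderiv ℂ (G i) (realEmb z) (realEmb v) = realEmb (deriv (g i) z * v) := by
  have hG : HasFDerivAt (G i) (fderiv ℂ (G i) (realEmb z)) (realEmb z) :=
    ((hE.differentiableOn_map i).differentiableAt (hE.isOpen.mem_nhds hzΩ)).hasFDerivAt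
  have h1 := (hG.restrictScalars ℝ).comp z realEmbL.hasFDerivAt
  have hg := ((h.differentiableOn i).differentiableAt (h.isOpen.mem_nhds hz)).hasDerivAt
  have h2 := realEmbL.hasFDerivAt.comp z (hg.hasFDerivAt.restrictScalars ℝ)
  have h3 := (h1.congr_of_eventuallyEq
    ((hE.eventually_map_eq h hz hzΩ i).mono fun w hw => hw.symm)).unique h2
  have h4 := congrArg (fun l : ℂ →L[ℝ] ℂ × ℂ => l v) h3
  simpa [realEmbL_apply, mul_comm] using h4

lemma apply_eq_smul_add_smul (A : ℂ × ℂ →L[ℂ] ℂ) (ξ : ℂ × ℂ) :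
    A ξ = ξ.1 * A (realEmb 1) + ξ.2 * A (realEmb Complex.I) := by
  have : ξ = ξ.1 • realEmb 1 + ξ.2 • realEmb Complex.I := by
    refine Prod.ext ?_ ?_ <;> simp [realEmb]
  conv_lhs => rw [this]
  rw [map_add, map_smul, map_smul, smul_eq_mul, smul_eq_mul]

/-- A complex linear form on `ℂ²` is determined by its values on the real basis vectors. Together
with `coordMinus_fderiv` this diagonalizes the derivative, with entries `g'` and its conjugate;
hence it scales `coordNorm` by exactly `|g'|`. -/
lemma coordPlus_fderiv (hE : IsHolomorphicExtension f V g Ω G Λ) (h : IsInverseBranches f V g)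
    {z : ℂ} (hz : z ∈ V) (hzΩ : realEmb z ∈ Ω) (i : Fin (ratDegree f)) (ξ : ℂ × ℂ) :
    coordPlus (fderiv ℂ (G i) (realEmb z) ξ) = deriv (g i) z * coordPlus ξ := by
  have h1 := apply_eq_smul_add_smul (coordPlus.comp (fderiv ℂ (G i) (realEmb z))) ξ
  simp only [ContinuousLinearMap.comp_apply, hE.fderiv_realEmb h hz hzΩ, coordPlus_realEmb] at h1
  rw [h1, coordPlus_apply]
  ring

lemma coordMinus_fderiv (hE : IsHolomorphicExtension f V g Ω G Λ) (h : IsInverseBranches f V g)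
    {z : ℂ} (hz : z ∈ V) (hzΩ : realEmb z ∈ Ω) (i : Fin (ratDegree f)) (ξ : ℂ × ℂ) :
    coordMinus (fderiv ℂ (G i) (realEmb z) ξ) =
      (starRingEnd ℂ) (deriv (g i) z) * coordMinus ξ := by
  have h1 := apply_eq_smul_add_smul (coordMinus.comp (fderiv ℂ (G i) (realEmb z))) ξ
  simp only [ContinuousLinearMap.comp_apply, hE.fderiv_realEmb h hz hzΩ, coordMinus_realEmb,
    map_mul, map_one, Complex.conj_I] at h1
  rw [h1, coordMinus_apply]
  ring

lemma isCompact_juliaReal (hinf : OnePoint.infty ∉ juliaSet f) : IsCompact (juliaReal f) :=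
  (isCompact_juliaPlane hinf).image continuous_realEmb

/-- Near the Julia set, the extended inverse branches contract at the rate of the inverse
branches, up to a uniform quadratic error. -/
lemma exists_coordNorm_le (hE : IsHolomorphicExtension f V g Ω G Λ)
    (h : IsInverseBranches f V g) (hinf : OnePoint.infty ∉ juliaSet f) :
    ∃ r > 0, ∃ C : ℝ, 0 ≤ C ∧ ∀ i, ∀ z ∈ juliaPlane f, ∀ w,
      coordNorm (w - realEmb z) < r → coordNorm (G i w - realEmb (g i z)) ≤
        (‖deriv (g i) z‖ + C * coordNorm (w - realEmb z)) * coordNorm (w - realEmb z) := by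
  have hcpt := isCompact_juliaReal hinf
  obtain ⟨δ, hδ, hsub⟩ := hcpt.exists_cthickening_subset_open hE.isOpen hE.julia_subset
  have hKc : IsCompact (Metric.cthickening δ (juliaReal f)) := hcpt.cthickening
  have hcont : ∀ i, ContinuousOn (G i) (Metric.cthickening δ (juliaReal f)) := fun i =>
    (hE.differentiableOn_map i).continuousOn.mono hsub
  choose b hb using fun i => hKc.exists_bound_of_continuousOn
    (continuous_coordNorm.comp_continuousOn (hcont i))
  set M : ℝ := ∑ i, |b i| with hM
  have hM0 : 0 ≤ M := Finset.sum_nonneg fun i _ => abs_nonneg _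
  have hbM : ∀ i, ∀ w ∈ Metric.cthickening δ (juliaReal f), coordNorm (G i w) ≤ M := by
    intro i w hw
    refine (le_abs_self _).trans ((hb i w hw).trans ((le_abs_self _).trans ?_))
    exact Finset.single_le_sum (f := fun i => |b i|) (fun i _ => abs_nonneg _) (Finset.mem_univ i)
  refine ⟨δ, hδ, 4 * M / δ ^ 2, by positivity, fun i z hz w hw => ?_⟩
  have hp : realEmb z ∈ juliaReal f := mem_image_of_mem _ hz
  have hzV := h.julia_subset hz
  have hzΩ := hE.julia_subset hp
  have hball : Metric.ball (realEmb z) δ ⊆ Metric.cthickening δ (juliaReal f) :=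
    Metric.ball_subset_closedBall.trans (Metric.closedBall_subset_cthickening hp δ)
  have hGd : ∀ v ∈ Metric.ball (realEmb z) δ, DifferentiableAt ℂ (G i) v := fun v hv =>
    (hE.differentiableOn_map i).differentiableAt (hE.isOpen.mem_nhds (hsub (hball hv)))
  set ξ := w - realEmb z with hξ
  have hwξ : w = realEmb z + ξ := by rw [hξ, add_sub_cancel]
  have hξn : ‖ξ‖ ≤ coordNorm ξ := norm_le_coordNorm ξ
  have hC : 0 ≤ 4 * M / δ ^ 2 := by positivity
  have main : ∀ l : ℂ × ℂ →L[ℂ] ℂ, (∀ v, ‖l v‖ ≤ coordNorm v) →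
      ‖l (fderiv ℂ (G i) (realEmb z) ξ)‖ ≤ ‖deriv (g i) z‖ * coordNorm ξ →
      ‖l (G i w - realEmb (g i z))‖ ≤ (‖deriv (g i) z‖ + 4 * M / δ ^ 2 * coordNorm ξ) *
        coordNorm ξ := by
    intro l hl hlξ
    have hz0 : realEmb z ∈ Metric.ball (realEmb z) δ := Metric.mem_ball_self hδ
    have h1 := norm_sub_sub_fderiv_le (F := fun v => l (G i v)) (p := realEmb z) (ξ := ξ) (R := δ)
      (M := M) (fun v hv => l.differentiableAt.comp v (hGd v hv))
      (fun v hv => (hl _).trans (hbM i v (hball hv))) (hξn.trans_lt hw)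
    have h2 : fderiv ℂ (fun v => l (G i v)) (realEmb z) = l.comp (fderiv ℂ (G i) (realEmb z)) :=
      (l.hasFDerivAt.comp (realEmb z) (hGd _ hz0).hasFDerivAt).fderiv
    rw [h2, ← hwξ, ContinuousLinearMap.comp_apply, hE.map_eq i z hzV hzΩ, ← map_sub] at h1
    have h3 := norm_le_norm_sub_add (l (G i w - realEmb (g i z)))
      (l (fderiv ℂ (G i) (realEmb z) ξ))
    have h4 : 4 * M / δ ^ 2 * ‖ξ‖ ^ 2 ≤
        4 * M / δ ^ 2 * coordNorm ξ * coordNorm ξ := by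
      rw [mul_assoc, ← pow_two]
      gcongr
    linarith
  refine max_le (main coordPlus (fun v => le_max_left _ _) ?_)
    (main coordMinus (fun v => le_max_right _ _) ?_)
  · rw [hE.coordPlus_fderiv h hzV hzΩ, norm_mul]
    gcongr
    exact le_max_left _ _
  · rw [hE.coordMinus_fderiv h hzV hzΩ, norm_mul, RCLike.norm_conj]
    gcongr
    exact le_max_right _ _

end IsHolomorphicExtension

end

/-! ### Admissible domains -/

section

open Finset in
/-- The density of the metric on the Julia set that makes a hyperbolic map expanding. -/
def adaptedDensity (f : RatFunc ℂ) (θ : ℝ) (n : ℕ) (z : ℂ) : ℝ :=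
  ∑ k ∈ range n, θ ^ k * ∏ j ∈ range k, ‖deriv (planeMap f) ((planeMap f)^[j] z)‖

variable {f : RatFunc ℂ} {V : Set ℂ} {g : Fin (ratDegree f) → ℂ → ℂ}

lemma one_le_adaptedDensity {θ : ℝ} (hθ : 0 ≤ θ) {n : ℕ} (hn : 1 ≤ n) (z : ℂ) :
    1 ≤ adaptedDensity f θ n z := by
  have h := Finset.single_le_sum (s := Finset.range n)
    (f := fun k => θ ^ k * ∏ j ∈ Finset.range k, ‖deriv (planeMap f) ((planeMap f)^[j] z)‖)
    (fun k _ => mul_nonneg (pow_nonneg hθ k) (Finset.prod_nonneg fun j _ => norm_nonneg _))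
    (Finset.mem_range.2 hn)
  simpa [adaptedDensity] using h

lemma exists_adaptedDensity_le (hdeg : 2 ≤ ratDegree f) (hinf : OnePoint.infty ∉ juliaSet f)
    {θ : ℝ} (hθ : 0 ≤ θ) (n : ℕ) : ∃ B, ∀ z ∈ juliaPlane f, adaptedDensity f θ n z ≤ B := by
  have hcont : ContinuousOn (deriv (planeMap f)) (juliaPlane f) := fun z hz =>
    (analyticAt_planeMap (denom_ne_zero_of_mem_julia hdeg hinf hz)).deriv.continuousAt.continuousWithinAt
  obtain ⟨M, hM⟩ := (isCompact_juliaPlane hinf).exists_bound_of_continuousOn hcont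
  refine ⟨∑ k ∈ Finset.range n, θ ^ k * ∏ j ∈ Finset.range k, M, fun z hz => ?_⟩
  unfold adaptedDensity
  gcongr with k _ j _
  exact hM _ (iterate_mem_julia hdeg hinf hz j)

lemma IsInverseBranches.mem_julia (h : IsInverseBranches f V g) (hdeg : 2 ≤ ratDegree f) {z : ℂ}
    (hz : z ∈ juliaPlane f) (i : Fin (ratDegree f)) : g i z ∈ juliaPlane f :=
  mem_julia_of_ratMap_eq hdeg hz
    (ratMap_coe_eq_coe_iff.2 (h.planeMap_apply (h.julia_subset hz) i))

lemma IsInverseBranches.exists_eq (h : IsInverseBranches f V g) (hdeg : 2 ≤ ratDegree f)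
    (hinf : OnePoint.infty ∉ juliaSet f) {z : ℂ} (hz : z ∈ juliaPlane f) :
    ∃ i, ∃ w ∈ juliaPlane f, g i w = z := by
  have hw := planeMap_mem_julia hdeg hinf hz
  have h1 : (z : OnePoint ℂ) ∈ ratMap f ⁻¹' {(planeMap f z : OnePoint ℂ)} :=
    ratMap_coe_of_ne (denom_ne_zero_of_mem_julia hdeg hinf hz)
  rw [h.preimage_eq _ (h.julia_subset hw)] at h1
  obtain ⟨i, hi⟩ := h1
  exact ⟨i, _, hw, OnePoint.coe_eq_coe.1 hi⟩

/-- By the chain rule, passing from `z` to `g i z` shifts the terms of the density by one and yields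
the factor `θ`. The only new term is `|g'|`. It is dominated by the term dropped at the other end,
because `1 ≤ θ ^ (n + 1) * κ`. -/
lemma IsInverseBranches.mul_adaptedDensity_le (h : IsInverseBranches f V g)
    (hdeg : 2 ≤ ratDegree f) {θ κ : ℝ} (hθ : 0 ≤ θ) {n : ℕ} (hθκ : 1 ≤ θ ^ (n + 1) * κ)
    (hκ : ∀ z ∈ juliaPlane f,
      κ ≤ ∏ k ∈ Finset.range (n + 1), ‖deriv (planeMap f) ((planeMap f)^[k] z)‖)
    {z : ℂ} (hz : z ∈ juliaPlane f) (i : Fin (ratDegree f)) :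
    ‖deriv (g i) z‖ * adaptedDensity f θ (n + 1) (g i z) ≤ θ * adaptedDensity f θ (n + 1) z := by
  have hzV := h.julia_subset hz
  have hprod : ∀ k, ∏ j ∈ Finset.range (k + 1), ‖deriv (planeMap f) ((planeMap f)^[j] (g i z))‖ =
      (∏ j ∈ Finset.range k, ‖deriv (planeMap f) ((planeMap f)^[j] z)‖) *
        ‖deriv (planeMap f) (g i z)‖ := by
    intro k
    rw [Finset.prod_range_succ']
    simp only [Function.iterate_succ_apply, (h.planeMap_apply hzV i).2, Function.iterate_zero, id]
  have hinv : ‖deriv (planeMap f) (g i z)‖ * ‖deriv (g i) z‖ = 1 := by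
    rw [← norm_mul, h.deriv_mul_deriv hzV, norm_one]
  have e1 : ‖deriv (g i) z‖ * adaptedDensity f θ (n + 1) (g i z) = ‖deriv (g i) z‖ +
      θ * ∑ k ∈ Finset.range n, θ ^ k *
        ∏ j ∈ Finset.range k, ‖deriv (planeMap f) ((planeMap f)^[j] z)‖ := by
    rw [adaptedDensity, Finset.sum_range_succ']
    simp only [hprod, Finset.range_zero, Finset.prod_empty, pow_zero, mul_one]
    rw [mul_add, mul_one, add_comm, Finset.mul_sum, Finset.mul_sum]
    congr 1
    refine Finset.sum_congr rfl fun k _ => ?_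
    linear_combination (θ ^ (k + 1) *
      ∏ j ∈ Finset.range k, ‖deriv (planeMap f) ((planeMap f)^[j] z)‖) * hinv
  rw [e1, adaptedDensity, Finset.sum_range_succ, mul_add, add_comm]
  gcongr
  have h1 := hκ _ (h.mem_julia hdeg hz i)
  rw [hprod] at h1
  set P := ∏ j ∈ Finset.range n, ‖deriv (planeMap f) ((planeMap f)^[j] z)‖
  calc ‖deriv (g i) z‖ ≤ ‖deriv (g i) z‖ * (θ ^ (n + 1) * κ) :=
        le_mul_of_one_le_right (norm_nonneg _) hθκ
    _ ≤ ‖deriv (g i) z‖ * (θ ^ (n + 1) * (P * ‖deriv (planeMap f) (g i z)‖)) := by gcongr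
    _ = θ * (θ ^ n * P) := by linear_combination (θ ^ (n + 1) * P) * hinv

/-- A metric on the Julia set in which the inverse branches of a hyperbolic map contract. -/
lemma IsInverseBranches.exists_adapted (h : IsInverseBranches f V g) (hdeg : 2 ≤ ratDegree f)
    (hinf : OnePoint.infty ∉ juliaSet f) (hhyp : IsHyperbolic f) :
    ∃ (θ B : ℝ) (ρ : ℂ → ℝ), 0 < θ ∧ θ < 1 ∧ 1 ≤ B ∧ (∀ z, 1 ≤ ρ z) ∧
      (∀ z ∈ juliaPlane f, ρ z ≤ B) ∧
      ∀ i, ∀ z ∈ juliaPlane f, ‖deriv (g i) z‖ * ρ (g i z) ≤ θ * ρ z := by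
  obtain ⟨n, hn, κ, hκ1, hκ⟩ := hhyp.exists_prod hdeg hinf
  obtain ⟨n, rfl⟩ : ∃ k, n = k + 1 := ⟨n - 1, by omega⟩
  have hev : ∀ᶠ θ : ℝ in 𝓝[<] 1, 0 < θ ∧ 1 < θ ^ (n + 1) * κ := by
    refine nhdsWithin_le_nhds ((lt_mem_nhds one_pos).and ?_)
    have hc : ContinuousAt (fun θ : ℝ => θ ^ (n + 1) * κ) 1 := by fun_prop
    exact hc.eventually_const_lt (by simpa using hκ1)
  obtain ⟨θ, ⟨hθ0, hθκ⟩, hθ1⟩ := (hev.and self_mem_nhdsWithin).exists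
  obtain ⟨B, hB⟩ := exists_adaptedDensity_le hdeg hinf hθ0.le (n + 1)
  exact ⟨θ, max B 1, adaptedDensity f θ (n + 1), hθ0, hθ1, le_max_right _ _,
    one_le_adaptedDensity hθ0.le hn, fun z hz => (hB z hz).trans (le_max_left _ _),
    fun i z hz => h.mul_adaptedDensity_le hdeg hθ0.le hθκ.le hκ hz i⟩

/-- The pieces `g i (J)` of the Julia set have positive distance. -/
lemma IsInverseBranches.exists_separation (h : IsInverseBranches f V g)
    (hinf : OnePoint.infty ∉ juliaSet f) : ∃ δ > 0, ∀ i j, i ≠ j →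
      ∀ z ∈ juliaPlane f, ∀ w ∈ juliaPlane f, δ ≤ ‖g i z - g j w‖ := by
  have hJ := isCompact_juliaPlane hinf
  have hK : ∀ i, IsCompact (g i '' juliaPlane f) := fun i => hJ.image_of_continuousOn
    ((h.differentiableOn i).continuousOn.mono h.julia_subset)
  have key : ∀ i j, ∃ δ : ℝ, 0 < δ ∧ (i ≠ j →
      ∀ z ∈ juliaPlane f, ∀ w ∈ juliaPlane f, δ ≤ ‖g i z - g j w‖) := by
    intro i j
    by_cases hij : i = j
    · exact ⟨1, one_pos, fun hne => (hne hij).elim⟩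
    have hdisj : Disjoint (g i '' juliaPlane f) (g j '' juliaPlane f) := by
      rw [disjoint_left]
      rintro _ ⟨z, hz, rfl⟩ ⟨w, hw, hwz⟩
      have e : w = z := by
        rw [← (h.planeMap_apply (h.julia_subset hw) j).2, hwz,
          (h.planeMap_apply (h.julia_subset hz) i).2]
      subst e
      exact hij (h.injective w (h.julia_subset hw) hwz).symm
    obtain ⟨δ, hδ, hlt⟩ := hdisj.exists_thickenings (hK i) (hK j).isClosed
    refine ⟨δ, hδ, fun _ z hz w hw => ?_⟩
    by_contra! hcon
    refine disjoint_left.1 hlt (Metric.self_subset_thickening hδ _ (mem_image_of_mem _ hz)) ?_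
    rw [Metric.mem_thickening_iff]
    exact ⟨g j w, mem_image_of_mem _ hw, by rwa [dist_eq_norm]⟩
  choose δ hδ hd using key
  rcases isEmpty_or_nonempty (Fin (ratDegree f) × Fin (ratDegree f)) with he | hne
  · exact ⟨1, one_pos, fun i j => (he.false (i, j)).elim⟩
  obtain ⟨p, hp⟩ := Finite.exists_min fun q : Fin (ratDegree f) × Fin (ratDegree f) => δ q.1 q.2
  exact ⟨δ p.1 p.2, hδ _ _, fun i j hij z hz w hw => (hp (i, j)).trans (hd i j hij z hz w hw)⟩

/-- Every neighbourhood of the Julia set contains an admissible domain. -/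
theorem IsHolomorphicExtension.exists_isAdmissible {Ω : Set (ℂ × ℂ)}
    {G : Fin (ratDegree f) → ℂ × ℂ → ℂ × ℂ} {Λ : Fin (ratDegree f) → ℂ × ℂ → ℂ}
    (hE : IsHolomorphicExtension f V g Ω G Λ) (h : IsInverseBranches f V g)
    (hdeg : 2 ≤ ratDegree f) (hinf : OnePoint.infty ∉ juliaSet f) (hhyp : IsHyperbolic f)
    {W : Set (ℂ × ℂ)} (hW : IsOpen W) (hJW : juliaReal f ⊆ W) :
    ∃ D : Fin (ratDegree f) → TopologicalSpace.Opens (ℂ × ℂ),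
      IsAdmissible f g Ω G D ∧
      juliaReal f ⊆ ((⨆ i, D i : TopologicalSpace.Opens (ℂ × ℂ)) : Set (ℂ × ℂ)) ∧
      ((⨆ i, D i : TopologicalSpace.Opens (ℂ × ℂ)) : Set (ℂ × ℂ)) ⊆ W := by
  obtain ⟨θ, B, ρ, hθ0, hθ1, hB1, hρ1, hρB, hρ⟩ := h.exists_adapted hdeg hinf hhyp
  obtain ⟨r, hr, C, hC, hG⟩ := hE.exists_coordNorm_le h hinf
  obtain ⟨d, hd, hsep⟩ := h.exists_separation hinf
  have hcpt := IsHolomorphicExtension.isCompact_juliaReal hinf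
  obtain ⟨t, ht, hsub⟩ := hcpt.exists_cthickening_subset_open (hE.isOpen.inter hW)
    (subset_inter hE.julia_subset hJW)
  -- One `δ` pays for the closure of the domain, another for the quadratic error of the extended
  -- map. With `θ = 1 - 4 * δ` the product in `hδθ` is `1 - 2 * δ - 3 * δ ^ 2`.
  set δ : ℝ := (1 - θ) / 4 with hδ
  have hδ0 : 0 < δ := by rw [hδ]; linarith
  have hδ1 : δ ≤ 1 := by rw [hδ]; linarith
  have hδθ : (θ + δ) * (1 + δ) < 1 := by
    have : θ = 1 - 4 * δ := by rw [hδ]; ring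
    rw [this]
    nlinarith
  have hB0 : 0 < B := one_pos.trans_le hB1
  -- a small radius
  obtain ⟨ε, hε, hεr, hεC, hεd, hεt⟩ : ∃ ε : ℝ, 0 < ε ∧ 2 * ε < r ∧ C * (2 * ε) ≤ δ / B ∧
      2 * ε < d ∧ 2 * ε < t := by
    have h1 : ∀ {c : ℝ}, 0 < c → ∀ᶠ ε : ℝ in 𝓝[>] 0, 2 * ε < c := fun hc =>
      nhdsWithin_le_nhds ((by fun_prop : ContinuousAt (fun ε : ℝ => 2 * ε) 0).eventually_lt_const
        (by simpa using hc))
    have h2 : ∀ᶠ ε : ℝ in 𝓝[>] 0, C * (2 * ε) < δ / B :=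
      nhdsWithin_le_nhds ((by fun_prop : ContinuousAt (fun ε : ℝ => C * (2 * ε)) 0).eventually_lt_const
        (by simpa using div_pos hδ0 hB0))
    have h0 : ∀ᶠ ε : ℝ in 𝓝[>] 0, 0 < ε := self_mem_nhdsWithin
    obtain ⟨ε, hε, h3, h4, h5, h6⟩ := (h0.and
      ((h1 hr).and (h2.and ((h1 hd).and (h1 ht))))).exists
    exact ⟨ε, hε, h3, h4.le, h5, h6⟩
  have hρ0 : ∀ z, 0 < ρ z := fun z => one_pos.trans_le (hρ1 z)
  have hερ : ∀ z, ε / ρ z ≤ ε := fun z => div_le_self hε.le (hρ1 z)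
  -- Around each point `y` of the piece stands a ball of radius `ε / ρ y`, that is, of radius `ε` in
  -- the adapted metric, so the rate `θ` acts directly on these radii.
  let D : Fin (ratDegree f) → TopologicalSpace.Opens (ℂ × ℂ) := fun i =>
    ⟨⋃ z ∈ juliaPlane f, {w | coordNorm (w - realEmb (g i z)) < ε / ρ (g i z)},
      isOpen_biUnion fun z _ => isOpen_lt
        (continuous_coordNorm.comp (continuous_id.sub continuous_const)) continuous_const⟩
  have hD : ∀ i w, w ∈ D i ↔ ∃ z ∈ juliaPlane f,
      coordNorm (w - realEmb (g i z)) < ε / ρ (g i z) := by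
    intro i w
    change w ∈ ⋃ z ∈ juliaPlane f, {w | coordNorm (w - realEmb (g i z)) < ε / ρ (g i z)} ↔ _
    simp only [mem_iUnion, mem_ofPred_eq, exists_prop]
  have hself : ∀ i, ∀ z ∈ juliaPlane f, realEmb (g i z) ∈ D i := by
    intro i z hz
    refine (hD i _).2 ⟨z, hz, ?_⟩
    rw [coordNorm_realEmb_sub, sub_self, norm_zero]
    exact div_pos hε (hρ0 _)
  -- points of the closure are close to the Julia set
  have hcl : ∀ w ∈ closure ((⨆ i, D i : TopologicalSpace.Opens (ℂ × ℂ)) : Set (ℂ × ℂ)),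
      ∃ y ∈ juliaPlane f, coordNorm (w - realEmb y) < (1 + δ) * (ε / ρ y) := by
    intro w hw
    obtain ⟨w', hw', hdist⟩ := Metric.mem_closure_iff.1 hw (δ * (ε / B) / 2) (by positivity)
    obtain ⟨i, hi⟩ := TopologicalSpace.Opens.mem_iSup.1 hw'
    obtain ⟨z, hz, hlt⟩ := (hD i w').1 hi
    have hy := h.mem_julia hdeg hz i
    refine ⟨g i z, hy, ?_⟩
    have h1 := coordNorm_add_le (w - w') (w' - realEmb (g i z))
    rw [sub_add_sub_cancel] at h1
    have h2 := coordNorm_le (w - w')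
    rw [dist_eq_norm] at hdist
    have h3 : δ * (ε / B) ≤ δ * (ε / ρ (g i z)) := by
      have := hρ0 (g i z)
      gcongr
      exact hρB _ hy
    linarith
  have hcl2 : ∀ y w, coordNorm (w - realEmb y) < (1 + δ) * (ε / ρ y) →
      coordNorm (w - realEmb y) < 2 * ε := by
    intro y w hlt
    refine hlt.trans_le ?_
    have := div_pos hε (hρ0 y)
    have := hερ y
    nlinarith
  have hclt : closure ((⨆ i, D i : TopologicalSpace.Opens (ℂ × ℂ)) : Set (ℂ × ℂ)) ⊆
      Metric.cthickening t (juliaReal f) := by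
    intro w hw
    obtain ⟨y, hy, hlt⟩ := hcl w hw
    refine Metric.closedBall_subset_cthickening (mem_image_of_mem realEmb hy) t ?_
    rw [mem_closedBall_iff_norm]
    exact ((norm_le_coordNorm _).trans_lt (hcl2 y w hlt)).le.trans hεt.le
  refine ⟨D, ⟨?_, ?_, ?_, hself, ?_⟩, ?_, ?_⟩
  · exact (hcpt.isBounded.cthickening).subset (subset_closure.trans hclt)
  · exact hclt.trans (hsub.trans inter_subset_left)
  · intro i j hij
    rw [disjoint_left]
    intro w hi hj
    obtain ⟨z, hz, hlt⟩ := (hD i w).1 hi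
    obtain ⟨z', hz', hlt'⟩ := (hD j w).1 hj
    have h1 := hsep i j hij z hz z' hz'
    have h2 := coordNorm_add_le (realEmb (g i z) - w) (w - realEmb (g j z'))
    rw [sub_add_sub_cancel, coordNorm_realEmb_sub, coordNorm_sub_comm] at h2
    have h3 := hερ (g i z)
    have h4 := hερ (g j z')
    linarith
  -- The nearby point `y` may belong to any piece of `J`; its image `g i y` is in piece `i`. The
  -- ball of radius `(1 + δ) * (ε / ρ y)` around `y` is mapped into the one of radius `(θ + δ) * (1
  -- + δ) * a < a` around `g i y`.
  · intro i w hw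
    obtain ⟨y, hy, hlt⟩ := hcl w hw
    have hlt2 := hcl2 y w hlt
    refine (hD i _).2 ⟨y, hy, ?_⟩
    have h1 := hG i y hy w (hlt2.trans hεr)
    set N := coordNorm (w - realEmb y) with hN
    have hN0 : 0 ≤ N := coordNorm_nonneg _
    have hgy := h.mem_julia hdeg hy i
    set a := ε / ρ (g i y) with ha
    have ha0 : 0 < a := div_pos hε (hρ0 _)
    have hy0 := div_pos hε (hρ0 y)
    have h2 : ‖deriv (g i) y‖ * (ε / ρ y) ≤ θ * a := by
      have := hρ i y hy
      rw [ha, mul_div_assoc', mul_div_assoc', div_le_div_iff₀ (hρ0 _) (hρ0 _)]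
      nlinarith
    have h3 : C * N * (ε / ρ y) ≤ δ * a := by
      calc C * N * (ε / ρ y) ≤ C * (2 * ε) * ε := by
            gcongr
            exact hερ y
        _ ≤ δ / B * ε := by gcongr
        _ = δ * (ε / B) := by ring
        _ ≤ δ * a := by
            have := hρ0 (g i y)
            rw [ha]
            gcongr
            exact hρB _ hgy
    calc coordNorm (G i w - realEmb (g i y)) ≤ (‖deriv (g i) y‖ + C * N) * N := h1
      _ ≤ (‖deriv (g i) y‖ + C * N) * ((1 + δ) * (ε / ρ y)) := by gcongr
      _ = (‖deriv (g i) y‖ * (ε / ρ y) + C * N * (ε / ρ y)) * (1 + δ) := by ring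
      _ ≤ (θ * a + δ * a) * (1 + δ) := by gcongr
      _ = (θ + δ) * (1 + δ) * a := by ring
      _ < a := mul_lt_of_lt_one_left ha0 hδθ
  · rintro _ ⟨z, hz, rfl⟩
    obtain ⟨i, w, hw, rfl⟩ := h.exists_eq hdeg hinf hz
    exact TopologicalSpace.Opens.mem_iSup.2 ⟨i, hself i w hw⟩
  · exact (subset_closure.trans hclt).trans (hsub.trans inter_subset_right)

end

end RuelleZeta

end

open RuelleZeta

theorem mainTheorem6 (f : RatFunc ℂ) (hdeg : 2 ≤ ratDegree f)
    (hinf : OnePoint.infty ∉ juliaSet f) (hdisc : IsTotallyDisconnected (juliaSet f))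
    (hhyp : IsHyperbolic f) :
    (∃ (V : Set ℂ) (g : Fin (ratDegree f) → ℂ → ℂ), IsInverseBranches f V g) ∧
    ∀ (V : Set ℂ) (g : Fin (ratDegree f) → ℂ → ℂ), IsInverseBranches f V g →
      (∃ (Ω : Set (ℂ × ℂ)) (G : Fin (ratDegree f) → ℂ × ℂ → ℂ × ℂ)
        (Λ : Fin (ratDegree f) → ℂ × ℂ → ℂ), IsHolomorphicExtension f V g Ω G Λ) ∧
      ∀ (Ω : Set (ℂ × ℂ)) (G : Fin (ratDegree f) → ℂ × ℂ → ℂ × ℂ)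
        (Λ : Fin (ratDegree f) → ℂ × ℂ → ℂ), IsHolomorphicExtension f V g Ω G Λ →
        (∀ W : Set (ℂ × ℂ), IsOpen W → juliaReal f ⊆ W →
          ∃ D : Fin (ratDegree f) → TopologicalSpace.Opens (ℂ × ℂ),
            IsAdmissible f g Ω G D ∧
            juliaReal f ⊆ ((⨆ i, D i : TopologicalSpace.Opens (ℂ × ℂ)) : Set (ℂ × ℂ)) ∧
            ((⨆ i, D i : TopologicalSpace.Opens (ℂ × ℂ)) : Set (ℂ × ℂ)) ⊆ W) ∧
        ∀ D : Fin (ratDegree f) → TopologicalSpace.Opens (ℂ × ℂ), IsAdmissible f g Ω G D →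
          ∃ L : ℂ → (bergmanSpace (⨆ i, D i) →L[ℂ] bergmanSpace (⨆ i, D i)),
            (∀ s, IsTransferOperator (⨆ i, D i) G Λ s (L s)) ∧
            (∀ s, IsTraceClass (L s)) ∧
            (∀ s, DetConverges (-(L s))) ∧
            (∃ C : ℝ, 0 < C ∧
              ∀ s : ℂ, ‖detOneAdd (-(L s))‖ ≤ C * Real.exp (C * ‖s‖ ^ 3)) ∧
            Differentiable ℂ (fun s : ℂ => detOneAdd (-(L s))) ∧
            entireOrder (fun s : ℂ => detOneAdd (-(L s))) ≤ 3 := by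
  refine ⟨exists_isInverseBranches hhyp hdeg hinf hdisc, fun V g hg =>
    ⟨hg.exists_isHolomorphicExtension, fun Ω G Λ hE =>
      ⟨fun W hW hJW => hE.exists_isAdmissible hg hdeg hinf hhyp hW hJW, fun D hD => ?_⟩⟩⟩
  obtain ⟨K, B, hB, hK⟩ := hD.exists_isContractingSystem hE
  exact hK.exists_transferOperator_det hB
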